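/- **Setting.** Consider the system $x_{t+1}=Ax_t+Bu_t+w_t$, $x_t\in\mathbb R^n$, $u_t\in\mathbb R^m$, where $(w_t)$ is i.i.d. and uniformly bounded ($\|w_t\|\le v$ almost surely for some $v>0$), with mean $\bar w$ and covariance $W\succ0$; the initial state is independent of the noise and has a finite second moment. Let $Q\succeq0$, $R\succ0$, $(A,B)$ controllable, $(A,Q^{1/2})$ observable. Put $M_3=\mathbb E[(w_t-\bar w)(w_t-\bar w)^\top Q(w_t-\bar w)]$, $m_4=\mathbb E[((w_t-\bar w)^\top Q(w_t-\bar w)-\operatorname{tr}(WQ))^2]$ and $\bar\rho=\rho-m_4+4\operatorname{tr}((WQ)^2)$ for a risk tolerance $\rho$. A policy $X=[K,l]\in\mathbb R^{m\times(n+1)}$ acts by $u_t=-Kx_t+l$; $\mathcal S$ is the set of policies for which $A-BK$ has spectral radius $<1$. Norms and gradients of policies are Euclidean (Frobenius). For $X\in\mathcal S$ and fixed $\mu\ge0$ let $$\mathcal L(X,\mu)=J(X)+\mu(J_c(X)-\bar\rho),$$ $$J(X)=\lim_{T\to\infty}\tfrac1T\mathbb E\sum_{t<T}(x_t^\top Qx_t+u_t^\top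 Ru_t),\qquad J_c(X)=\lim_{T\to\infty}\tfrac1T\mathbb E\sum_{t<T}(4x_t^\top QWQx_t+4x_t^\top QM_3),$$ and $\mathcal L^*(\mu)=\min_{X\in\mathcal S}\mathcal L(X,\mu)$. The oracle returns, from one sampled trajectory under $X$, $\widehat{\mathcal L}(X,\mu)=\lim_{T\to\infty}\frac1T\sum_{t<T}c_\mu(x_t,u_t)$ with $c_\mu(x,u)=x^\top(Q+4\mu QWQ)x+4\mu x^\top QM_3+u^\top Ru-\mu\bar\rho$. **Algorithm.** Start from $X^{(0)}\in\mathcal S$. At step $i$ sample $U^{(i)}$ uniformly from the unit sphere of $\mathbb R^{m\times(n+1)}$ and a fresh trajectory, independently of each other and of the past; set $$\widehat{\nabla_X\mathcal L}=\tfrac{m(n+1)}{r}\,\widehat{\mathcal L}(X^{(i)}+rU^{(i)},\mu)\,U^{(i)},\qquad X^{(i+1)}=X^{(i)}-\eta\,\widehat{\nabla_X\mathcal L}.$$ **Constants.** Let $\Delta_0=\mathcal L(X^{(0)},\mu)-\mathcal L^*(\mu)$ and $\mathcal S_{10}=\{X\in\mathcal S:\mathcal L(X,\mu)-\mathcal L(X^{(0)},\mu)\le10\Delta_0\}$.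 Let $\lambda_0>0$ satisfy $\mathcal L(X,\mu)-\mathcal L^*(\mu)\le\lambda_0\|\nabla_X\mathcal L(X,\mu)\|^2$ on $\mathcal S_{10}$. For $X\in\mathcal S$ let $\xi_X,\beta_X,\gamma_X>0$ be such that, for all $X'\in\mathcal S$ with $\|X'-X\|\le\gamma_X$, $|\mathcal L(X',\mu)-\mathcal L(X,\mu)|\le\xi_X\|X'-X\|$ and $\|\nabla_X\mathcal L(X',\mu)-\nabla_X\mathcal L(X,\mu)\|\le\beta_X\|X'-X\|$; let $\xi_0,\beta_0$ be the (finite) suprema of $\xi_X,\beta_X$ and $\gamma_0$ the infimum of $\gamma_X$ over $\mathcal S_{10}$; $\theta_0=\min\{1/(2\beta_0),\gamma_0/\xi_0\}$. Let $G_\infty$ be the supremum over $X\in\mathcal S_{10}$ of the essential supremum of $\|\widehat{\nabla_X\mathcal L}\|$, and $G_2=\sup_{X\in\mathcal S_{10}}\mathbb E\|\widehat{\nabla_X\mathcal L}-\mathbb E[\widehat{\nabla_X\mathcal L}]\|^2$. **Theorem.** Such constants $\lambda_0,\xi_X,\beta_X,\gamma_X$ with $\xi_0,\beta_0<\infty$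 and $\gamma_0>0$ exist. For every choice of them, $G_\infty$ and $G_2$ are finite for all $0<r\le\gamma_0$, and the following holds. Let $\epsilon,\eta,r>0$ satisfy $$\eta\le\min\Big\{\frac{\epsilon}{240\lambda_0\beta_0G_2},\frac1{2\beta_0},\frac{\gamma_0}{G_\infty}\Big\},\qquad r\le\min\Big\{\frac{\theta_0}{8\lambda_0\beta_0}\sqrt{\frac{\epsilon}{15}},\frac1{2\beta_0}\sqrt{\frac{\epsilon}{30\lambda_0}},\gamma_0\Big\},\qquad \epsilon\log\frac{120\Delta_0}{\epsilon}<\frac{10\Delta_0}{3}.$$ Then for every integer $N\ge0$ with $$\frac{4\lambda_0}{\eta}\log\frac{120\Delta_0}{\epsilon}\ \le\ N\ \le\ \frac{100\,\lambda_0\Delta_0}{\eta\,\epsilon}+1$$ (in particular for the least integer $N\ge0$ satisfying the lower bound), with probability greater than $3/4$ the policy $X^{(N)}$ lies in $\mathcal S$ and $\mathcal L(X^{(N)},\mu)-\mathcal L^*(\mu)\le\epsilon$. -/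

import Mathlib

open MeasureTheory Filter Topology Matrix

noncomputable section

namespace RCLQR

/-- Kalman controllability of `(A, B)`: the block matrix `[B, AB, …, A^(n-1) B]` has rank `n`. -/
def Controllable {n m : ℕ} (A : Matrix (Fin n) (Fin n) ℝ) (B : Matrix (Fin n) (Fin m) ℝ) : Prop :=
  (Matrix.of fun (i : Fin n) (p : Fin n × Fin m) => (A ^ (p.1 : ℕ) * B) i p.2).rank = n

/-- Kalman observability of `(A, C)`: the stacked matrix `[C; CA; …; C A^(n-1)]` has rank `n`. -/
def Observable {n p : ℕ} (A : Matrix (Fin n) (Fin n) ℝ) (C : Matrix (Fin p) (Fin n) ℝ) : Prop :=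
  (Matrix.of fun (q : Fin n × Fin p) (j : Fin n) => (C * A ^ (q.1 : ℕ)) q.2 j).rank = n

section Sqrt
open scoped MatrixOrder Matrix.Norms.L2Operator

/-- The positive semidefinite square root of a positive semidefinite real matrix. -/
def matSqrt {n : ℕ} (Q : Matrix (Fin n) (Fin n) ℝ) : Matrix (Fin n) (Fin n) ℝ := CFC.sqrt Q

end Sqrt

/-- The data of a risk-constrained linear quadratic regulator: the system `x⁺ = A x + B u + w`,
the weights `Q`, `R`, the common law of the i.i.d. noise vectors `w_t`, the law of the initial
state, and the risk tolerance. -/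
structure Model (n m : ℕ) where
  A : Matrix (Fin n) (Fin n) ℝ
  B : Matrix (Fin n) (Fin m) ℝ
  Q : Matrix (Fin n) (Fin n) ℝ
  R : Matrix (Fin m) (Fin m) ℝ
  noiseLaw : Measure (Fin n → ℝ)
  initLaw : Measure (Fin n → ℝ)
  tol : ℝ

/-- Policies `X = [K, l]`, as `m × (n + 1)` real matrices with the Euclidean (Frobenius) norm. -/
abbrev Policy (n m : ℕ) := EuclideanSpace ℝ (Fin m × Fin (n + 1))

/-- The gain `K`: the first `n` columns of the policy. -/
def gain {n m : ℕ} (X : Policy n m) : Matrix (Fin m) (Fin n) ℝ :=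
  Matrix.of fun i j => X (i, j.castSucc)

/-- The offset `l`: the last column of the policy. -/
def offset {n m : ℕ} (X : Policy n m) : Fin m → ℝ := fun i => X (i, Fin.last n)

/-- Randomness of one trajectory: the initial state and the noise sequence. -/
abbrev Path (n : ℕ) := (Fin n → ℝ) × (ℕ → Fin n → ℝ)

/-- Randomness of one iteration of random search: the direction on the unit (Frobenius) sphere and
the randomness of the trajectory sampled by the oracle. -/
abbrev Draw (n m : ℕ) := Metric.sphere (0 : Policy n m) 1 × Path n

/-- The uniform probability measure on the unit sphere of policies. -/
def sphereUniform (n m : ℕ) : Measure (Metric.sphere (0 : Policy n m) 1) :=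
  ProbabilityTheory.cond ((volume : Measure (Policy n m)).toSphere) Set.univ

namespace Model

variable {n m : ℕ} (M : Model n m)

/-- Mean of the noise. -/
def wbar : Fin n → ℝ := fun i => ∫ w, w i ∂M.noiseLaw

/-- Covariance matrix of the noise. -/
def W : Matrix (Fin n) (Fin n) ℝ :=
  Matrix.of fun i j => ∫ w, (w i - M.wbar i) * (w j - M.wbar j) ∂M.noiseLaw

/-- The third-moment vector `E[(w - w̄)(w - w̄)ᵀ Q (w - w̄)]`. -/
def M3 : Fin n → ℝ := fun i =>
  ∫ w, (w i - M.wbar i) * ((w - M.wbar) ⬝ᵥ (M.Q *ᵥ (w - M.wbar))) ∂M.noiseLaw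

/-- The fourth-moment number `E[((w - w̄)ᵀ Q (w - w̄) - tr(WQ))²]`. -/
def m4 : ℝ :=
  ∫ w, ((w - M.wbar) ⬝ᵥ (M.Q *ᵥ (w - M.wbar)) - (M.W * M.Q).trace) ^ 2 ∂M.noiseLaw

/-- The reshaped risk tolerance `ρ̄ = ρ - m₄ + 4 tr((WQ)²)`. -/
def tolBar : ℝ := M.tol - M.m4 + 4 * ((M.W * M.Q) ^ 2).trace

/-- Standing assumptions, including uniform boundedness of the noise (in Euclidean norm). -/
structure Standing : Prop where
  Q_psd : M.Q.PosSemidef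
  R_pd : M.R.PosDef
  controllable : Controllable M.A M.B
  observable : Observable M.A (matSqrt M.Q)
  noise_prob : IsProbabilityMeasure M.noiseLaw
  noise_bounded : ∃ v : ℝ, 0 < v ∧ ∀ᵐ w ∂M.noiseLaw, Real.sqrt (w ⬝ᵥ w) ≤ v
  W_pd : M.W.PosDef
  init_prob : IsProbabilityMeasure M.initLaw
  init_sq : MemLp (fun x : Fin n → ℝ => x) 2 M.initLaw

/-- The set `𝒮` of stabilizing policies: the spectral radius of `A - BK` is less than one. -/
def stab : Set (Policy n m) :=
  {X | spectralRadius ℂ ((M.A - M.B * gain X).map (algebraMap ℝ ℂ)) < 1}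

/-- The control input of the policy `X` in state `x`. -/
def input (X : Policy n m) (x : Fin n → ℝ) : Fin m → ℝ := offset X - gain X *ᵥ x

/-- The closed-loop state trajectory under the policy `X`. -/
def state (X : Policy n m) (ω : Path n) : ℕ → Fin n → ℝ
  | 0 => ω.1
  | t + 1 => M.A *ᵥ state X ω t + M.B *ᵥ input X (state X ω t) + ω.2 t

/-- The law of one trajectory's randomness: an initial state independent of i.i.d. noise. -/
def pathLaw : Measure (Path n) :=
  M.initLaw.prod (Measure.infinitePi fun _ : ℕ => M.noiseLaw)

/-- The limiting time-averaged expected value of a stage cost under the policy `X`. -/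
def avgCost (c : (Fin n → ℝ) → (Fin m → ℝ) → ℝ) (X : Policy n m) : ℝ :=
  limUnder atTop fun T : ℕ => (T : ℝ)⁻¹ *
    ∫ ω, ∑ t ∈ Finset.range T, c (M.state X ω t) (input X (M.state X ω t)) ∂M.pathLaw

/-- The quadratic cost `J`. -/
def J (X : Policy n m) : ℝ :=
  M.avgCost (fun x u => x ⬝ᵥ (M.Q *ᵥ x) + u ⬝ᵥ (M.R *ᵥ u)) X

/-- The risk functional `J_c`. -/
def Jc (X : Policy n m) : ℝ :=
  M.avgCost (fun x _ => 4 * (x ⬝ᵥ ((M.Q * M.W * M.Q) *ᵥ x)) + 4 * (x ⬝ᵥ (M.Q *ᵥ M.M3))) X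

/-- The Lagrangian `L(X, μ) = J(X) + μ (J_c(X) - ρ̄)` (meaningful on `M.stab`). -/
def lagr (μ : ℝ) (X : Policy n m) : ℝ := M.J X + μ * (M.Jc X - M.tolBar)

/-- The minimal Lagrangian `L*(μ)` over stabilizing policies. -/
def lagrMin (μ : ℝ) : ℝ := sInf (M.lagr μ '' M.stab)

/-- `Q_μ = Q + 4 μ Q W Q`. -/
def Qmu (μ : ℝ) : Matrix (Fin n) (Fin n) ℝ := M.Q + (4 * μ) • (M.Q * M.W * M.Q)

/-- `S = 2 μ Q M₃`. -/
def Svec (μ : ℝ) : Fin n → ℝ := (2 * μ) • (M.Q *ᵥ M.M3)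

/-- The reshaped stage cost `c_μ`. -/
def stageCost (μ : ℝ) (x : Fin n → ℝ) (u : Fin m → ℝ) : ℝ :=
  x ⬝ᵥ (M.Qmu μ *ᵥ x) + 2 * (x ⬝ᵥ M.Svec μ) + u ⬝ᵥ (M.R *ᵥ u) - μ * M.tolBar

/-- The oracle: the limiting time average of the reshaped cost along one sampled trajectory. -/
def oracle (μ : ℝ) (X : Policy n m) (ω : Path n) : ℝ :=
  limUnder atTop fun T : ℕ => (T : ℝ)⁻¹ *
    ∑ t ∈ Finset.range T, M.stageCost μ (M.state X ω t) (input X (M.state X ω t))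

/-- The one-point gradient estimate `(d / r) L̂(X + rU, μ) U`, where `d = m (n + 1)` is the
dimension of the space of policies. -/
def gradEst (μ r : ℝ) (X : Policy n m) (d : Draw n m) : Policy n m :=
  (((m * (n + 1) : ℕ) : ℝ) / r * M.oracle μ (X + r • (d.1 : Policy n m)) d.2) •
    (d.1 : Policy n m)

/-- The iterates of random search, driven by one draw per iteration. -/
def iter (μ η r : ℝ) (X₀ : Policy n m) (ds : ℕ → Draw n m) : ℕ → Policy n m
  | 0 => X₀
  | i + 1 => iter μ η r X₀ ds i - η • M.gradEst μ r (iter μ η r X₀ ds i) (ds i)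

/-- The law of a single draw: a uniform direction independent of the sampled trajectory. -/
def drawLaw : Measure (Draw n m) := (sphereUniform n m).prod M.pathLaw

/-- The law of the whole run: the draws of different iterations are independent. -/
def runLaw : Measure (ℕ → Draw n m) := Measure.infinitePi fun _ : ℕ => M.drawLaw

/-- The initial optimality gap `Δ₀`. -/
def gap₀ (μ : ℝ) (X₀ : Policy n m) : ℝ := M.lagr μ X₀ - M.lagrMin μ

/-- The sublevel set `𝒮₁₀`. -/
def sub10 (μ : ℝ) (X₀ : Policy n m) : Set (Policy n m) :=
  {X | X ∈ M.stab ∧ M.lagr μ X - M.lagr μ X₀ ≤ 10 * M.gap₀ μ X₀}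

/-- `lam` is a gradient dominance constant of the Lagrangian over the set `D`. -/
def GradDominated (μ : ℝ) (D : Set (Policy n m)) (lam : ℝ) : Prop :=
  0 < lam ∧ ∀ X ∈ D, M.lagr μ X - M.lagrMin μ ≤ lam * ‖gradient (M.lagr μ) X‖ ^ 2

/-- `(ξ_X, β_X, γ_X)` are positive local Lipschitz constants of the Lagrangian and its gradient
at every stabilizing policy `X`. -/
def LocalLipschitz (μ : ℝ) (ξ β γ : Policy n m → ℝ) : Prop :=
  ∀ X ∈ M.stab, 0 < ξ X ∧ 0 < β X ∧ 0 < γ X ∧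
    ∀ X' ∈ M.stab, ‖X' - X‖ ≤ γ X →
      |M.lagr μ X' - M.lagr μ X| ≤ ξ X * ‖X' - X‖ ∧
      ‖gradient (M.lagr μ) X' - gradient (M.lagr μ) X‖ ≤ β X * ‖X' - X‖

/-- `G_∞`: the supremum over `𝒮₁₀` of the essential supremum of the estimate's norm. -/
def Ginf (μ r : ℝ) (X₀ : Policy n m) : ENNReal :=
  ⨆ X ∈ M.sub10 μ X₀, essSup (fun d => ‖M.gradEst μ r X d‖ₑ) M.drawLaw

/-- `G₂`: the supremum over `𝒮₁₀` of the variance of the estimate. -/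
def G2 (μ r : ℝ) (X₀ : Policy n m) : ENNReal :=
  ⨆ X ∈ M.sub10 μ X₀,
    ∫⁻ d, ‖M.gradEst μ r X d - ∫ d', M.gradEst μ r X d' ∂M.drawLaw‖ₑ ^ 2 ∂M.drawLaw

end Model

end RCLQR

end

/-! The oracle is exact with probability one. Under a stabilizing policy the bounded noise keeps the
closed loop bounded, and a law of large numbers makes the time averages of a quadratic cost converge
along almost every trajectory to a deterministic number. By dominated convergence the expected
averages have the same limit. So the Lagrangian and, almost surely, the oracle are both given by the
smooth closed form `lagrForm` (`lagr_eq`, `ae_tendsto_stageCost`), and the only randomness left in a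
search step is the direction on the sphere.

The landscape is studied in the coordinates z = [-x; 1], in which the affine policy is the linear
feedback u = Xz. A Bellman equation gives the exact cost-difference formula
`exists_lagrForm_sub_gradient`: L(X+D) - L(X) is tr(Dᵀ(R+H)DΦ) + 2 tr(DᵀEΦ), with Φ the stationary
second moment of z under X+D, while the gradient at X is 2E times the second moment under X.
Completing the square in D gives gradient dominance, with a constant depending only on bounds for R
and the second moments. These bounds are uniform because sublevel sets are compact inside the open
set of stabilizing policies (`isCompact_sublevel`): positivity of W and R together with
observability bounds the policies and the cost-to-go matrices, and a uniform observability Gramian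
then forces a uniform contraction rate. Compactness also yields a minimizer and uniform local
Lipschitz constants. It further shows that a ball on which the Lagrangian is Lipschitz cannot leave
the stabilizing set (`closedBall_subset_stab`).

The mean of the one-point estimate differs from the gradient by at most β₀r
(`abs_sphere_moment_sub_le`). Rotation invariance of the surface measure gives a differential
equation in the radius for the first spherical moments, and comparing its solution with the linear
part of the function bounds the bias.

Inside the sublevel set the descent inequality, gradient dominance and the bounds on bias and
variance show that one step multiplies the expected gap by 1 - η/(2λ₀), up to a drift η/(2λ₀) · ε/80
(`lintegral_potential_step_le`). The iteration is coupled with a copy frozen when the gap exceeds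
11Δ₀. Two applications of Markov's inequality finish: one bounds the chance of having left the
sublevel set before the last step, the other the chance that the final gap exceeds ε
(`measure_stopped_compl_le`). Their sum is below 1/4. -/

namespace RCLQR

/-! ### Schur stability and the discrete Lyapunov equation -/

section Schur

open scoped Matrix.Norms.Operator

variable {n : ℕ}

theorem norm_map_algebraMap (F : Matrix (Fin n) (Fin n) ℝ) :
    ‖F.map (algebraMap ℝ ℂ)‖ = ‖F‖ := by
  simp [Matrix.linfty_opNorm_def]

/-- The spectral radius of a power dominates the power of the spectral radius and is at most the
norm. A single power of norm below one therefore certifies stability, and this certificate is an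
open condition. -/
theorem spectralRadius_lt_one_of_norm_pow_lt_one {F : Matrix (Fin n) (Fin n) ℝ} {k : ℕ}
    (hk : k ≠ 0) (h : ‖F ^ k‖ < 1) : spectralRadius ℂ (F.map (algebraMap ℝ ℂ)) < 1 := by
  have h1 : ‖(F.map (algebraMap ℝ ℂ)) ^ k‖ < 1 := by
    rwa [← Matrix.map_pow, norm_map_algebraMap]
  have h2 : spectralRadius ℂ ((F.map (algebraMap ℝ ℂ)) ^ k) < 1 := by
    rcases isEmpty_or_nonempty (Fin n) with hn | hn
    · have : Subsingleton (Matrix (Fin n) (Fin n) ℂ) := inferInstance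
      rw [spectrum.SpectralRadius.of_subsingleton]; simp
    · refine (spectrum.spectralRadius_le_nnnorm _).trans_lt ?_
      have h1' : ‖(F.map (algebraMap ℝ ℂ)) ^ k‖₊ < 1 := h1
      exact_mod_cast h1'
  have h3 := (spectrum.spectralRadius_pow_le (𝕜 := ℂ) (F.map (algebraMap ℝ ℂ)) k hk).trans_lt h2
  by_contra hcon
  rw [not_lt] at hcon
  exact absurd h3 (not_lt.mpr (one_le_pow₀ hcon))

/-- By Gelfand's formula the powers are eventually below a geometric sequence with ratio strictly
between the spectral radius and one. -/
theorem summable_norm_pow_of_spectralRadius_lt_one {F : Matrix (Fin n) (Fin n) ℝ}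
    (h : spectralRadius ℂ (F.map (algebraMap ℝ ℂ)) < 1) :
    Summable fun t : ℕ => ‖F ^ t‖ := by
  obtain ⟨q, hq1, hq2⟩ := ENNReal.lt_iff_exists_nnreal_btwn.mp h
  have hT := spectrum.pow_nnnorm_pow_one_div_tendsto_nhds_spectralRadius
    (F.map (algebraMap ℝ ℂ))
  have hev := hT.eventually (gt_mem_nhds hq1)
  have hq2' : (q : ℝ) < 1 := by exact_mod_cast hq2
  refine summable_of_isBigO_nat (summable_geometric_of_lt_one q.2 hq2') ?_
  refine Asymptotics.IsBigO.of_bound 1 ?_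
  filter_upwards [hev, eventually_gt_atTop 0] with t ht ht0
  have h1 : (‖(F.map (algebraMap ℝ ℂ)) ^ t‖₊ : ENNReal) < (q : ENNReal) ^ t := by
    have := ENNReal.rpow_lt_rpow ht (show (0 : ℝ) < t by exact_mod_cast ht0)
    rwa [← ENNReal.rpow_mul, one_div, inv_mul_cancel₀ (by exact_mod_cast ht0.ne'),
      ENNReal.rpow_one, ENNReal.rpow_natCast] at this
  have h2 : ‖(F.map (algebraMap ℝ ℂ)) ^ t‖ < (q : ℝ) ^ t := by exact_mod_cast h1
  rw [← Matrix.map_pow, norm_map_algebraMap] at h2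
  rw [norm_norm, one_mul, Real.norm_of_nonneg (pow_nonneg q.2 t)]
  exact h2.le

/-- A square matrix is Schur stable when its powers tend to zero. -/
def Schur (F : Matrix (Fin n) (Fin n) ℝ) : Prop := Tendsto (fun t : ℕ => F ^ t) atTop (𝓝 0)

theorem spectralRadius_lt_one_iff {F : Matrix (Fin n) (Fin n) ℝ} :
    spectralRadius ℂ (F.map (algebraMap ℝ ℂ)) < 1 ↔ Schur F := by
  constructor
  · intro h
    exact tendsto_zero_iff_norm_tendsto_zero.mpr (summable_norm_pow_of_spectralRadius_lt_one h).tendsto_atTop_zero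
  · intro h
    have h1 := (tendsto_zero_iff_norm_tendsto_zero.mp h).eventually (gt_mem_nhds one_pos)
    obtain ⟨k, hk, hk0⟩ := (h1.and (eventually_gt_atTop 0)).exists
    exact spectralRadius_lt_one_of_norm_pow_lt_one hk0.ne' hk

theorem Schur.summable_norm {F : Matrix (Fin n) (Fin n) ℝ} (h : Schur F) :
    Summable fun t : ℕ => ‖F ^ t‖ := summable_norm_pow_of_spectralRadius_lt_one (spectralRadius_lt_one_iff.mpr h)

theorem isOpen_schur : IsOpen {F : Matrix (Fin n) (Fin n) ℝ | Schur F} := by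
  rw [isOpen_iff_mem_nhds]
  intro F hF
  have h1 := (tendsto_zero_iff_norm_tendsto_zero.mp hF).eventually (gt_mem_nhds one_pos)
  obtain ⟨k, hk, hk0⟩ := (h1.and (eventually_gt_atTop 0)).exists
  have hc : Continuous fun G : Matrix (Fin n) (Fin n) ℝ => ‖G ^ k‖ := (continuous_pow k).norm
  filter_upwards [hc.continuousAt.eventually (gt_mem_nhds hk)] with G hG
  exact spectralRadius_lt_one_iff.mp (spectralRadius_lt_one_of_norm_pow_lt_one hk0.ne' hG)

theorem Schur.transpose {F : Matrix (Fin n) (Fin n) ℝ} (h : Schur F) : Schur Fᵀ := by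
  have : Tendsto (fun t : ℕ => (F ^ t)ᵀ) atTop (𝓝 0) := by
    have := (Continuous.matrix_transpose continuous_id).continuousAt.tendsto.comp h
    simpa [Function.comp_def] using this
  simpa [Schur, Matrix.transpose_pow] using this

/-- The Lyapunov operator `S ↦ S - F S Fᵀ`. -/
def lyapOp (F : Matrix (Fin n) (Fin n) ℝ) :
    Matrix (Fin n) (Fin n) ℝ →ₗ[ℝ] Matrix (Fin n) (Fin n) ℝ where
  toFun S := S - F * S * Fᵀ
  map_add' S T := by simp only [Matrix.mul_add, Matrix.add_mul]; abel
  map_smul' c S := by simp [smul_sub]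

theorem lyapOp_apply (F S : Matrix (Fin n) (Fin n) ℝ) : lyapOp F S = S - F * S * Fᵀ := rfl

theorem Schur.tendsto_conj {F : Matrix (Fin n) (Fin n) ℝ} (h : Schur F)
    (S : Matrix (Fin n) (Fin n) ℝ) : Tendsto (fun t : ℕ => F ^ t * S * (Fᵀ) ^ t) atTop (𝓝 0) := by
  have := (Tendsto.mul_const S h).mul h.transpose
  simpa using this

theorem conj_pow_of_eq {F S : Matrix (Fin n) (Fin n) ℝ} (h : S = F * S * Fᵀ) (t : ℕ) :
    F ^ t * S * (Fᵀ) ^ t = S := by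
  induction t with
  | zero => simp
  | succ t ih =>
    rw [pow_succ, pow_succ']
    calc F ^ t * F * S * (Fᵀ * Fᵀ ^ t) = F ^ t * (F * S * Fᵀ) * Fᵀ ^ t := by
          simp only [Matrix.mul_assoc]
      _ = S := by rw [← h, ih]

/-- An element of the kernel is fixed by S ↦ F S Fᵀ, hence by all its iterates, and these tend to
zero. -/
theorem Schur.lyapOp_injective {F : Matrix (Fin n) (Fin n) ℝ} (h : Schur F) :
    Function.Injective (lyapOp F) := by
  rw [injective_iff_map_eq_zero]
  intro S hS
  rw [lyapOp_apply, sub_eq_zero] at hS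
  have h1 := h.tendsto_conj S
  simp only [conj_pow_of_eq hS] at h1
  exact tendsto_nhds_unique tendsto_const_nhds h1

/-- The solution `S` of the discrete Lyapunov equation `S = F S Fᵀ + W`. -/
noncomputable def lyap (F W : Matrix (Fin n) (Fin n) ℝ) : Matrix (Fin n) (Fin n) ℝ :=
  Matrix.of fun i j => ((1 - kroneckerMap (· * ·) F F)⁻¹ *ᵥ fun p => W p.1 p.2) (i, j)

theorem kronecker_mulVec_entries (F S : Matrix (Fin n) (Fin n) ℝ) (p : Fin n × Fin n) :
    (kroneckerMap (· * ·) F F *ᵥ fun p => S p.1 p.2) p = (F * S * Fᵀ) p.1 p.2 := by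
  simp only [Matrix.mulVec, dotProduct, kroneckerMap_apply, Fintype.sum_prod_type, Matrix.mul_apply,
    Finset.sum_mul, Matrix.transpose_apply]
  rw [Finset.sum_comm]
  refine Finset.sum_congr rfl fun i _ => Finset.sum_congr rfl fun j _ => ?_
  ring

/-- The Kronecker square is conjugation by F written in coordinates, so this is injectivity of the
Lyapunov operator. Solving through an explicit matrix inverse is what makes `lyap` smooth in F
later. -/
theorem Schur.isUnit_one_sub_kronecker {F : Matrix (Fin n) (Fin n) ℝ} (h : Schur F) :
    IsUnit (1 - kroneckerMap (· * ·) F F) := by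
  rw [← Matrix.mulVec_injective_iff_isUnit, ← Matrix.coe_mulVecLin, injective_iff_map_eq_zero]
  intro v hv
  have h0 : lyapOp F (Matrix.of fun i j => v (i, j)) = 0 := by
    ext i j
    have h1 := congrFun hv (i, j)
    have h2 := kronecker_mulVec_entries F (Matrix.of fun i j => v (i, j)) (i, j)
    simp only [Matrix.of_apply, Prod.mk.eta] at h2
    simp only [Matrix.mulVecLin_apply, Matrix.sub_mulVec, Matrix.one_mulVec, Pi.sub_apply,
      Pi.zero_apply] at h1
    rw [h2] at h1
    simpa [lyapOp_apply] using h1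
  have h1 := h.lyapOp_injective (h0.trans (map_zero _).symm)
  ext p
  exact congrFun (congrFun h1 p.1) p.2

theorem Schur.lyapOp_lyap {F : Matrix (Fin n) (Fin n) ℝ} (h : Schur F)
    (W : Matrix (Fin n) (Fin n) ℝ) : lyapOp F (lyap F W) = W := by
  ext i j
  have h2 := kronecker_mulVec_entries F (lyap F W) (i, j)
  have h3 : (fun p : Fin n × Fin n => lyap F W p.1 p.2) =
      (1 - kroneckerMap (· * ·) F F)⁻¹ *ᵥ fun p => W p.1 p.2 := by
    ext p; rfl
  have h4 : (1 - kroneckerMap (· * ·) F F) *ᵥ (fun p : Fin n × Fin n => lyap F W p.1 p.2) =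
      fun p => W p.1 p.2 := by
    rw [h3, Matrix.mulVec_mulVec, Matrix.mul_nonsing_inv _
      ((Matrix.isUnit_iff_isUnit_det _).mp h.isUnit_one_sub_kronecker), Matrix.one_mulVec]
  have h5 := congrFun h4 (i, j)
  rw [Matrix.sub_mulVec, Matrix.one_mulVec, Pi.sub_apply, h2] at h5
  simpa [lyapOp_apply] using h5

theorem Schur.lyap_eq {F : Matrix (Fin n) (Fin n) ℝ} (h : Schur F)
    (W : Matrix (Fin n) (Fin n) ℝ) : lyap F W = F * lyap F W * Fᵀ + W := by
  have h1 := h.lyapOp_lyap W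
  rw [lyapOp_apply, sub_eq_iff_eq_add] at h1
  rw [add_comm]
  exact h1

theorem Schur.lyap_unique {F : Matrix (Fin n) (Fin n) ℝ} (h : Schur F)
    {S W : Matrix (Fin n) (Fin n) ℝ} (hS : S = F * S * Fᵀ + W) : S = lyap F W := by
  apply h.lyapOp_injective
  rw [h.lyapOp_lyap, lyapOp_apply, sub_eq_iff_eq_add, add_comm]
  exact hS

theorem Schur.lyap_transpose {F : Matrix (Fin n) (Fin n) ℝ} (h : Schur F)
    {W : Matrix (Fin n) (Fin n) ℝ} (hW : Wᵀ = W) : (lyap F W)ᵀ = lyap F W := by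
  apply h.lyap_unique
  nth_rw 1 [h.lyap_eq W]
  simp [hW, Matrix.mul_assoc]

/-- The inverse of the Lyapunov operator is linear in finite dimension, hence continuous, so
approximate solutions converge to the exact one. This identifies the limit of time-averaged outer
products. -/
theorem Schur.tendsto_lyap {F : Matrix (Fin n) (Fin n) ℝ} (h : Schur F)
    {W : Matrix (Fin n) (Fin n) ℝ} {S : ℕ → Matrix (Fin n) (Fin n) ℝ}
    (hS : Tendsto (fun t => S t - F * S t * Fᵀ) atTop (𝓝 W)) :
    Tendsto S atTop (𝓝 (lyap F W)) := by
  let e := LinearEquiv.ofInjectiveEndo (lyapOp F) h.lyapOp_injective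
  have h1 : ∀ T : Matrix (Fin n) (Fin n) ℝ, e.symm (T - F * T * Fᵀ) = T := by
    intro T
    exact e.symm_apply_apply T
  have h2 := (e.symm.toLinearMap.continuous_of_finiteDimensional.tendsto W).comp hS
  have h3 : e.symm W = lyap F W := by
    rw [LinearEquiv.symm_apply_eq]
    exact (h.lyapOp_lyap W).symm
  simpa only [Function.comp_def, LinearEquiv.coe_coe, h1, h3] using h2

theorem Schur.isUnit_one_sub {F : Matrix (Fin n) (Fin n) ℝ} (h : Schur F) :
    IsUnit (1 - F) := by
  rw [← Matrix.mulVec_injective_iff_isUnit]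
  rw [← Matrix.coe_mulVecLin, injective_iff_map_eq_zero]
  intro v hv
  have h1 : F *ᵥ v = v := by
    simp [sub_eq_zero] at hv
    exact hv.symm
  have h2 : ∀ t : ℕ, (F ^ t) *ᵥ v = v := by
    intro t
    induction t with
    | zero => simp
    | succ t ih => rw [pow_succ, ← Matrix.mulVec_mulVec, h1, ih]
  have h3 : Tendsto (fun t : ℕ => (F ^ t) *ᵥ v) atTop (𝓝 ((0 : Matrix (Fin n) (Fin n) ℝ) *ᵥ v)) :=
    ((Continuous.matrix_mulVec continuous_id continuous_const).tendsto _).comp h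
  simp only [h2, Matrix.zero_mulVec] at h3
  exact tendsto_nhds_unique tendsto_const_nhds h3

theorem posSemidef_conj {ι κ : Type*} [Fintype ι] [Fintype κ] {S : Matrix ι ι ℝ}
    (hS : S.PosSemidef) (F : Matrix κ ι ℝ) : (F * S * Fᵀ).PosSemidef := by
  simpa [Matrix.conjTranspose_eq_transpose_of_trivial] using hS.mul_mul_conjTranspose_same F

/-- The differences S - F^t S (Fᵀ)^t are partial sums of the series of F^s W (Fᵀ)^s, hence positive
semidefinite, and they converge to S. -/
theorem Schur.posSemidef_of_eq {F S W : Matrix (Fin n) (Fin n) ℝ} (h : Schur F)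
    (hSt : Sᵀ = S) (hS : S = F * S * Fᵀ + W) (hW : W.PosSemidef) : S.PosSemidef := by
  have h1 : ∀ t : ℕ, (S - F ^ t * S * Fᵀ ^ t).PosSemidef := by
    intro t
    induction t with
    | zero => simpa using Matrix.PosSemidef.zero
    | succ t ih =>
      have h2 : S - F ^ (t + 1) * S * Fᵀ ^ (t + 1) =
          (S - F ^ t * S * Fᵀ ^ t) + F ^ t * W * (F ^ t)ᵀ := by
        have hW' : W = S - F * S * Fᵀ := by nth_rw 1 [hS]; abel
        rw [hW', pow_succ, pow_succ', Matrix.transpose_pow]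
        simp only [Matrix.mul_sub, Matrix.sub_mul, Matrix.mul_assoc]
        abel
      rw [h2]
      exact ih.add (posSemidef_conj hW _)
  refine Matrix.PosSemidef.of_dotProduct_mulVec_nonneg
    (by simpa [Matrix.IsHermitian, Matrix.conjTranspose_eq_transpose_of_trivial] using hSt)
    fun v => ?_
  have h3 : Tendsto (fun t : ℕ => star v ⬝ᵥ ((S - F ^ t * S * Fᵀ ^ t) *ᵥ v)) atTop
      (𝓝 (star v ⬝ᵥ ((S - 0) *ᵥ v))) := by
    have hc : Continuous fun T : Matrix (Fin n) (Fin n) ℝ => star v ⬝ᵥ ((S - T) *ᵥ v) := by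
      fun_prop
    exact (hc.tendsto 0).comp (h.tendsto_conj S)
  rw [sub_zero] at h3
  exact ge_of_tendsto' h3 fun t => (h1 t).dotProduct_mulVec_nonneg v

end Schur

/-! ### Entrywise smoothness of matrix-valued maps -/

section Smooth

variable {E : Type*} [NormedAddCommGroup E] [NormedSpace ℝ E] {k : WithTop ℕ∞} {x : E}

/-- A matrix-valued map is smooth at a point when all of its entries are. -/
def SmoothAt {ι κ : Type*} (f : E → Matrix ι κ ℝ) (x : E) : Prop :=
  ∀ i j, ContDiffAt ℝ ⊤ (fun y => f y i j) x

variable {ι κ τ : Type*}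

theorem SmoothAt.const (A : Matrix ι κ ℝ) : SmoothAt (fun _ : E => A) x :=
  fun _ _ => contDiffAt_const

theorem SmoothAt.add {f g : E → Matrix ι κ ℝ} (hf : SmoothAt f x) (hg : SmoothAt g x) :
    SmoothAt (fun y => f y + g y) x := fun i j => (hf i j).add (hg i j)

theorem SmoothAt.sub {f g : E → Matrix ι κ ℝ} (hf : SmoothAt f x) (hg : SmoothAt g x) :
    SmoothAt (fun y => f y - g y) x := fun i j => (hf i j).sub (hg i j)

theorem SmoothAt.transpose {f : E → Matrix ι κ ℝ} (hf : SmoothAt f x) :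
    SmoothAt (fun y => (f y)ᵀ) x := fun i j => hf j i

theorem SmoothAt.mul [Fintype κ] {f : E → Matrix ι κ ℝ} {g : E → Matrix κ τ ℝ}
    (hf : SmoothAt f x) (hg : SmoothAt g x) : SmoothAt (fun y => f y * g y) x := by
  intro i j
  simp only [Matrix.mul_apply]
  exact ContDiffAt.sum fun l _ => (hf i l).mul (hg l j)

theorem SmoothAt.trace [Fintype ι] {f : E → Matrix ι ι ℝ} (hf : SmoothAt f x) :
    ContDiffAt ℝ ⊤ (fun y => (f y).trace) x := by
  simp only [Matrix.trace, Matrix.diag]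
  exact ContDiffAt.sum fun l _ => hf l l

theorem SmoothAt.det [Fintype ι] [DecidableEq ι] {f : E → Matrix ι ι ℝ} (hf : SmoothAt f x) :
    ContDiffAt ℝ ⊤ (fun y => (f y).det) x := by
  simp only [Matrix.det_apply]
  refine ContDiffAt.sum fun σ _ => ContDiffAt.const_smul _ ?_
  exact contDiffAt_prod fun l _ => hf _ _

/-- Cramer's rule: the entries are polynomials in the entries of f divided by a determinant that
does not vanish at x. -/
theorem SmoothAt.inv [Fintype ι] [DecidableEq ι] {f : E → Matrix ι ι ℝ} (hf : SmoothAt f x)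
    (hx : IsUnit (f x)) : SmoothAt (fun y => (f y)⁻¹) x := by
  intro i j
  have hdet : (f x).det ≠ 0 := ((Matrix.isUnit_iff_isUnit_det _).mp hx).ne_zero
  simp only [Matrix.inv_def, Ring.inverse_eq_inv', Matrix.smul_apply, smul_eq_mul,
    Matrix.adjugate_apply]
  refine (hf.det.inv hdet).mul (SmoothAt.det fun a b => ?_)
  by_cases h : a = j
  · subst h
    simp only [Matrix.updateRow_self]
    exact contDiffAt_const
  · simp only [Matrix.updateRow_ne h]
    exact hf a b

theorem SmoothAt.lyap {n : ℕ} {F : E → Matrix (Fin n) (Fin n) ℝ} (hF : SmoothAt F x)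
    (h : Schur (F x)) (W : Matrix (Fin n) (Fin n) ℝ) : SmoothAt (fun y => lyap (F y) W) x := by
  intro i j
  have h1 : SmoothAt (fun y => (1 - kroneckerMap (· * ·) (F y) (F y))⁻¹) x := by
    refine SmoothAt.inv (SmoothAt.sub (SmoothAt.const 1) fun p q => ?_) h.isUnit_one_sub_kronecker
    exact (hF _ _).mul (hF _ _)
  simp only [RCLQR.lyap, Matrix.of_apply, Matrix.mulVec, dotProduct]
  exact ContDiffAt.sum fun p _ => (h1 _ p).mul contDiffAt_const

theorem SmoothAt.continuousAt {f : E → Matrix ι κ ℝ} (hf : SmoothAt f x) : ContinuousAt f x :=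
  continuousAt_pi.mpr fun i => continuousAt_pi.mpr fun j => (hf i j).continuousAt

end Smooth

end RCLQR

namespace RCLQR

/-! ### The cost-difference identity -/

section Algebra

variable {a b p : Type*} [Fintype a] [Fintype b] [Fintype p]

/-- Cost-difference identity for a linear system with a quadratic cost: `P` solves the Bellman
equation of the gain `X` and `Φ'` is stationary under the gain `X + D`. -/
theorem trace_cost_eq {C P W Φ' N : Matrix p p ℝ} {F F' : Matrix p p ℝ} {R : Matrix b b ℝ}
    {G : Matrix p b ℝ} {X D : Matrix b p ℝ} (hR : Rᵀ = R) (hP : Pᵀ = P)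
    (hF' : F' = F + G * D)
    (hBell : C + Xᵀ * R * X + Fᵀ * P * F = P + N)
    (hΦ' : Φ' = F' * Φ' * F'ᵀ + W) :
    ((C + (X + D)ᵀ * R * (X + D)) * Φ').trace =
      (P * W).trace + (N * Φ').trace +
      ((Dᵀ * (R + Gᵀ * P * G) * D + Dᵀ * (R * X + Gᵀ * P * F) +
        (R * X + Gᵀ * P * F)ᵀ * D) * Φ').trace := by
  have h1 : C + (X + D)ᵀ * R * (X + D) = P - F'ᵀ * P * F' + N +
      (Dᵀ * (R + Gᵀ * P * G) * D + Dᵀ * (R * X + Gᵀ * P * F) +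
        (R * X + Gᵀ * P * F)ᵀ * D) := by
    have h2 : C = P + N - Fᵀ * P * F - Xᵀ * R * X := by rw [← hBell]; abel
    rw [h2, hF']
    simp only [Matrix.transpose_add, Matrix.transpose_mul, hR, hP, Matrix.transpose_transpose,
      Matrix.mul_add, Matrix.add_mul, Matrix.mul_assoc]
    abel
  -- Stationarity of Φ' makes the terms containing P cancel up to the noise contribution, which is
  -- the same for every gain.
  have h3 : ((P - F'ᵀ * P * F') * Φ').trace = (P * W).trace := by
    have h4 : (P * Φ').trace = (P * (F' * Φ' * F'ᵀ + W)).trace := by rw [← hΦ']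
    rw [Matrix.sub_mul, Matrix.trace_sub, h4, Matrix.mul_add, Matrix.trace_add]
    have h5 : (F'ᵀ * P * F' * Φ').trace = (P * (F' * Φ' * F'ᵀ)).trace := by
      rw [Matrix.mul_assoc, Matrix.mul_assoc, Matrix.trace_mul_comm]
      simp only [Matrix.mul_assoc]
    rw [h5]; ring
  rw [h1, Matrix.add_mul, Matrix.add_mul, Matrix.trace_add, Matrix.trace_add, h3]

end Algebra

/-! ### Augmented coordinates, the stationary second moment and the Bellman equation -/

section Augmented

variable {n m : ℕ}

/-- The policy as an `m × (n + 1)` matrix. -/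
def policyMat (X : Policy n m) : Matrix (Fin m) (Fin (n + 1)) ℝ := Matrix.of fun i j => X (i, j)

variable (n) in
/-- The inclusion of the state coordinates into the augmented coordinates. -/
noncomputable def inc : Matrix (Fin (n + 1)) (Fin n) ℝ :=
  Matrix.of fun i j => if i = j.castSucc then 1 else 0

variable (n) in
/-- The last basis vector of the augmented coordinates, as a column. -/
noncomputable def lastCol : Matrix (Fin (n + 1)) Unit ℝ :=
  Matrix.of fun i _ => if i = Fin.last n then 1 else 0

theorem inc_transpose_mul_inc : (inc n)ᵀ * inc n = 1 := by
  ext i j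
  simp [inc, Matrix.mul_apply, Matrix.one_apply, Fin.castSucc_inj, eq_comm]

theorem lastCol_transpose_mul_inc : (lastCol n)ᵀ * inc n = 0 := by
  ext i j
  simp [inc, lastCol, Matrix.mul_apply, (Fin.castSucc_lt_last j).ne]

theorem inc_transpose_mul_lastCol : (inc n)ᵀ * lastCol n = 0 := by
  ext i j
  simp [inc, lastCol, Matrix.mul_apply, (Fin.castSucc_lt_last i).ne']

theorem lastCol_transpose_mul_lastCol : (lastCol n)ᵀ * lastCol n = 1 := by
  ext i j
  simp [lastCol, Matrix.mul_apply]

theorem inc_mul_transpose_add : inc n * (inc n)ᵀ + lastCol n * (lastCol n)ᵀ = 1 := by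
  ext i j
  simp only [inc, lastCol, Matrix.add_apply, Matrix.mul_apply, Matrix.transpose_apply,
    Matrix.of_apply, Matrix.one_apply, Finset.univ_unique, Finset.sum_singleton]
  induction i using Fin.lastCases with
  | last => 
    induction j using Fin.lastCases with
    | last => simp [(Fin.castSucc_lt_last _).ne']
    | cast j => simp [(Fin.castSucc_lt_last _).ne', (Fin.castSucc_lt_last j).ne]
  | cast i =>
    induction j using Fin.lastCases with
    | last => simp [(Fin.castSucc_lt_last _).ne']
    | cast j => simp [(Fin.castSucc_lt_last _).ne, Fin.castSucc_inj]

theorem policyMat_mul_inc (X : Policy n m) : policyMat X * inc n = gain X := by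
  ext i j
  simp [policyMat, inc, gain, Matrix.mul_apply]

theorem policyMat_mul_lastCol (X : Policy n m) :
    policyMat X * lastCol n = replicateCol Unit (offset X) := by
  ext i j
  simp [policyMat, lastCol, offset, Matrix.mul_apply]

theorem policyMat_eq (X : Policy n m) :
    policyMat X = gain X * (inc n)ᵀ + replicateCol Unit (offset X) * (lastCol n)ᵀ := by
  rw [← policyMat_mul_inc, ← policyMat_mul_lastCol, Matrix.mul_assoc, Matrix.mul_assoc,
    ← Matrix.mul_add, inc_mul_transpose_add, Matrix.mul_one]

end Augmented

namespace Model

variable {n m : ℕ} (M : Model n m)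

/-- The closed-loop matrix. -/
noncomputable def clm (X : Policy n m) : Matrix (Fin n) (Fin n) ℝ := M.A - M.B * gain X

theorem mem_stab {X : Policy n m} : X ∈ M.stab ↔ Schur (M.clm X) := spectralRadius_lt_one_iff

/-- The stationary mean of the state, as a column. -/
noncomputable def statMean (X : Policy n m) : Matrix (Fin n) Unit ℝ :=
  (1 - M.clm X)⁻¹ * (M.B * replicateCol Unit (offset X) + replicateCol Unit M.wbar)

/-- The stationary covariance of the state. -/
noncomputable def statCov (X : Policy n m) : Matrix (Fin n) (Fin n) ℝ := lyap (M.clm X) M.W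

/-- The stationary mean of the augmented vector `[-x; 1]`. -/
noncomputable def augMean (X : Policy n m) : Matrix (Fin (n + 1)) Unit ℝ :=
  lastCol n - inc n * M.statMean X

/-- The stationary second moment of the augmented vector `[-x; 1]`. -/
noncomputable def secondMoment (X : Policy n m) : Matrix (Fin (n + 1)) (Fin (n + 1)) ℝ :=
  inc n * M.statCov X * (inc n)ᵀ + M.augMean X * (M.augMean X)ᵀ

/-- The dynamics of the augmented vector under the policy. -/
noncomputable def augDyn (X : Policy n m) : Matrix (Fin (n + 1)) (Fin (n + 1)) ℝ :=
  inc n * M.A * (inc n)ᵀ - inc n * replicateCol Unit M.wbar * (lastCol n)ᵀ +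
    lastCol n * (lastCol n)ᵀ + (-(inc n * M.B)) * policyMat X

theorem augDyn_mul_inc (X : Policy n m) : M.augDyn X * inc n = inc n * M.clm X := by
  simp only [augDyn, clm, Matrix.add_mul, Matrix.sub_mul, Matrix.neg_mul, Matrix.mul_assoc,
    inc_transpose_mul_inc, lastCol_transpose_mul_inc, policyMat_mul_inc, Matrix.mul_zero,
    Matrix.mul_one, Matrix.mul_sub]
  abel

theorem augDyn_mul_lastCol (X : Policy n m) : M.augDyn X * lastCol n =
    lastCol n - inc n * (M.B * replicateCol Unit (offset X) + replicateCol Unit M.wbar) := by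
  simp only [augDyn, Matrix.add_mul, Matrix.sub_mul, Matrix.neg_mul, Matrix.mul_assoc,
    inc_transpose_mul_lastCol, lastCol_transpose_mul_lastCol, policyMat_mul_lastCol,
    Matrix.mul_zero, Matrix.mul_one, Matrix.mul_add]
  abel

theorem inc_transpose_mul_augDyn (X : Policy n m) : (inc n)ᵀ * M.augDyn X =
    M.A * (inc n)ᵀ - replicateCol Unit M.wbar * (lastCol n)ᵀ - M.B * policyMat X := by
  simp only [augDyn, Matrix.mul_add, Matrix.mul_sub, Matrix.mul_neg, Matrix.neg_mul,
    ← Matrix.mul_assoc, inc_transpose_mul_inc, inc_transpose_mul_lastCol, Matrix.zero_mul,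
    Matrix.one_mul]
  abel

/-- The constant coordinate is preserved, so the augmented dynamics has the eigenvalue one and is
never Schur stable. This is why the Bellman equation carries a constant term. -/
theorem lastCol_transpose_mul_augDyn (X : Policy n m) :
    (lastCol n)ᵀ * M.augDyn X = (lastCol n)ᵀ := by
  simp only [augDyn, Matrix.mul_add, Matrix.mul_sub, Matrix.mul_neg, Matrix.neg_mul,
    ← Matrix.mul_assoc, lastCol_transpose_mul_inc, lastCol_transpose_mul_lastCol, Matrix.zero_mul,
    Matrix.one_mul]
  abel

variable {M}

theorem statMean_eq {X : Policy n m} (hX : X ∈ M.stab) : M.statMean X =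
    M.clm X * M.statMean X + (M.B * replicateCol Unit (offset X) + replicateCol Unit M.wbar) := by
  have hu := (Matrix.isUnit_iff_isUnit_det _).mp (M.mem_stab.mp hX).isUnit_one_sub
  have h1 : (1 - M.clm X) * M.statMean X =
      M.B * replicateCol Unit (offset X) + replicateCol Unit M.wbar := by
    rw [statMean, ← Matrix.mul_assoc, Matrix.mul_nonsing_inv _ hu, Matrix.one_mul]
  rw [← h1, Matrix.sub_mul, Matrix.one_mul]
  abel

theorem statCov_eq {X : Policy n m} (hX : X ∈ M.stab) : M.statCov X =
    M.clm X * M.statCov X * (M.clm X)ᵀ + M.W := (M.mem_stab.mp hX).lyap_eq _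

theorem augDyn_mul_augMean {X : Policy n m} (hX : X ∈ M.stab) :
    M.augDyn X * M.augMean X = M.augMean X := by
  rw [augMean, Matrix.mul_sub, augDyn_mul_lastCol, ← Matrix.mul_assoc, augDyn_mul_inc]
  nth_rw 2 [statMean_eq hX]
  simp only [Matrix.mul_add, Matrix.mul_assoc]
  abel

theorem secondMoment_eq {X : Policy n m} (hX : X ∈ M.stab) : M.secondMoment X =
    M.augDyn X * M.secondMoment X * (M.augDyn X)ᵀ + inc n * M.W * (inc n)ᵀ := by
  have h1 : M.augDyn X * M.secondMoment X * (M.augDyn X)ᵀ =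
      (M.augDyn X * inc n) * M.statCov X * (M.augDyn X * inc n)ᵀ +
      (M.augDyn X * M.augMean X) * (M.augDyn X * M.augMean X)ᵀ := by
    simp only [secondMoment, Matrix.mul_add, Matrix.add_mul, Matrix.transpose_mul,
      Matrix.mul_assoc]
  rw [h1, augDyn_mul_inc, augDyn_mul_augMean hX, secondMoment]
  nth_rw 1 [statCov_eq hX]
  simp only [Matrix.mul_add, Matrix.add_mul, Matrix.transpose_mul, Matrix.mul_assoc]
  abel

/-- The last coordinate of z is identically one. Hence the Bellman constant contributes the same
amount under every policy and drops out of cost differences. -/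
theorem secondMoment_last (X : Policy n m) :
    (lastCol n * (lastCol n)ᵀ * M.secondMoment X).trace = 1 := by
  have h1 : (lastCol n)ᵀ * M.secondMoment X * lastCol n = 1 := by
    have h2 : (lastCol n)ᵀ * M.augMean X = 1 := by
      rw [augMean, Matrix.mul_sub, ← Matrix.mul_assoc, lastCol_transpose_mul_inc,
        lastCol_transpose_mul_lastCol, Matrix.zero_mul, sub_zero]
    have h3 : (M.augMean X)ᵀ * lastCol n = 1 := by
      rw [← Matrix.transpose_inj, Matrix.transpose_mul, Matrix.transpose_transpose, h2,
        Matrix.transpose_one]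
    rw [secondMoment, Matrix.mul_add, Matrix.add_mul]
    rw [← Matrix.mul_assoc, ← Matrix.mul_assoc, ← Matrix.mul_assoc, lastCol_transpose_mul_inc,
      Matrix.zero_mul, Matrix.zero_mul, Matrix.zero_mul, zero_add, h2, Matrix.one_mul, h3]
  rw [Matrix.mul_assoc, Matrix.trace_mul_comm, h1]
  simp

/-- Bellman equation of a quadratic cost of the augmented vector. -/
theorem exists_bellman {X : Policy n m} (hX : X ∈ M.stab)
    {C : Matrix (Fin (n + 1)) (Fin (n + 1)) ℝ} (hC : Cᵀ = C)
    (hpos : ((inc n)ᵀ * C * inc n).PosSemidef) :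
    ∃ (P : Matrix (Fin (n + 1)) (Fin (n + 1)) ℝ) (k : Matrix Unit Unit ℝ), Pᵀ = P ∧
      ((inc n)ᵀ * P * inc n).PosSemidef ∧
      C + (M.augDyn X)ᵀ * P * M.augDyn X = P + lastCol n * k * (lastCol n)ᵀ := by
  have hS := M.mem_stab.mp hX
  set F := M.clm X with hF
  set z := M.augMean X with hz
  set e := lastCol n
  set Jm := inc n with hJ
  -- V sends [-x; 1] to the deviation of x from its stationary mean, with reversed sign. In the
  -- coordinates (V, eᵀ) the dynamics is block diagonal: V is propagated by F and eᵀ is fixed.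
  set V : Matrix (Fin n) (Fin (n + 1)) ℝ := Jmᵀ + M.statMean X * eᵀ with hV
  set G := Jmᵀ * C * Jm with hG
  set h := Jmᵀ * C * z with hh
  have hGt : Gᵀ = G := by simp [hG, hC, Matrix.mul_assoc]
  set P := lyap Fᵀ G with hP
  have hPt : Pᵀ = P := hS.transpose.lyap_transpose hGt
  have hPeq : P = Fᵀ * P * F + G := by
    simpa using hS.transpose.lyap_eq G
  obtain ⟨q, hq⟩ : ∃ q : Matrix (Fin n) Unit ℝ, q = Fᵀ * q + h := by
    have hu := (Matrix.isUnit_iff_isUnit_det _).mp hS.transpose.isUnit_one_sub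
    refine ⟨(1 - Fᵀ)⁻¹ * h, ?_⟩
    have h1 : (1 - Fᵀ) * ((1 - Fᵀ)⁻¹ * h) = h := by
      rw [← Matrix.mul_assoc, Matrix.mul_nonsing_inv _ hu, Matrix.one_mul]
    rw [Matrix.sub_mul, Matrix.one_mul, sub_eq_iff_eq_add] at h1
    rw [add_comm]
    exact h1
  have hVF : V * M.augDyn X = F * V := by
    have h1 : M.statMean X * eᵀ = (F * M.statMean X +
      (M.B * replicateCol Unit (offset X) + replicateCol Unit M.wbar)) * eᵀ := by
      rw [← statMean_eq hX]
    have h2 : V * M.augDyn X = M.A * Jmᵀ - replicateCol Unit M.wbar * eᵀ - M.B * policyMat X +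
        M.statMean X * eᵀ := by
      rw [hV, Matrix.add_mul, inc_transpose_mul_augDyn, Matrix.mul_assoc,
        lastCol_transpose_mul_augDyn]
    rw [h2, h1, hV, policyMat_eq, hF, clm]
    simp only [Matrix.mul_add, Matrix.add_mul, Matrix.sub_mul, Matrix.mul_assoc]
    abel
  have heF : eᵀ * M.augDyn X = eᵀ := M.lastCol_transpose_mul_augDyn X
  have hid : Jm * V + z * eᵀ = 1 := by
    rw [hV, hz, augMean, ← inc_mul_transpose_add]
    simp only [Matrix.mul_add, Matrix.sub_mul, Matrix.mul_assoc]
    abel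
  have hCe : C = Vᵀ * G * V + Vᵀ * h * eᵀ + e * hᵀ * V + e * (zᵀ * C * z) * eᵀ := by
    have h1 : C = (Jm * V + z * eᵀ)ᵀ * C * (Jm * V + z * eᵀ) := by rw [hid]; simp
    nth_rw 1 [h1]
    simp only [hG, hh, Matrix.transpose_add, Matrix.transpose_mul, Matrix.transpose_transpose,
      Matrix.mul_add, Matrix.add_mul, Matrix.mul_assoc, hC]
    abel
  have hVJ : V * Jm = 1 := by
    rw [hV, Matrix.add_mul, inc_transpose_mul_inc, Matrix.mul_assoc, lastCol_transpose_mul_inc,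
      Matrix.mul_zero, add_zero]
  have heJ : eᵀ * Jm = 0 := lastCol_transpose_mul_inc
  -- There is no e eᵀ block: it would be invariant under the dynamics and cancel from both sides.
  -- The cost at the stationary mean takes its place as the constant.
  refine ⟨Vᵀ * P * V + Vᵀ * q * eᵀ + e * qᵀ * V, zᵀ * C * z, ?_, ?_, ?_⟩
  · simp only [Matrix.transpose_add, Matrix.transpose_mul, Matrix.transpose_transpose, hPt,
      Matrix.mul_assoc]
    abel
  · have h1 : Jmᵀ * (Vᵀ * P * V + Vᵀ * q * eᵀ + e * qᵀ * V) * Jm = P := by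
      have h2 : Jmᵀ * (Vᵀ * P * V + Vᵀ * q * eᵀ + e * qᵀ * V) * Jm =
          (V * Jm)ᵀ * P * (V * Jm) + (V * Jm)ᵀ * q * (eᵀ * Jm) + (eᵀ * Jm)ᵀ * qᵀ * (V * Jm) := by
        simp only [Matrix.transpose_mul, Matrix.transpose_transpose, Matrix.mul_add,
          Matrix.add_mul, Matrix.mul_assoc]
      rw [h2, hVJ, heJ]
      simp
    rw [h1]
    refine hS.transpose.posSemidef_of_eq hPt ?_ hpos
    simpa using hPeq
  · have h2 : (M.augDyn X)ᵀ * (Vᵀ * P * V + Vᵀ * q * eᵀ + e * qᵀ * V) * M.augDyn X =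
        (V * M.augDyn X)ᵀ * P * (V * M.augDyn X) + (V * M.augDyn X)ᵀ * q * (eᵀ * M.augDyn X) +
        (eᵀ * M.augDyn X)ᵀ * qᵀ * (V * M.augDyn X) := by
      simp only [Matrix.transpose_mul, Matrix.transpose_transpose, Matrix.mul_add,
        Matrix.add_mul, Matrix.mul_assoc]
    rw [h2, hVF, heF]
    have h3 : Vᵀ * P * V = Vᵀ * (Fᵀ * P * F + G) * V := by rw [← hPeq]
    have h4 : Vᵀ * q * eᵀ = Vᵀ * (Fᵀ * q + h) * eᵀ := by rw [← hq]
    have h5 : e * qᵀ * V = e * (Fᵀ * q + h)ᵀ * V := by rw [← hq]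
    rw [h3, h4, h5]
    nth_rw 1 [hCe]
    simp only [Matrix.transpose_add, Matrix.transpose_mul, Matrix.transpose_transpose,
      Matrix.mul_add, Matrix.add_mul, Matrix.mul_assoc]
    abel

end Model

end RCLQR

namespace RCLQR

/-! ### Bounds between positive semidefinite matrices -/

section Loewner

variable {ι κ : Type*} [Fintype ι] [Fintype κ]

theorem psd_of_forall {A : Matrix ι ι ℝ} (hA : Aᵀ = A) (h : ∀ v, 0 ≤ v ⬝ᵥ (A *ᵥ v)) :
    A.PosSemidef :=
  Matrix.PosSemidef.of_dotProduct_mulVec_nonneg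
    (by simpa [Matrix.IsHermitian, Matrix.conjTranspose_eq_transpose_of_trivial] using hA)
    fun v => by simpa using h v

omit [Fintype ι] in
theorem _root_.Matrix.PosSemidef.transpose_eq {A : Matrix ι ι ℝ} (hA : A.PosSemidef) : Aᵀ = A := by
  simpa [Matrix.IsHermitian, Matrix.conjTranspose_eq_transpose_of_trivial] using hA.isHermitian

theorem _root_.Matrix.PosSemidef.quad_nonneg {A : Matrix ι ι ℝ} (hA : A.PosSemidef) (v : ι → ℝ) :
    0 ≤ v ⬝ᵥ (A *ᵥ v) := by simpa using hA.dotProduct_mulVec_nonneg v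

/-- Writing B as a sum of rank-one squares turns the trace into a sum of values of the quadratic
form of A. -/
theorem trace_mul_nonneg {A B : Matrix ι ι ℝ} (hA : A.PosSemidef) (hB : B.PosSemidef) :
    0 ≤ (A * B).trace := by
  obtain ⟨k, v, hv⟩ := Matrix.posSemidef_iff_eq_sum_vecMulVec.mp hB
  rw [hv, Matrix.mul_sum, Matrix.trace_sum]
  refine Finset.sum_nonneg fun i _ => ?_
  rw [Matrix.mul_vecMulVec, Matrix.trace_vecMulVec, dotProduct_comm]
  simpa using hA.quad_nonneg (v i)

theorem psd_conj {S : Matrix ι ι ℝ} (hS : S.PosSemidef) (F : Matrix ι κ ℝ) :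
    (Fᵀ * S * F).PosSemidef := by simpa using posSemidef_conj hS Fᵀ

theorem psd_transpose_mul_self (F : Matrix ι κ ℝ) : (Fᵀ * F).PosSemidef := by
  simpa [Matrix.conjTranspose_eq_transpose_of_trivial] using
    Matrix.posSemidef_conjTranspose_mul_self F

theorem quad_sub_smul_one [DecidableEq ι] (A : Matrix ι ι ℝ) (c : ℝ) (v : ι → ℝ) :
    v ⬝ᵥ ((A - c • 1) *ᵥ v) = v ⬝ᵥ (A *ᵥ v) - c * (v ⬝ᵥ v) := by
  rw [Matrix.sub_mulVec, dotProduct_sub, Matrix.smul_mulVec, Matrix.one_mulVec, dotProduct_smul,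
    smul_eq_mul]

theorem le_quad [DecidableEq ι] {A : Matrix ι ι ℝ} {c : ℝ} (h : (A - c • 1).PosSemidef)
    (v : ι → ℝ) : c * (v ⬝ᵥ v) ≤ v ⬝ᵥ (A *ᵥ v) := by
  have := h.quad_nonneg v
  rw [quad_sub_smul_one] at this
  linarith

theorem quad_smul (A : Matrix ι ι ℝ) (c : ℝ) (v : ι → ℝ) :
    (c • v) ⬝ᵥ (A *ᵥ (c • v)) = c ^ 2 * (v ⬝ᵥ (A *ᵥ v)) := by
  rw [Matrix.mulVec_smul, dotProduct_smul, smul_dotProduct, smul_eq_mul, smul_eq_mul]; ring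

/-- The quadratic forms of a continuous family of symmetric matrices over a compact set are
uniformly bounded below by a multiple of the identity; the multiple is positive when all matrices
are positive definite. -/
theorem exists_smul_one_le [DecidableEq ι] {T : Type*} [TopologicalSpace T] {K : Set T}
    (hK : IsCompact K) {A : T → Matrix ι ι ℝ} (hA : ContinuousOn A K)
    (hs : ∀ x ∈ K, (A x)ᵀ = A x) :
    ∃ c : ℝ, (∀ x ∈ K, (A x - c • 1).PosSemidef) ∧ ((∀ x ∈ K, (A x).PosDef) → 0 < c) := by
  let B : Set (ι → ℝ) := {v | v ⬝ᵥ v = 1}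
  have hBc : IsCompact B := by
    refine Metric.isCompact_of_isClosed_isBounded ?_ ?_
    · exact isClosed_eq (by fun_prop) continuous_const
    · refine (Metric.isBounded_closedBall (x := (0 : ι → ℝ)) (r := 1)).subset fun v hv => ?_
      rw [mem_closedBall_zero_iff, pi_norm_le_iff_of_nonneg zero_le_one]
      intro i
      have h1 : v i * v i ≤ v ⬝ᵥ v :=
        Finset.single_le_sum (f := fun j => v j * v j) (fun j _ => mul_self_nonneg _)
          (Finset.mem_univ i)
      rw [show v ⬝ᵥ v = 1 from hv] at h1
      rw [Real.norm_eq_abs]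
      exact abs_le_one_iff_mul_self_le_one.mpr h1
  have hf : ContinuousOn (fun q : T × (ι → ℝ) => q.2 ⬝ᵥ (A q.1 *ᵥ q.2)) (K ×ˢ B) := by
    have h1 : ContinuousOn (fun q : T × (ι → ℝ) => A q.1) (K ×ˢ B) :=
      hA.comp continuousOn_fst fun q hq => hq.1
    have h2 : Continuous fun r : Matrix ι ι ℝ × (ι → ℝ) => r.2 ⬝ᵥ (r.1 *ᵥ r.2) := by fun_prop
    exact h2.comp_continuousOn (h1.prodMk continuousOn_snd)
  have hscale : ∀ x ∈ K, ∀ c : ℝ, (∀ v ∈ B, c ≤ v ⬝ᵥ (A x *ᵥ v)) → (A x - c • 1).PosSemidef := by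
    intro x hx c hc
    refine psd_of_forall (by simp [hs x hx]) fun v => ?_
    rw [quad_sub_smul_one]
    by_cases hv : v = 0
    · simp [hv]
    have hpos : 0 < v ⬝ᵥ v := by
      have h0 : 0 ≤ v ⬝ᵥ v := Finset.sum_nonneg fun i _ => mul_self_nonneg (v i)
      exact h0.lt_of_ne fun h => hv (dotProduct_self_eq_zero.mp h.symm)
    set r := Real.sqrt (v ⬝ᵥ v) with hr
    have hr2 : r ^ 2 = v ⬝ᵥ v := Real.sq_sqrt hpos.le
    have hr0 : 0 < r := Real.sqrt_pos.mpr hpos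
    have h1 := hc (r⁻¹ • v) (by
      change (r⁻¹ • v) ⬝ᵥ (r⁻¹ • v) = 1
      rw [dotProduct_smul, smul_dotProduct, ← hr2]
      simp only [smul_eq_mul]
      field_simp)
    rw [quad_smul, inv_pow, hr2, inv_mul_eq_div, le_div_iff₀ hpos] at h1
    linarith
  -- The product is empty when K is or when there are no coordinates. The bound is then vacuous and
  -- any positive constant serves.
  rcases (K ×ˢ B).eq_empty_or_nonempty with he | hne
  · refine ⟨1, fun x hx => hscale x hx 1 fun v hv => ?_, fun _ => one_pos⟩
    exact absurd (Set.mk_mem_prod hx hv) (by rw [he]; exact Set.notMem_empty _)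
  · obtain ⟨q, hq, hmin⟩ := (hK.prod hBc).exists_isMinOn hne hf
    refine ⟨q.2 ⬝ᵥ (A q.1 *ᵥ q.2), fun x hx => hscale x hx _ fun v hv => ?_, fun hpd => ?_⟩
    · exact hmin (Set.mk_mem_prod hx hv)
    · have hv0 : q.2 ≠ 0 := by
        intro h0
        have h1 : q.2 ⬝ᵥ q.2 = 1 := hq.2
        rw [h0] at h1
        simp at h1
      simpa using (hpd q.1 hq.1).dotProduct_mulVec_pos hv0

theorem exists_pos_smul_one_le [DecidableEq ι] {A : Matrix ι ι ℝ} (hA : A.PosDef) :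
    ∃ c : ℝ, 0 < c ∧ (A - c • 1).PosSemidef := by
  obtain ⟨c, h1, h2⟩ := exists_smul_one_le (K := {()}) isCompact_singleton (A := fun _ => A)
    continuousOn_const (fun _ _ => hA.posSemidef.transpose_eq)
  exact ⟨c, h2 fun _ _ => hA, h1 () rfl⟩

theorem exists_le_smul_one [DecidableEq ι] {A : Matrix ι ι ℝ} (hA : Aᵀ = A) :
    ∃ c : ℝ, 0 < c ∧ (c • 1 - A).PosSemidef := by
  obtain ⟨c, h1, -⟩ := exists_smul_one_le (K := {()}) isCompact_singleton (A := fun _ => -A)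
    continuousOn_const (fun _ _ => by simp [hA])
  refine ⟨|c| + 1, by positivity, ?_⟩
  have h2 := (h1 () rfl).add ((Matrix.PosSemidef.one (n := ι) (R := ℝ)).smul
    (show (0 : ℝ) ≤ |c| + 1 + c by linarith [neg_abs_le c]))
  convert h2 using 1
  rw [add_smul (|c| + 1)]; abel

/-- A positive semidefinite matrix is bounded above by its trace. -/
theorem quad_le_trace {P : Matrix ι ι ℝ} (hP : P.PosSemidef) (v : ι → ℝ) :
    v ⬝ᵥ (P *ᵥ v) ≤ P.trace * (v ⬝ᵥ v) := by
  classical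
  -- Cauchy-Schwarz as a matrix inequality, to be paired with P under the trace.
  have h1 : ((v ⬝ᵥ v) • (1 : Matrix ι ι ℝ) - vecMulVec v v).PosSemidef := by
    refine psd_of_forall (by simp) fun x => ?_
    rw [Matrix.sub_mulVec, Matrix.smul_mulVec, Matrix.one_mulVec, dotProduct_sub, dotProduct_smul,
      Matrix.vecMulVec_mulVec]
    have h2 : (x ⬝ᵥ v) ^ 2 ≤ (x ⬝ᵥ x) * (v ⬝ᵥ v) := by
      simpa [dotProduct, pow_two] using Finset.sum_mul_sq_le_sq_mul_sq Finset.univ x v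
    simp only [smul_eq_mul, op_smul_eq_smul, dotProduct_smul, dotProduct_comm v x]
    nlinarith
  have h2 := trace_mul_nonneg hP h1
  rw [Matrix.mul_sub, Matrix.trace_sub, Matrix.mul_smul, Matrix.mul_one, Matrix.trace_smul,
    Matrix.mul_vecMulVec, Matrix.trace_vecMulVec, smul_eq_mul, dotProduct_comm (P *ᵥ v)] at h2
  linarith

end Loewner

/-! ### Policies as matrices with the Frobenius inner product -/

section PolicyMat

variable {n m : ℕ}

/-- The policy with a given matrix. -/
def ofMat (A : Matrix (Fin m) (Fin (n + 1)) ℝ) : Policy n m := WithLp.toLp 2 fun p => A p.1 p.2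

@[simp] theorem policyMat_ofMat (A : Matrix (Fin m) (Fin (n + 1)) ℝ) : policyMat (ofMat A) = A := rfl

theorem policyMat_add (X Y : Policy n m) : policyMat (X + Y) = policyMat X + policyMat Y := rfl

theorem policyMat_smul (c : ℝ) (X : Policy n m) : policyMat (c • X) = c • policyMat X := rfl

theorem inner_eq_trace (X Y : Policy n m) :
    inner ℝ X Y = ((policyMat X)ᵀ * policyMat Y).trace := by
  simp only [PiLp.inner_apply, Fintype.sum_prod_type, Matrix.trace, Matrix.diag, Matrix.mul_apply,
    policyMat, Matrix.transpose_apply, Matrix.of_apply]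
  rw [Finset.sum_comm]
  refine Finset.sum_congr rfl fun i _ => Finset.sum_congr rfl fun j _ => ?_
  simp [mul_comm]

theorem norm_sq_eq_trace (X : Policy n m) : ‖X‖ ^ 2 = ((policyMat X)ᵀ * policyMat X).trace := by
  rw [← inner_eq_trace, real_inner_self_eq_norm_sq]

theorem smoothAt_policyMat (X : Policy n m) : SmoothAt (policyMat (n := n) (m := m)) X := by
  intro i j
  exact (EuclideanSpace.proj (𝕜 := ℝ) (i, j) : Policy n m →L[ℝ] ℝ).contDiff.contDiffAt

theorem smoothAt_gain (X : Policy n m) : SmoothAt (gain (n := n) (m := m)) X := by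
  intro i j
  exact (EuclideanSpace.proj (𝕜 := ℝ) (i, j.castSucc) : Policy n m →L[ℝ] ℝ).contDiff.contDiffAt

theorem smoothAt_offset (X : Policy n m) :
    SmoothAt (fun X : Policy n m => replicateCol Unit (offset X)) X := by
  intro i j
  exact (EuclideanSpace.proj (𝕜 := ℝ) (i, Fin.last n) : Policy n m →L[ℝ] ℝ).contDiff.contDiffAt

end PolicyMat

end RCLQR

namespace RCLQR

/-! ### The closed form of the Lagrangian and its smoothness -/

namespace Model

variable {n m : ℕ} (M : Model n m)

/-- The reshaped stage cost as a quadratic form of the augmented vector, without the input term. -/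
noncomputable def augCost (μ : ℝ) : Matrix (Fin (n + 1)) (Fin (n + 1)) ℝ :=
  inc n * M.Qmu μ * (inc n)ᵀ - inc n * replicateCol Unit (M.Svec μ) * (lastCol n)ᵀ -
    lastCol n * (replicateCol Unit (M.Svec μ))ᵀ * (inc n)ᵀ -
    (μ * M.tolBar) • (lastCol n * (lastCol n)ᵀ)

/-- The closed form of the Lagrangian on stabilizing policies. -/
noncomputable def lagrForm (μ : ℝ) (X : Policy n m) : ℝ :=
  ((M.augCost μ + (policyMat X)ᵀ * M.R * policyMat X) * M.secondMoment X).trace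

variable {M}

theorem W_transpose : M.Wᵀ = M.W := by
  ext i j
  simp only [W, Matrix.transpose_apply, Matrix.of_apply]
  congr 1; ext w; ring

theorem Qmu_posSemidef (hM : M.Standing) {μ : ℝ} (hμ : 0 ≤ μ) : (M.Qmu μ).PosSemidef := by
  refine hM.Q_psd.add (Matrix.PosSemidef.smul ?_ (by positivity))
  have := psd_conj hM.W_pd.posSemidef M.Q
  rwa [hM.Q_psd.transpose_eq] at this

theorem augCost_transpose (hM : M.Standing) {μ : ℝ} (hμ : 0 ≤ μ) :
    (M.augCost μ)ᵀ = M.augCost μ := by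
  simp only [augCost, Matrix.transpose_sub, Matrix.transpose_mul, Matrix.transpose_transpose,
    Matrix.transpose_smul, (Qmu_posSemidef hM hμ).transpose_eq, Matrix.mul_assoc]
  abel

theorem inc_augCost_inc (μ : ℝ) : (inc n)ᵀ * M.augCost μ * inc n = M.Qmu μ := by
  simp only [augCost, Matrix.mul_sub, Matrix.sub_mul, Matrix.mul_smul, Matrix.smul_mul]
  simp only [← Matrix.mul_assoc, inc_transpose_mul_inc, inc_transpose_mul_lastCol, Matrix.zero_mul,
    Matrix.one_mul]
  simp only [Matrix.mul_assoc, inc_transpose_mul_inc, lastCol_transpose_mul_inc, Matrix.mul_zero,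
    Matrix.mul_one]
  simp

theorem statCov_transpose {X : Policy n m} (hX : X ∈ M.stab) : (M.statCov X)ᵀ = M.statCov X :=
  (M.mem_stab.mp hX).lyap_transpose W_transpose

theorem statCov_posSemidef (hM : M.Standing) {X : Policy n m} (hX : X ∈ M.stab) :
    (M.statCov X).PosSemidef :=
  (M.mem_stab.mp hX).posSemidef_of_eq (statCov_transpose hX) (statCov_eq hX) hM.W_pd.posSemidef

theorem statCov_sub_W (hM : M.Standing) {X : Policy n m} (hX : X ∈ M.stab) :
    (M.statCov X - M.W).PosSemidef := by
  nth_rw 1 [statCov_eq hX]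
  rw [add_sub_cancel_right]
  exact posSemidef_conj (statCov_posSemidef hM hX) _

/-- The stationary covariance dominates W, which handles every direction with a nonzero state
component. The other directions are multiples of the last basis vector, which the mean term sees
because the last entry of `augMean` is one. -/
theorem secondMoment_posDef (hM : M.Standing) {X : Policy n m} (hX : X ∈ M.stab) :
    (M.secondMoment X).PosDef := by
  have hcov : (M.statCov X).PosDef := by
    have := hM.W_pd.add_posSemidef (statCov_sub_W hM hX)
    simpa using this
  have h1 : (M.secondMoment X).PosSemidef := by
    refine (posSemidef_conj hcov.posSemidef _).add ?_
    simpa using psd_transpose_mul_self (M.augMean X)ᵀ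
  refine Matrix.PosDef.of_dotProduct_mulVec_pos h1.isHermitian fun {v} hv => ?_
  simp only [star_trivial]
  have hqd : v ⬝ᵥ (M.secondMoment X *ᵥ v) =
      ((inc n)ᵀ *ᵥ v) ⬝ᵥ (M.statCov X *ᵥ ((inc n)ᵀ *ᵥ v)) +
      ((M.augMean X)ᵀ *ᵥ v) ⬝ᵥ ((M.augMean X)ᵀ *ᵥ v) := by
    rw [secondMoment, Matrix.add_mulVec, dotProduct_add, ← Matrix.mulVec_mulVec,
      ← Matrix.mulVec_mulVec, ← Matrix.mulVec_mulVec, Matrix.dotProduct_mulVec v,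
      Matrix.dotProduct_mulVec v (M.augMean X), ← Matrix.mulVec_transpose, ← Matrix.mulVec_transpose]
  have h2 : 0 ≤ ((M.augMean X)ᵀ *ᵥ v) ⬝ᵥ ((M.augMean X)ᵀ *ᵥ v) :=
    Finset.sum_nonneg fun i _ => mul_self_nonneg _
  rw [hqd]
  by_cases hx : (inc n)ᵀ *ᵥ v = 0
  · have h3 : v = (lastCol n) *ᵥ ((lastCol n)ᵀ *ᵥ v) := by
      nth_rw 1 [← Matrix.one_mulVec v, ← inc_mul_transpose_add, Matrix.add_mulVec]
      rw [← Matrix.mulVec_mulVec, hx, Matrix.mulVec_zero, zero_add, Matrix.mulVec_mulVec]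
    have h4 : (M.augMean X)ᵀ *ᵥ v = (lastCol n)ᵀ *ᵥ v := by
      rw [augMean, Matrix.transpose_sub, Matrix.sub_mulVec, Matrix.transpose_mul,
        ← Matrix.mulVec_mulVec, hx, Matrix.mulVec_zero, sub_zero]
    have h5 : (lastCol n)ᵀ *ᵥ v ≠ 0 := by
      intro h0
      apply hv
      rw [h3, h0, Matrix.mulVec_zero]
    rw [hx, h4]
    simp only [Matrix.mulVec_zero, dotProduct_zero, zero_add]
    have h6 : 0 ≤ ((lastCol n)ᵀ *ᵥ v) ⬝ᵥ ((lastCol n)ᵀ *ᵥ v) :=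
      Finset.sum_nonneg fun i _ => mul_self_nonneg _
    exact h6.lt_of_ne fun h => h5 (dotProduct_self_eq_zero.mp h.symm)
  · have := hcov.dotProduct_mulVec_pos hx
    simp only [star_trivial] at this
    linarith

theorem secondMoment_transpose (hM : M.Standing) {X : Policy n m} (hX : X ∈ M.stab) :
    (M.secondMoment X)ᵀ = M.secondMoment X := (secondMoment_posDef hM hX).posSemidef.transpose_eq

/-- Cost-difference formula for the Lagrangian. -/
theorem exists_lagrForm_sub (hM : M.Standing) {μ : ℝ} (hμ : 0 ≤ μ) {X : Policy n m}
    (hX : X ∈ M.stab) : ∃ (E : Matrix (Fin m) (Fin (n + 1)) ℝ) (H : Matrix (Fin m) (Fin m) ℝ),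
      H.PosSemidef ∧ ∀ D : Policy n m, X + D ∈ M.stab →
        M.lagrForm μ (X + D) - M.lagrForm μ X =
          (((policyMat D)ᵀ * (M.R + H) * policyMat D + (policyMat D)ᵀ * E +
            Eᵀ * policyMat D) * M.secondMoment (X + D)).trace := by
  have hpos : ((inc n)ᵀ * (M.augCost μ + (policyMat X)ᵀ * M.R * policyMat X) *
      inc n).PosSemidef := by
    have h1 : (inc n)ᵀ * (M.augCost μ + (policyMat X)ᵀ * M.R * policyMat X) * inc n =
        M.Qmu μ + (gain X)ᵀ * M.R * gain X := by
      rw [Matrix.mul_add, Matrix.add_mul, inc_augCost_inc, ← policyMat_mul_inc]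
      simp only [Matrix.transpose_mul, Matrix.mul_assoc]
    rw [h1]
    exact (Qmu_posSemidef hM hμ).add (psd_conj hM.R_pd.posSemidef _)
  have hR := hM.R_pd.posSemidef.transpose_eq
  obtain ⟨P, k, hPt, hPpos, hBell⟩ := exists_bellman hX
    (C := M.augCost μ + (policyMat X)ᵀ * M.R * policyMat X)
    (by simp [augCost_transpose hM hμ, hR, Matrix.mul_assoc]) hpos
  set G := -(inc n * M.B) with hG
  have hk : ∀ Y : Policy n m, (lastCol n * k * (lastCol n)ᵀ * M.secondMoment Y).trace = k () () := by
    intro Y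
    have hk1 : k = (k () ()) • (1 : Matrix Unit Unit ℝ) := by ext i j; simp
    rw [hk1, Matrix.mul_smul, Matrix.smul_mul, Matrix.smul_mul, Matrix.mul_one, Matrix.trace_smul,
      M.secondMoment_last]
    simp
  have hdyn : ∀ D : Policy n m, M.augDyn (X + D) = M.augDyn X + G * policyMat D := by
    intro D
    rw [augDyn, augDyn, policyMat_add, Matrix.mul_add]
    abel
  refine ⟨M.R * policyMat X + Gᵀ * P * M.augDyn X, Gᵀ * P * G, ?_, fun D hD => ?_⟩
  · have h1 : Gᵀ * P * G = M.Bᵀ * ((inc n)ᵀ * P * inc n) * M.B := by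
      simp only [hG, Matrix.transpose_neg, Matrix.transpose_mul, Matrix.neg_mul, Matrix.mul_neg,
        neg_neg, Matrix.mul_assoc]
    rw [h1]
    exact psd_conj hPpos _
  · have e1 := trace_cost_eq (G := G) hR hPt (hdyn D) hBell (secondMoment_eq hD)
    have e0 := trace_cost_eq (G := G) (D := 0) (F' := M.augDyn X) hR hPt (by simp) hBell
      (secondMoment_eq hX)
    rw [hk] at e0 e1
    simp only [add_zero, Matrix.transpose_zero, Matrix.zero_mul, Matrix.mul_zero,
      Matrix.trace_zero] at e0
    rw [lagrForm, lagrForm, policyMat_add, e0, e1]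
    ring

theorem smoothAt_clm (X : Policy n m) : SmoothAt M.clm X :=
  (SmoothAt.const _).sub ((SmoothAt.const _).mul (smoothAt_gain X))

theorem smoothAt_secondMoment {X : Policy n m} (hX : X ∈ M.stab) : SmoothAt M.secondMoment X := by
  have hF := M.mem_stab.mp hX
  have h1 : SmoothAt M.statMean X :=
    (SmoothAt.inv ((SmoothAt.const 1).sub (smoothAt_clm X)) hF.isUnit_one_sub).mul
      (((SmoothAt.const _).mul (smoothAt_offset X)).add (SmoothAt.const _))
  have h2 : SmoothAt M.statCov X := SmoothAt.lyap (smoothAt_clm X) hF _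
  have h3 : SmoothAt M.augMean X := (SmoothAt.const _).sub ((SmoothAt.const _).mul h1)
  exact (((SmoothAt.const _).mul h2).mul (SmoothAt.const _)).add (h3.mul h3.transpose)

theorem contDiffAt_lagrForm (μ : ℝ) {X : Policy n m} (hX : X ∈ M.stab) :
    ContDiffAt ℝ ⊤ (M.lagrForm μ) X :=
  SmoothAt.trace (((SmoothAt.const _).add (((smoothAt_policyMat X).transpose.mul
    (SmoothAt.const _)).mul (smoothAt_policyMat X))).mul (smoothAt_secondMoment hX))

theorem isOpen_stab : IsOpen M.stab := by
  have hc : Continuous M.clm := continuous_iff_continuousAt.mpr fun X => (smoothAt_clm X).continuousAt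
  have h1 : M.stab = M.clm ⁻¹' {F | Schur F} := by ext X; exact M.mem_stab
  rw [h1]
  exact isOpen_schur.preimage hc

end Model

end RCLQR

namespace RCLQR

/-! ### Gradient formula, gradient dominance and uniqueness of the minimizer -/

namespace Model

variable {n m : ℕ} {M : Model n m}

theorem trace_cross {Φ : Matrix (Fin (n + 1)) (Fin (n + 1)) ℝ} (hΦ : Φᵀ = Φ)
    (D E : Matrix (Fin m) (Fin (n + 1)) ℝ) : (Eᵀ * D * Φ).trace = (Dᵀ * E * Φ).trace := by
  rw [← Matrix.trace_transpose]
  simp only [Matrix.transpose_mul, Matrix.transpose_transpose, hΦ]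
  rw [Matrix.trace_mul_comm]

theorem inner_gradient_lagrForm (μ : ℝ) (X V : Policy n m) :
    inner ℝ (gradient (M.lagrForm μ) X) V = fderiv ℝ (M.lagrForm μ) X V := by
  rw [gradient, InnerProductSpace.toDual_symm_apply]

/-- Cost-difference formula for the Lagrangian, together with its gradient. -/
theorem exists_lagrForm_sub_gradient (hM : M.Standing) {μ : ℝ} (hμ : 0 ≤ μ) {X : Policy n m}
    (hX : X ∈ M.stab) : ∃ (E : Matrix (Fin m) (Fin (n + 1)) ℝ) (H : Matrix (Fin m) (Fin m) ℝ),
      H.PosSemidef ∧ (∀ D : Policy n m, X + D ∈ M.stab →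
        M.lagrForm μ (X + D) - M.lagrForm μ X =
          ((policyMat D)ᵀ * (M.R + H) * policyMat D * M.secondMoment (X + D)).trace +
          2 * ((policyMat D)ᵀ * E * M.secondMoment (X + D)).trace) ∧
      ∀ V : Policy n m, inner ℝ (gradient (M.lagrForm μ) X) V =
        2 * ((policyMat V)ᵀ * E * M.secondMoment X).trace := by
  obtain ⟨E, H, hH, hsub⟩ := exists_lagrForm_sub hM hμ hX
  have hsub' : ∀ D : Policy n m, X + D ∈ M.stab →
        M.lagrForm μ (X + D) - M.lagrForm μ X =
          ((policyMat D)ᵀ * (M.R + H) * policyMat D * M.secondMoment (X + D)).trace +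
          2 * ((policyMat D)ᵀ * E * M.secondMoment (X + D)).trace := by
    intro D hD
    rw [hsub D hD, Matrix.add_mul, Matrix.add_mul, Matrix.trace_add, Matrix.trace_add,
      trace_cross (secondMoment_transpose hM hD)]
    ring
  refine ⟨E, H, hH, hsub', fun V => ?_⟩
  rw [inner_gradient_lagrForm]
  have hdiff : DifferentiableAt ℝ (M.lagrForm μ) X :=
    (contDiffAt_lagrForm μ hX).differentiableAt (by simp)
  -- The gradient is read off from the difference quotients of the exact formula along X + sV: the
  -- quadratic term is of second order in s and the second moment converges to its value at X.
  have hline : HasDerivAt (fun s : ℝ => M.lagrForm μ (X + s • V)) (fderiv ℝ (M.lagrForm μ) X V) 0 := by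
    have h1 : HasDerivAt (fun s : ℝ => X + s • V) V 0 := by
      simpa using ((hasDerivAt_id (0 : ℝ)).smul_const V).const_add X
    have h2 : HasFDerivAt (M.lagrForm μ) (fderiv ℝ (M.lagrForm μ) X) (X + (0 : ℝ) • V) := by
      simpa using hdiff.hasFDerivAt
    exact h2.comp_hasDerivAt 0 h1
  have hcl : Continuous fun s : ℝ => X + s • V := by fun_prop
  have hΦ : Tendsto (fun s : ℝ => M.secondMoment (X + s • V)) (𝓝 0) (𝓝 (M.secondMoment X)) := by
    have h1 := hcl.tendsto 0
    simp only [zero_smul, add_zero] at h1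
    exact (smoothAt_secondMoment hX).continuousAt.tendsto.comp h1
  have hst : ∀ᶠ s : ℝ in 𝓝 0, X + s • V ∈ M.stab := by
    have h1 := hcl.tendsto 0
    simp only [zero_smul, add_zero] at h1
    exact h1.eventually (isOpen_stab.mem_nhds hX)
  have hlim : Tendsto (fun s : ℝ =>
      s * ((policyMat V)ᵀ * (M.R + H) * policyMat V * M.secondMoment (X + s • V)).trace +
          2 * ((policyMat V)ᵀ * E * M.secondMoment (X + s • V)).trace) (𝓝 0)
      (𝓝 (0 * ((policyMat V)ᵀ * (M.R + H) * policyMat V * M.secondMoment X).trace +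
          2 * ((policyMat V)ᵀ * E * M.secondMoment X).trace)) := by
    have hc : Continuous fun q : ℝ × Matrix (Fin (n + 1)) (Fin (n + 1)) ℝ =>
        q.1 * ((policyMat V)ᵀ * (M.R + H) * policyMat V * q.2).trace +
          2 * ((policyMat V)ᵀ * E * q.2).trace := by fun_prop
    exact (hc.tendsto (0, M.secondMoment X)).comp (tendsto_id.prodMk_nhds hΦ)
  rw [zero_mul, zero_add] at hlim
  have hslope := hline.tendsto_slope_zero
  refine tendsto_nhds_unique hslope ((hlim.mono_left nhdsWithin_le_nhds).congr' ?_)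
  filter_upwards [self_mem_nhdsWithin, mem_nhdsWithin_of_mem_nhds hst] with s hs0 hs
  have hs0' : s ≠ 0 := hs0
  simp only [zero_add, zero_smul, add_zero]
  rw [hsub' _ hs, policyMat_smul]
  simp only [Matrix.transpose_smul, Matrix.smul_mul, Matrix.mul_smul, Matrix.trace_smul,
    smul_eq_mul]
  field_simp

theorem trace_transpose_mul_self_nonneg {Φ : Matrix (Fin (n + 1)) (Fin (n + 1)) ℝ}
    (hΦ : Φ.PosSemidef) (D : Matrix (Fin m) (Fin (n + 1)) ℝ) : 0 ≤ (Dᵀ * D * Φ).trace :=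
  trace_mul_nonneg (psd_transpose_mul_self D) hΦ

theorem smul_trace_le {Φ : Matrix (Fin (n + 1)) (Fin (n + 1)) ℝ} {c : ℝ}
    (hc : (Φ - c • 1).PosSemidef) (D : Policy n m) :
    c * ‖D‖ ^ 2 ≤ ((policyMat D)ᵀ * policyMat D * Φ).trace := by
  have h := trace_mul_nonneg (psd_transpose_mul_self (policyMat D)) hc
  rw [Matrix.mul_sub, Matrix.trace_sub, Matrix.mul_smul, Matrix.trace_smul, Matrix.mul_one,
    ← norm_sq_eq_trace, smul_eq_mul] at h
  linarith

theorem trace_le_smul {Φ : Matrix (Fin (n + 1)) (Fin (n + 1)) ℝ} {c : ℝ}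
    (hc : (c • 1 - Φ).PosSemidef) (D : Policy n m) :
    ((policyMat D)ᵀ * policyMat D * Φ).trace ≤ c * ‖D‖ ^ 2 := by
  have h := trace_mul_nonneg (psd_transpose_mul_self (policyMat D)) hc
  rw [Matrix.mul_sub, Matrix.trace_sub, Matrix.mul_smul, Matrix.trace_smul, Matrix.mul_one,
    ← norm_sq_eq_trace, smul_eq_mul] at h
  linarith

theorem le_trace_weight {r : ℝ} {R H : Matrix (Fin m) (Fin m) ℝ} (hR : (R - r • 1).PosSemidef)
    (hH : H.PosSemidef) {Φ : Matrix (Fin (n + 1)) (Fin (n + 1)) ℝ} (hΦ : Φ.PosSemidef)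
    (D : Matrix (Fin m) (Fin (n + 1)) ℝ) :
    r * (Dᵀ * D * Φ).trace ≤ (Dᵀ * (R + H) * D * Φ).trace := by
  have h := trace_mul_nonneg (psd_conj (hR.add hH) D) hΦ
  have h1 : Dᵀ * (R - r • 1 + H) * D = Dᵀ * (R + H) * D - r • (Dᵀ * D) := by
    simp only [Matrix.mul_add, Matrix.add_mul, Matrix.mul_sub, Matrix.sub_mul, Matrix.mul_smul,
      Matrix.smul_mul, Matrix.mul_one]
    abel
  rw [h1, Matrix.sub_mul, Matrix.trace_sub, Matrix.smul_mul, Matrix.trace_smul, smul_eq_mul] at h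
  linarith

/-- Test the gradient against E itself, then compare the lower bound on Φ with Cauchy-Schwarz. -/
theorem norm_le_norm_gradient {Φ : Matrix (Fin (n + 1)) (Fin (n + 1)) ℝ} {c : ℝ}
    (hc : (Φ - c • 1).PosSemidef) {g E : Policy n m}
    (hg : ∀ V : Policy n m, inner ℝ g V = 2 * ((policyMat V)ᵀ * policyMat E * Φ).trace) :
    2 * c * ‖E‖ ≤ ‖g‖ := by
  have h1 := smul_trace_le hc E
  have h2 := hg E
  have h3 := real_inner_le_norm g E
  rcases (norm_nonneg E).eq_or_lt with h0 | h0
  · rw [← h0, mul_zero]; exact norm_nonneg g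
  · nlinarith

/-- Gradient dominance relative to an arbitrary stabilizing policy, uniformly over a compact set. -/
theorem exists_gradient_dominance (hM : M.Standing) {μ : ℝ} (hμ : 0 ≤ μ) {K : Set (Policy n m)}
    (hK : IsCompact K) (hKs : K ⊆ M.stab) {Y : Policy n m} (hY : Y ∈ M.stab) :
    ∃ lam : ℝ, 0 < lam ∧ ∀ X ∈ K,
      M.lagrForm μ X - M.lagrForm μ Y ≤ lam * ‖gradient (M.lagrForm μ) X‖ ^ 2 := by
  obtain ⟨c, hc, hc0⟩ := exists_smul_one_le hK (A := M.secondMoment)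
    (fun X hX => (smoothAt_secondMoment (hKs hX)).continuousAt.continuousWithinAt)
    (fun X hX => secondMoment_transpose hM (hKs hX))
  replace hc0 := hc0 fun X hX => secondMoment_posDef hM (hKs hX)
  obtain ⟨C, hC0, hC⟩ := exists_le_smul_one (secondMoment_transpose hM hY)
  obtain ⟨r, hr0, hr⟩ := exists_pos_smul_one_le hM.R_pd
  -- C bounds the second moment at Y from above, r bounds R from below, and c bounds the second
  -- moments on K from below. The last gives 2c‖E‖ ≤ ‖∇L‖, the source of 4c².
  refine ⟨C / (4 * r * c ^ 2), by positivity, fun X hX => ?_⟩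
  obtain ⟨E, H, hH, hsub, hgrad⟩ := exists_lagrForm_sub_gradient hM hμ (hKs hX)
  have hΦ := (secondMoment_posDef hM hY).posSemidef
  have h1 := hsub (Y - X) (by simpa using hY)
  rw [add_sub_cancel] at h1
  set D := policyMat (Y - X) with hD
  have h2 := le_trace_weight hr hH hΦ D
  -- Completing the square in D: nonnegativity of this trace shows that L(Y) - L(X) is at least
  -- -tr(EᵀEΦ)/r, whatever D is.
  have h3 := trace_transpose_mul_self_nonneg hΦ (r • D + E)
  have h4 : ((r • D + E)ᵀ * (r • D + E) * M.secondMoment Y).trace =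
      r ^ 2 * (Dᵀ * D * M.secondMoment Y).trace + 2 * r * (Dᵀ * E * M.secondMoment Y).trace +
        (Eᵀ * E * M.secondMoment Y).trace := by
    simp only [Matrix.transpose_add, Matrix.transpose_smul, Matrix.add_mul, Matrix.mul_add,
      Matrix.smul_mul, Matrix.mul_smul, Matrix.trace_add, Matrix.trace_smul, smul_eq_mul]
    rw [trace_cross hΦ.transpose_eq D E]
    ring
  have h5 := trace_le_smul hC (ofMat E)
  rw [policyMat_ofMat] at h5
  have h6 := norm_le_norm_gradient (hc X hX) (E := ofMat E) hgrad
  have h7 : (2 * c * ‖ofMat E‖) ^ 2 ≤ ‖gradient (M.lagrForm μ) X‖ ^ 2 :=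
    pow_le_pow_left₀ (by positivity) h6 2
  rw [div_mul_eq_mul_div, le_div_iff₀ (by positivity)]
  have h8 : r * (M.lagrForm μ X - M.lagrForm μ Y) ≤ C * ‖ofMat E‖ ^ 2 := by
    have : r * (M.lagrForm μ Y - M.lagrForm μ X) ≥ -(Eᵀ * E * M.secondMoment Y).trace := by
      rw [h1]
      nlinarith
    linarith
  have h9 : 4 * c ^ 2 * (r * (M.lagrForm μ X - M.lagrForm μ Y)) ≤
      4 * c ^ 2 * (C * ‖ofMat E‖ ^ 2) := mul_le_mul_of_nonneg_left h8 (by positivity)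
  have h10 : C * (2 * c * ‖ofMat E‖) ^ 2 ≤ C * ‖gradient (M.lagrForm μ) X‖ ^ 2 :=
    mul_le_mul_of_nonneg_left h7 hC0.le
  nlinarith

theorem gradient_eq_zero_of_forall_le {μ : ℝ} {X : Policy n m} (hX : X ∈ M.stab)
    (hmin : ∀ Y ∈ M.stab, M.lagrForm μ X ≤ M.lagrForm μ Y) :
    gradient (M.lagrForm μ) X = 0 := by
  have h1 : IsLocalMin (M.lagrForm μ) X :=
    (isOpen_stab.mem_nhds hX : M.stab ∈ 𝓝 X) |> fun h => Filter.mem_of_superset h hmin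
  rw [gradient, h1.fderiv_eq_zero, map_zero]

/-- The minimizer of the Lagrangian is unique. -/
theorem lagrForm_lt_of_ne (hM : M.Standing) {μ : ℝ} (hμ : 0 ≤ μ) {X : Policy n m}
    (hX : X ∈ M.stab) (hmin : ∀ Y ∈ M.stab, M.lagrForm μ X ≤ M.lagrForm μ Y)
    {Y : Policy n m} (hY : Y ∈ M.stab) (hne : Y ≠ X) : M.lagrForm μ X < M.lagrForm μ Y := by
  obtain ⟨E, H, hH, hsub, hgrad⟩ := exists_lagrForm_sub_gradient hM hμ hX
  obtain ⟨c, hc0, hc⟩ := exists_pos_smul_one_le (secondMoment_posDef hM hX)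
  obtain ⟨d, hd0, hd⟩ := exists_pos_smul_one_le (secondMoment_posDef hM hY)
  obtain ⟨r, hr0, hr⟩ := exists_pos_smul_one_le hM.R_pd
  have h6 := norm_le_norm_gradient hc (E := ofMat E) hgrad
  rw [gradient_eq_zero_of_forall_le hX hmin, norm_zero] at h6
  -- The gradient vanishes at the minimizer, so E does too, and only the positive definite quadratic
  -- term of the cost difference survives.
  have hE : ‖ofMat E‖ = 0 := le_antisymm (by nlinarith) (norm_nonneg _)
  have hE' : E = 0 := by
    rw [norm_eq_zero] at hE
    rw [← policyMat_ofMat E, hE]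
    rfl
  have h1 := hsub (Y - X) (by simpa using hY)
  rw [add_sub_cancel, hE', Matrix.mul_zero, Matrix.zero_mul, Matrix.trace_zero, mul_zero,
    add_zero] at h1
  have h2 := le_trace_weight hr hH (secondMoment_posDef hM hY).posSemidef (policyMat (Y - X))
  have h3 := smul_trace_le hd (Y - X)
  have h4 : 0 < ‖Y - X‖ := norm_pos_iff.mpr (sub_ne_zero.mpr hne)
  have h5 : 0 < r * (d * ‖Y - X‖ ^ 2) := by positivity
  nlinarith

end Model

end RCLQR

namespace RCLQR

/-! ### Observability and positive semidefinite kernels -/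

section Observability

open scoped MatrixOrder Matrix.Norms.L2Operator

theorem Observable.eq_zero {n p : ℕ} {A : Matrix (Fin n) (Fin n) ℝ} {C : Matrix (Fin p) (Fin n) ℝ}
    (h : Observable A C) {v : Fin n → ℝ} (hv : ∀ t : ℕ, t < n → C *ᵥ ((A ^ t) *ᵥ v) = 0) :
    v = 0 := by
  set O := Matrix.of fun (q : Fin n × Fin p) (j : Fin n) => (C * A ^ (q.1 : ℕ)) q.2 j with hO
  have h1 : O.rank = n := h
  have h2 : O *ᵥ v = 0 := by
    ext q
    have := congrFun (hv q.1 q.1.2) q.2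
    rw [Matrix.mulVec_mulVec] at this
    exact this
  have h3 := O.mulVecLin.finrank_range_add_finrank_ker
  rw [← Matrix.rank, h1, Module.finrank_fin_fun] at h3
  have h4 : Module.finrank ℝ (LinearMap.ker O.mulVecLin) = 0 := by omega
  rw [Submodule.finrank_eq_zero] at h4
  have h5 : v ∈ LinearMap.ker O.mulVecLin := by simpa using h2
  rw [h4] at h5
  simpa using h5

/-- The squared length of the image under the square root is the quadratic form of Q. This lets
observability be used through Q alone. -/
theorem matSqrt_mulVec_eq_zero {n : ℕ} {Q : Matrix (Fin n) (Fin n) ℝ} (hQ : Q.PosSemidef)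
    {v : Fin n → ℝ} (hv : Q *ᵥ v = 0) : matSqrt Q *ᵥ v = 0 := by
  have h1 : matSqrt Q * matSqrt Q = Q :=
    CFC.sqrt_mul_sqrt_self Q (Matrix.nonneg_iff_posSemidef.mpr hQ)
  have h2 : (matSqrt Q)ᵀ = matSqrt Q := by
    have : (matSqrt Q).PosSemidef := Matrix.nonneg_iff_posSemidef.mp (CFC.sqrt_nonneg Q)
    exact this.transpose_eq
  have h3 : (matSqrt Q *ᵥ v) ⬝ᵥ (matSqrt Q *ᵥ v) = 0 := by
    rw [Matrix.dotProduct_mulVec, ← Matrix.mulVec_transpose, h2, Matrix.mulVec_mulVec, h1, hv,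
      zero_dotProduct]
  exact dotProduct_self_eq_zero.mp h3

theorem mulVec_eq_zero_of_quad {ι : Type*} [Fintype ι] {A : Matrix ι ι ℝ} (hA : A.PosSemidef)
    {v : ι → ℝ} (hv : v ⬝ᵥ (A *ᵥ v) = 0) : A *ᵥ v = 0 :=
  (hA.dotProduct_mulVec_zero_iff v).mp (by simpa using hv)

theorem mulVec_eq_zero_of_quad_posDef {ι : Type*} [Fintype ι] {A : Matrix ι ι ℝ} (hA : A.PosDef)
    {v : ι → ℝ} (hv : v ⬝ᵥ (A *ᵥ v) = 0) : v = 0 := by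
  by_contra h
  have := hA.dotProduct_mulVec_pos h
  simp only [star_trivial] at this
  exact this.ne' hv

end Observability

/-! ### Contraction rates from Lyapunov functions and Gramians -/

section Contraction

variable {n : ℕ}

theorem quad_transpose_mul_mul {ι κ : Type*} [Fintype ι] [Fintype κ] (P : Matrix ι ι ℝ)
    (F : Matrix ι κ ℝ) (v : κ → ℝ) :
    v ⬝ᵥ ((Fᵀ * P * F) *ᵥ v) = (F *ᵥ v) ⬝ᵥ (P *ᵥ (F *ᵥ v)) := by
  rw [← Matrix.mulVec_mulVec, ← Matrix.mulVec_mulVec, Matrix.dotProduct_mulVec v,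
    ← Matrix.mulVec_transpose, Matrix.transpose_transpose]

theorem dotProduct_self_nonneg' {ι : Type*} [Fintype ι] (v : ι → ℝ) : 0 ≤ v ⬝ᵥ v :=
  Finset.sum_nonneg fun i _ => mul_self_nonneg (v i)

/-- A matrix one of whose powers contracts the Euclidean norm is Schur stable. -/
theorem schur_of_contraction {F : Matrix (Fin n) (Fin n) ℝ} {N : ℕ} (hN : N ≠ 0)
    (h : ∀ v, ((F ^ N) *ᵥ v) ⬝ᵥ ((F ^ N) *ᵥ v) ≤ 1 / 2 * (v ⬝ᵥ v)) : Schur F := by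
  have h1 : ∀ (k : ℕ) (v : Fin n → ℝ),
      (((F ^ N) ^ k) *ᵥ v) ⬝ᵥ (((F ^ N) ^ k) *ᵥ v) ≤ (1 / 2) ^ k * (v ⬝ᵥ v) := by
    intro k
    induction k with
    | zero => intro v; simp
    | succ k ih =>
      intro v
      rw [pow_succ', ← Matrix.mulVec_mulVec, pow_succ']
      calc _ ≤ 1 / 2 * (((F ^ N) ^ k *ᵥ v) ⬝ᵥ ((F ^ N) ^ k *ᵥ v)) := h _
        _ ≤ 1 / 2 * ((1 / 2) ^ k * (v ⬝ᵥ v)) := by gcongr; exact ih v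
        _ = _ := by ring
  have h2 : Schur (F ^ N) := by
    refine tendsto_pi_nhds.mpr fun i => tendsto_pi_nhds.mpr fun j => ?_
    have h3 : ∀ k : ℕ, ((F ^ N) ^ k) i j ^ 2 ≤ (1 / 2) ^ k := by
      intro k
      have h4 := h1 k (Pi.single j 1)
      rw [Matrix.mulVec_single_one] at h4
      have h5 : (((F ^ N) ^ k).col j i) * (((F ^ N) ^ k).col j i) ≤
          ((F ^ N) ^ k).col j ⬝ᵥ ((F ^ N) ^ k).col j :=
        Finset.single_le_sum (f := fun l => ((F ^ N) ^ k).col j l * ((F ^ N) ^ k).col j l)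
          (fun l _ => mul_self_nonneg _) (Finset.mem_univ i)
      simp only [Matrix.col_apply, dotProduct_single, Pi.single_eq_same, mul_one] at h4 h5
      nlinarith
    have h6 : Tendsto (fun k : ℕ => ((F ^ N) ^ k) i j ^ 2) atTop (𝓝 0) :=
      squeeze_zero (fun k => sq_nonneg _) h3
        (tendsto_pow_atTop_nhds_zero_of_lt_one (by norm_num) (by norm_num))
    have h7 := h6.sqrt
    simp only [Real.sqrt_sq_eq_abs, Real.sqrt_zero] at h7
    exact (tendsto_zero_iff_abs_tendsto_zero _).mpr h7
  rw [← spectralRadius_lt_one_iff] at h2 ⊢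
  have h3 := spectrum.spectralRadius_pow_le (𝕜 := ℂ) (F.map (algebraMap ℝ ℂ)) N hN
  rw [← Matrix.map_pow] at h3
  by_contra hcon
  exact absurd (h3.trans_lt h2) (not_lt.mpr (one_le_pow₀ (not_lt.mp hcon)))

/-- The finite-horizon observability Gramian of a stage weight. -/
def gramian (F G : Matrix (Fin n) (Fin n) ℝ) : Matrix (Fin n) (Fin n) ℝ :=
  ∑ t ∈ Finset.range (n + 1), (F ^ t)ᵀ * G * F ^ t

/-- Unroll the Lyapunov equation n + 1 times. One more term than observability requires keeps the
exponent nonzero even when n = 0. -/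
theorem eq_gramian_add {F G P : Matrix (Fin n) (Fin n) ℝ} (hP : P = Fᵀ * P * F + G) :
    P = gramian F G + (F ^ (n + 1))ᵀ * P * F ^ (n + 1) := by
  have h : ∀ k : ℕ, P = ∑ t ∈ Finset.range k, (F ^ t)ᵀ * G * F ^ t + (F ^ k)ᵀ * P * F ^ k := by
    intro k
    induction k with
    | zero => simp
    | succ k ih =>
      rw [Finset.sum_range_succ]
      nth_rw 1 [ih]
      nth_rw 1 [hP]
      rw [pow_succ', Matrix.transpose_mul]
      simp only [Matrix.mul_add, Matrix.add_mul, Matrix.mul_assoc]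
      abel
  exact h _

/-- The form vᵀPv is a Lyapunov function: applying H removes vᵀGv, which is at least the fraction
g/p of vᵀPv. Since P dominates G, the form also controls the Euclidean norm from below, so the rate
depends on g and p only. -/
theorem contraction_of_bounds {H P G : Matrix (Fin n) (Fin n) ℝ} {g p : ℝ} (hg : 0 < g)
    (hgp : g ≤ p) (hP : P = G + Hᵀ * P * H) (hG : ∀ v, g * (v ⬝ᵥ v) ≤ v ⬝ᵥ (G *ᵥ v))
    (hP0 : P.PosSemidef) (hPp : ∀ v, v ⬝ᵥ (P *ᵥ v) ≤ p * (v ⬝ᵥ v)) (k : ℕ) (v : Fin n → ℝ) :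
    g * ((H ^ k *ᵥ v) ⬝ᵥ (H ^ k *ᵥ v)) ≤ (1 - g / p) ^ k * (p * (v ⬝ᵥ v)) := by
  have hp : 0 < p := hg.trans_le hgp
  have hθ : 0 ≤ 1 - g / p := by rw [sub_nonneg, div_le_one hp]; exact hgp
  have hstep : ∀ v, (H *ᵥ v) ⬝ᵥ (P *ᵥ (H *ᵥ v)) = v ⬝ᵥ (P *ᵥ v) - v ⬝ᵥ (G *ᵥ v) := by
    intro v
    have : v ⬝ᵥ (P *ᵥ v) = v ⬝ᵥ ((G + Hᵀ * P * H) *ᵥ v) := by rw [← hP]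
    rw [this, Matrix.add_mulVec, dotProduct_add, quad_transpose_mul_mul]
    ring
  have hcon : ∀ v, (H *ᵥ v) ⬝ᵥ (P *ᵥ (H *ᵥ v)) ≤ (1 - g / p) * (v ⬝ᵥ (P *ᵥ v)) := by
    intro v
    rw [hstep]
    have h1 : g / p * (v ⬝ᵥ (P *ᵥ v)) ≤ g / p * (p * (v ⬝ᵥ v)) :=
      mul_le_mul_of_nonneg_left (hPp v) (by positivity)
    have h2 : g / p * (p * (v ⬝ᵥ v)) = g * (v ⬝ᵥ v) := by field_simp
    have h3 := hG v
    linarith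
  have hiter : ∀ k : ℕ, (H ^ k *ᵥ v) ⬝ᵥ (P *ᵥ (H ^ k *ᵥ v)) ≤ (1 - g / p) ^ k * (v ⬝ᵥ (P *ᵥ v)) := by
    intro k
    induction k with
    | zero => simp
    | succ k ih =>
      rw [pow_succ', ← Matrix.mulVec_mulVec, pow_succ', mul_assoc]
      exact (hcon _).trans (mul_le_mul_of_nonneg_left ih hθ)
  have hlow : ∀ v, g * (v ⬝ᵥ v) ≤ v ⬝ᵥ (P *ᵥ v) := by
    intro v
    have h1 := hP0.quad_nonneg (H *ᵥ v)
    rw [hstep] at h1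
    linarith [hG v]
  exact (hlow _).trans ((hiter k).trans (mul_le_mul_of_nonneg_left (hPp v) (pow_nonneg hθ k)))

end Contraction

/-! ### Trace inequalities -/

section Traces

variable {ι κ : Type*} [Fintype ι] [Fintype κ]

theorem smul_trace_le_trace_conj [DecidableEq ι] {A : Matrix ι ι ℝ} {c : ℝ}
    (h : (A - c • 1).PosSemidef) (x : Matrix ι κ ℝ) :
    c * (xᵀ * x).trace ≤ (xᵀ * A * x).trace := by
  have h1 := (psd_conj h x).trace_nonneg
  rw [Matrix.mul_sub, Matrix.sub_mul, Matrix.trace_sub, Matrix.mul_smul, Matrix.mul_one,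
    Matrix.smul_mul, Matrix.trace_smul, smul_eq_mul] at h1
  linarith

theorem trace_conj_le [DecidableEq ι] {A : Matrix ι ι ℝ} (hA : A.PosSemidef) (x : Matrix ι κ ℝ) :
    (xᵀ * A * x).trace ≤ A.trace * (xᵀ * x).trace := by
  have h : (A.trace • 1 - A).PosSemidef := by
    refine psd_of_forall (by simp [hA.transpose_eq]) fun v => ?_
    rw [Matrix.sub_mulVec, dotProduct_sub, Matrix.smul_mulVec, Matrix.one_mulVec, dotProduct_smul,
      smul_eq_mul]
    linarith [quad_le_trace hA v]
  have h1 := (psd_conj h x).trace_nonneg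
  rw [Matrix.mul_sub, Matrix.sub_mul, Matrix.trace_sub, Matrix.mul_smul, Matrix.mul_one,
    Matrix.smul_mul, Matrix.trace_smul, smul_eq_mul] at h1
  linarith

theorem trace_add_sq_le (a b : Matrix ι κ ℝ) :
    ((a + b)ᵀ * (a + b)).trace ≤ 2 * (aᵀ * a).trace + 2 * (bᵀ * b).trace := by
  have h := (psd_transpose_mul_self (a - b)).trace_nonneg
  have h2 : ((a - b)ᵀ * (a - b)).trace + ((a + b)ᵀ * (a + b)).trace =
      2 * (aᵀ * a).trace + 2 * (bᵀ * b).trace := by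
    simp only [Matrix.transpose_add, Matrix.transpose_sub, Matrix.add_mul, Matrix.mul_add,
      Matrix.sub_mul, Matrix.mul_sub, Matrix.trace_add, Matrix.trace_sub]
    ring
  linarith

end Traces

end RCLQR

namespace RCLQR

/-! ### Coercivity and compact sublevel sets -/

namespace Model

variable {n m : ℕ} {M : Model n m}

/-- A vector in the kernel produces a trajectory on which both Q and the gain vanish. Closed and
open loop then agree along it, and observability of (A, Q^(1/2)) forces the vector to be zero.
Stability of the policy plays no role, so the Gramian can be bounded below on a whole closed ball.
-/
theorem gramian_posDef (hM : M.Standing) {μ : ℝ} (hμ : 0 ≤ μ) (X : Policy n m) :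
    (gramian (M.clm X) (M.Qmu μ + (gain X)ᵀ * M.R * gain X)).PosDef := by
  set F := M.clm X with hF
  set G := M.Qmu μ + (gain X)ᵀ * M.R * gain X with hG
  have hQW : (M.Q * M.W * M.Q).PosSemidef := by
    have := psd_conj hM.W_pd.posSemidef M.Q
    rwa [hM.Q_psd.transpose_eq] at this
  have hK := psd_conj hM.R_pd.posSemidef (gain X)
  have hGp : G.PosSemidef := (Qmu_posSemidef hM hμ).add hK
  have hterm : ∀ t : ℕ, ((F ^ t)ᵀ * G * F ^ t).PosSemidef := fun t => psd_conj hGp _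
  have hsum : (gramian F G).PosSemidef := Matrix.posSemidef_sum _ fun t _ => hterm t
  refine Matrix.PosDef.of_dotProduct_mulVec_pos hsum.isHermitian fun {v} hv => ?_
  simp only [star_trivial]
  refine (hsum.quad_nonneg v).lt_of_ne fun h0 => hv ?_
  have h1 : v ⬝ᵥ (gramian F G *ᵥ v) =
      ∑ t ∈ Finset.range (n + 1), v ⬝ᵥ (((F ^ t)ᵀ * G * F ^ t) *ᵥ v) := by
    rw [gramian, Matrix.sum_mulVec, dotProduct_sum]
  have h2 : ∀ t ∈ Finset.range (n + 1), v ⬝ᵥ (((F ^ t)ᵀ * G * F ^ t) *ᵥ v) = 0 := by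
    rw [← Finset.sum_eq_zero_iff_of_nonneg fun t _ => (hterm t).quad_nonneg v, ← h1]
    exact h0.symm
  have h3 : ∀ t : ℕ, t < n + 1 → M.Q *ᵥ (F ^ t *ᵥ v) = 0 ∧ gain X *ᵥ (F ^ t *ᵥ v) = 0 := by
    intro t ht
    have h4 := h2 t (Finset.mem_range.mpr ht)
    rw [quad_transpose_mul_mul] at h4
    set y := F ^ t *ᵥ v
    have h5 : y ⬝ᵥ (G *ᵥ y) = y ⬝ᵥ (M.Q *ᵥ y) + 4 * μ * (y ⬝ᵥ ((M.Q * M.W * M.Q) *ᵥ y)) +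
        (gain X *ᵥ y) ⬝ᵥ (M.R *ᵥ (gain X *ᵥ y)) := by
      rw [hG, Qmu, Matrix.add_mulVec, Matrix.add_mulVec, dotProduct_add, dotProduct_add,
        Matrix.smul_mulVec, dotProduct_smul, smul_eq_mul, quad_transpose_mul_mul]
    have h6 := hM.Q_psd.quad_nonneg y
    have h7 : 0 ≤ 4 * μ * (y ⬝ᵥ ((M.Q * M.W * M.Q) *ᵥ y)) :=
      mul_nonneg (by positivity) (hQW.quad_nonneg y)
    have h8 := hM.R_pd.posSemidef.quad_nonneg (gain X *ᵥ y)
    exact ⟨mulVec_eq_zero_of_quad hM.Q_psd (by linarith),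
      mulVec_eq_zero_of_quad_posDef hM.R_pd (by linarith)⟩
  have h4 : ∀ t : ℕ, t < n + 1 → F ^ t *ᵥ v = M.A ^ t *ᵥ v := by
    intro t
    induction t with
    | zero => intro _; simp
    | succ t ih =>
      intro ht
      have h5 := (h3 t (by omega)).2
      rw [pow_succ', ← Matrix.mulVec_mulVec, pow_succ', ← Matrix.mulVec_mulVec, ← ih (by omega)]
      nth_rw 1 [hF]
      rw [clm, Matrix.sub_mulVec, ← Matrix.mulVec_mulVec, h5, Matrix.mulVec_zero, sub_zero]
  refine hM.observable.eq_zero fun t ht => matSqrt_mulVec_eq_zero hM.Q_psd ?_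
  rw [← h4 t (by omega)]
  exact (h3 t (by omega)).1

/-- A vector in the kernel is fixed by A and annihilated by Q, hence unobservable. Positivity bounds
the stationary mean x̄ from its cost and from (1 - A)x̄ = Bū + w̄, with ū the mean input. -/
theorem posDef_Q_add (hM : M.Standing) : (M.Q + (1 - M.A)ᵀ * (1 - M.A)).PosDef := by
  have hsum : (M.Q + (1 - M.A)ᵀ * (1 - M.A)).PosSemidef :=
    hM.Q_psd.add (psd_transpose_mul_self _)
  refine Matrix.PosDef.of_dotProduct_mulVec_pos hsum.isHermitian fun {v} hv => ?_
  simp only [star_trivial]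
  refine (hsum.quad_nonneg v).lt_of_ne fun h0 => hv ?_
  have h1 := hM.Q_psd.quad_nonneg v
  have h2 : v ⬝ᵥ (((1 - M.A)ᵀ * (1 - M.A)) *ᵥ v) = ((1 - M.A) *ᵥ v) ⬝ᵥ ((1 - M.A) *ᵥ v) := by
    have := quad_transpose_mul_mul (1 : Matrix (Fin n) (Fin n) ℝ) (1 - M.A) v
    simpa using this
  have h3 := dotProduct_self_nonneg' ((1 - M.A) *ᵥ v)
  rw [Matrix.add_mulVec, dotProduct_add, h2] at h0
  have h4 := mulVec_eq_zero_of_quad hM.Q_psd (v := v) (by linarith)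
  have h5 : M.A *ᵥ v = v := by
    have : (1 - M.A) *ᵥ v = 0 := dotProduct_self_eq_zero.mp (by linarith)
    rw [Matrix.sub_mulVec, Matrix.one_mulVec, sub_eq_zero] at this
    exact this.symm
  have h6 : ∀ t : ℕ, M.A ^ t *ᵥ v = v := by
    intro t
    induction t with
    | zero => simp
    | succ t ih => rw [pow_succ, ← Matrix.mulVec_mulVec, h5, ih]
  refine hM.observable.eq_zero fun t _ => matSqrt_mulVec_eq_zero hM.Q_psd ?_
  rw [h6]
  exact h4

theorem policyMat_mul_augMean (X : Policy n m) :
    policyMat X * M.augMean X = replicateCol Unit (offset X) - gain X * M.statMean X := by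
  rw [augMean, Matrix.mul_sub, policyMat_mul_lastCol, ← Matrix.mul_assoc, policyMat_mul_inc]

theorem inc_transpose_mul_augMean (X : Policy n m) :
    (inc n)ᵀ * M.augMean X = -M.statMean X := by
  rw [augMean, Matrix.mul_sub, ← Matrix.mul_assoc, inc_transpose_mul_inc, inc_transpose_mul_lastCol,
    Matrix.one_mul, zero_sub]

theorem lastCol_transpose_mul_augMean (X : Policy n m) : (lastCol n)ᵀ * M.augMean X = 1 := by
  rw [augMean, Matrix.mul_sub, ← Matrix.mul_assoc, lastCol_transpose_mul_inc,
    lastCol_transpose_mul_lastCol, Matrix.zero_mul, sub_zero]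

/-- The Lagrangian splits into the contributions of the stationary covariance and mean. -/
theorem lagrForm_eq (μ : ℝ) (X : Policy n m) : M.lagrForm μ X =
    ((M.Qmu μ + (gain X)ᵀ * M.R * gain X) * M.statCov X).trace +
      (((M.statMean X)ᵀ * M.Qmu μ * M.statMean X).trace +
        2 * ((M.statMean X)ᵀ * replicateCol Unit (M.Svec μ)).trace - μ * M.tolBar) +
      ((policyMat X * M.augMean X)ᵀ * M.R * (policyMat X * M.augMean X)).trace := by
  have h1 : ((M.augCost μ + (policyMat X)ᵀ * M.R * policyMat X) *
      (inc n * M.statCov X * (inc n)ᵀ)).trace =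
      ((M.Qmu μ + (gain X)ᵀ * M.R * gain X) * M.statCov X).trace := by
    have h2 : (inc n)ᵀ * (M.augCost μ + (policyMat X)ᵀ * M.R * policyMat X) * inc n =
        M.Qmu μ + (gain X)ᵀ * M.R * gain X := by
      rw [Matrix.mul_add, Matrix.add_mul, inc_augCost_inc, ← policyMat_mul_inc]
      simp only [Matrix.transpose_mul, Matrix.mul_assoc]
    rw [← h2, ← Matrix.mul_assoc, Matrix.trace_mul_comm]
    simp only [Matrix.mul_assoc]
  have h3 : ((M.augCost μ + (policyMat X)ᵀ * M.R * policyMat X) *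
      (M.augMean X * (M.augMean X)ᵀ)).trace =
      ((M.augMean X)ᵀ * M.augCost μ * M.augMean X).trace +
      ((policyMat X * M.augMean X)ᵀ * M.R * (policyMat X * M.augMean X)).trace := by
    rw [← Matrix.mul_assoc, Matrix.trace_mul_comm, ← Matrix.trace_add]
    simp only [Matrix.transpose_mul, Matrix.mul_add, Matrix.add_mul, Matrix.mul_assoc]
  have h4 : ((M.augMean X)ᵀ * M.augCost μ * M.augMean X).trace =
      ((M.statMean X)ᵀ * M.Qmu μ * M.statMean X).trace +
        2 * ((M.statMean X)ᵀ * replicateCol Unit (M.Svec μ)).trace - μ * M.tolBar := by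
    have h5 : (M.augMean X)ᵀ * M.augCost μ * M.augMean X =
        ((inc n)ᵀ * M.augMean X)ᵀ * M.Qmu μ * ((inc n)ᵀ * M.augMean X) -
        ((inc n)ᵀ * M.augMean X)ᵀ * replicateCol Unit (M.Svec μ) * ((lastCol n)ᵀ * M.augMean X) -
        ((lastCol n)ᵀ * M.augMean X)ᵀ * (replicateCol Unit (M.Svec μ))ᵀ *
          ((inc n)ᵀ * M.augMean X) -
        (μ * M.tolBar) • (((lastCol n)ᵀ * M.augMean X)ᵀ * ((lastCol n)ᵀ * M.augMean X)) := by
      simp only [augCost, Matrix.transpose_mul, Matrix.transpose_transpose, Matrix.mul_sub,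
        Matrix.sub_mul, Matrix.mul_smul, Matrix.smul_mul, Matrix.mul_assoc]
    have h6 : ((replicateCol Unit (M.Svec μ))ᵀ * M.statMean X).trace =
        ((M.statMean X)ᵀ * replicateCol Unit (M.Svec μ)).trace := by
      rw [← Matrix.trace_transpose, Matrix.transpose_mul, Matrix.transpose_transpose]
    rw [h5, inc_transpose_mul_augMean, lastCol_transpose_mul_augMean]
    simp only [Matrix.transpose_neg, Matrix.neg_mul, Matrix.mul_neg, neg_neg, Matrix.mul_one,
      Matrix.transpose_one, Matrix.one_mul, Matrix.trace_sub, Matrix.trace_neg, Matrix.trace_smul,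
      h6]
    simp
    ring
  rw [lagrForm, secondMoment, Matrix.mul_add, Matrix.trace_add, h1, h3, h4]
  ring

/-- The third-moment term is linear in y = Qx̄, and the risk term 4μ yᵀWy dominates it because W is
positive definite. The square of 2wy + a, divided by 4w, shows that the loss is at most a constant.
-/
theorem exists_le_lagrForm (hM : M.Standing) {μ : ℝ} (hμ : 0 ≤ μ) : ∃ C : ℝ, ∀ X ∈ M.stab,
    ((M.Qmu μ + (gain X)ᵀ * M.R * gain X) * M.statCov X).trace +
      ((M.statMean X)ᵀ * M.Q * M.statMean X).trace +
      ((policyMat X * M.augMean X)ᵀ * M.R * (policyMat X * M.augMean X)).trace ≤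
    M.lagrForm μ X + C := by
  obtain ⟨w, hw0, hw⟩ := exists_pos_smul_one_le hM.W_pd
  set a := replicateCol Unit M.M3 with ha
  refine ⟨μ * M.tolBar + 4 * μ * ((aᵀ * a).trace / (4 * w)), fun X _ => ?_⟩
  rw [lagrForm_eq]
  set x := M.statMean X with hx
  set y := M.Q * x with hy
  have hQt := hM.Q_psd.transpose_eq
  have h1 : (xᵀ * M.Qmu μ * x).trace = (xᵀ * M.Q * x).trace + 4 * μ * (yᵀ * M.W * y).trace := by
    rw [Qmu, Matrix.mul_add, Matrix.add_mul, Matrix.trace_add, Matrix.mul_smul, Matrix.smul_mul,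
      Matrix.trace_smul, smul_eq_mul, hy, Matrix.transpose_mul, hQt]
    simp only [Matrix.mul_assoc]
  have h2 : (xᵀ * replicateCol Unit (M.Svec μ)).trace = 2 * μ * (yᵀ * a).trace := by
    have h3 : replicateCol Unit (M.Svec μ) = (2 * μ) • (M.Q * a) := by
      ext i j
      simp [Svec, ha, Matrix.mul_apply, Matrix.mulVec, dotProduct]
    rw [h3, Matrix.mul_smul, Matrix.trace_smul, smul_eq_mul, hy, Matrix.transpose_mul, hQt,
      Matrix.mul_assoc]
  have h3 := smul_trace_le_trace_conj hw y
  have h4 := (psd_transpose_mul_self ((2 * w) • y + a)).trace_nonneg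
  have h5 : (((2 * w) • y + a)ᵀ * ((2 * w) • y + a)).trace =
      4 * w ^ 2 * (yᵀ * y).trace + 4 * w * (yᵀ * a).trace + (aᵀ * a).trace := by
    have h6 : (aᵀ * y).trace = (yᵀ * a).trace := by
      rw [← Matrix.trace_transpose, Matrix.transpose_mul, Matrix.transpose_transpose]
    simp only [Matrix.transpose_add, Matrix.transpose_smul, Matrix.add_mul, Matrix.mul_add,
      Matrix.smul_mul, Matrix.mul_smul, Matrix.trace_add, Matrix.trace_smul, smul_eq_mul, h6]
    ring
  have h6 : 0 ≤ (yᵀ * M.W * y).trace + (yᵀ * a).trace + (aᵀ * a).trace / (4 * w) := by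
    have h7 : w * (yᵀ * y).trace + (yᵀ * a).trace + (aᵀ * a).trace / (4 * w) =
        (((2 * w) • y + a)ᵀ * ((2 * w) • y + a)).trace / (4 * w) := by
      rw [h5]; field_simp
    have h8 : 0 ≤ (((2 * w) • y + a)ᵀ * ((2 * w) • y + a)).trace / (4 * w) := by positivity
    linarith
  have h7 := mul_nonneg (show (0 : ℝ) ≤ 4 * μ by positivity) h6
  rw [h1, h2]
  linarith

theorem trace_policyMat_sq (X : Policy n m) : ‖X‖ ^ 2 = ((gain X)ᵀ * gain X).trace +
    ((replicateCol Unit (offset X))ᵀ * replicateCol Unit (offset X)).trace := by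
  rw [norm_sq_eq_trace, Matrix.trace_mul_comm]
  nth_rw 1 [policyMat_eq X]
  rw [Matrix.add_mul, Matrix.trace_add, Matrix.mul_assoc, Matrix.mul_assoc, Matrix.trace_mul_comm,
    ← Matrix.transpose_mul, policyMat_mul_inc, Matrix.trace_mul_comm (replicateCol _ _),
    ← Matrix.transpose_mul, policyMat_mul_lastCol]

/-- The Lyapunov equations for P and for the covariance are dual under the trace pairing. With W
positive definite, the cost therefore bounds P. -/
theorem trace_weight_mul_statCov {μ : ℝ} (hM : M.Standing) (hμ : 0 ≤ μ) {X : Policy n m}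
    (hX : X ∈ M.stab) :
    ∃ P : Matrix (Fin n) (Fin n) ℝ, P.PosSemidef ∧
      P = (M.clm X)ᵀ * P * M.clm X + (M.Qmu μ + (gain X)ᵀ * M.R * gain X) ∧
      (P * M.W).trace = ((M.Qmu μ + (gain X)ᵀ * M.R * gain X) * M.statCov X).trace := by
  have hS := (M.mem_stab.mp hX).transpose
  set G := M.Qmu μ + (gain X)ᵀ * M.R * gain X
  have hG : G.PosSemidef := (Qmu_posSemidef hM hμ).add (psd_conj hM.R_pd.posSemidef _)
  have h1 : lyap (M.clm X)ᵀ G = (M.clm X)ᵀ * lyap (M.clm X)ᵀ G * M.clm X + G := by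
    simpa using hS.lyap_eq G
  refine ⟨lyap (M.clm X)ᵀ G, hS.posSemidef_of_eq (hS.lyap_transpose hG.transpose_eq)
    (hS.lyap_eq G) hG, h1, ?_⟩
  set P := lyap (M.clm X)ᵀ G
  have h2 : (P * M.statCov X).trace =
      (((M.clm X)ᵀ * P * M.clm X + G) * M.statCov X).trace := by rw [← h1]
  have h3 : (P * M.statCov X).trace =
      (P * (M.clm X * M.statCov X * (M.clm X)ᵀ + M.W)).trace := by rw [← statCov_eq hX]
  have h4 : ((M.clm X)ᵀ * P * M.clm X * M.statCov X).trace =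
      (P * (M.clm X * M.statCov X * (M.clm X)ᵀ)).trace := by
    rw [Matrix.mul_assoc, Matrix.mul_assoc, Matrix.trace_mul_comm]
    simp only [Matrix.mul_assoc]
  rw [Matrix.add_mul, Matrix.trace_add, h4] at h2
  rw [Matrix.mul_add, Matrix.trace_add, h2] at h3
  linarith

/-- Policies with a bounded Lagrangian are bounded, and the cost-to-go matrices are bounded too. -/
theorem exists_bounds (hM : M.Standing) {μ : ℝ} (hμ : 0 ≤ μ) (a : ℝ) : ∃ ρ p : ℝ, ∀ X ∈ M.stab,
    M.lagrForm μ X ≤ a → ‖X‖ ≤ ρ ∧ ∃ P : Matrix (Fin n) (Fin n) ℝ, P.PosSemidef ∧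
      P = (M.clm X)ᵀ * P * M.clm X + (M.Qmu μ + (gain X)ᵀ * M.R * gain X) ∧
      ∀ v, v ⬝ᵥ (P *ᵥ v) ≤ p * (v ⬝ᵥ v) := by
  obtain ⟨C, hC⟩ := exists_le_lagrForm hM hμ
  obtain ⟨w, hw0, hw⟩ := exists_pos_smul_one_le hM.W_pd
  obtain ⟨r, hr0, hr⟩ := exists_pos_smul_one_le hM.R_pd
  obtain ⟨c, hc0, hc⟩ := exists_pos_smul_one_le (posDef_Q_add hM)
  set b := a + C with hb
  set ω := ((replicateCol Unit M.wbar)ᵀ * replicateCol Unit M.wbar).trace with hω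
  set β := (M.Bᵀ * M.B).trace with hβ
  have hβ0 : 0 ≤ β := (psd_transpose_mul_self M.B).trace_nonneg
  set xb := (b + 2 * (β * (b / r)) + 2 * ω) / c with hxb
  refine ⟨Real.sqrt (b / (r * w) + (2 * (b / r) + 2 * (b / (r * w) * xb))), b / w, fun X hX hXa => ?_⟩
  have hcov := statCov_posSemidef hM hX
  have hlow := hC X hX
  set u := policyMat X * M.augMean X with hu
  set x := M.statMean X with hx
  set K := gain X with hK
  have t1 : 0 ≤ ((M.Qmu μ + Kᵀ * M.R * K) * M.statCov X).trace :=
    trace_mul_nonneg ((Qmu_posSemidef hM hμ).add (psd_conj hM.R_pd.posSemidef _)) hcov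
  have t2 : 0 ≤ (xᵀ * M.Q * x).trace := (psd_conj hM.Q_psd x).trace_nonneg
  have t3 : 0 ≤ (uᵀ * M.R * u).trace := (psd_conj hM.R_pd.posSemidef u).trace_nonneg
  have hb0 : 0 ≤ b := by linarith
  have hu1 : (uᵀ * u).trace ≤ b / r := by
    rw [le_div_iff₀ hr0]
    linarith [smul_trace_le_trace_conj hr u]
  have hu0 : 0 ≤ (uᵀ * u).trace := (psd_transpose_mul_self u).trace_nonneg
  -- The input cost of the fluctuations is at least rw‖K‖², since R ⪰ r and the covariance dominates
  -- W ⪰ w.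
  have hK1 : (Kᵀ * K).trace ≤ b / (r * w) := by
    rw [le_div_iff₀ (by positivity)]
    have e1 : 0 ≤ (M.Qmu μ * M.statCov X).trace := trace_mul_nonneg (Qmu_posSemidef hM hμ) hcov
    have e2 : 0 ≤ (Kᵀ * (M.R - r • 1) * K * M.statCov X).trace :=
      trace_mul_nonneg (psd_conj hr K) hcov
    have e3 : 0 ≤ ((Kᵀ * K) * (M.statCov X - M.W + (M.W - w • 1))).trace :=
      trace_mul_nonneg (psd_transpose_mul_self K) ((statCov_sub_W hM hX).add hw)
    rw [sub_add_sub_cancel, Matrix.mul_sub, Matrix.trace_sub, Matrix.mul_smul, Matrix.mul_one,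
      Matrix.trace_smul, smul_eq_mul] at e3
    rw [Matrix.mul_sub, Matrix.sub_mul, Matrix.sub_mul, Matrix.trace_sub, Matrix.mul_smul,
      Matrix.mul_one, Matrix.smul_mul, Matrix.smul_mul, Matrix.trace_smul, smul_eq_mul] at e2
    rw [Matrix.add_mul, Matrix.trace_add] at hlow
    nlinarith
  have hK0 : 0 ≤ (Kᵀ * K).trace := (psd_transpose_mul_self K).trace_nonneg
  have hx1 : (xᵀ * x).trace ≤ xb := by
    rw [hxb, le_div_iff₀ hc0]
    have e1 := smul_trace_le_trace_conj hc x
    have e2 : (1 - M.A) * x = M.B * u + replicateCol Unit M.wbar := by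
      rw [hu, policyMat_mul_augMean, Matrix.sub_mul, Matrix.one_mul]
      nth_rw 1 [hx, statMean_eq hX]
      rw [clm, Matrix.sub_mul, Matrix.mul_sub, Matrix.mul_assoc]
      abel
    have e3 : (xᵀ * (M.Q + (1 - M.A)ᵀ * (1 - M.A)) * x).trace = (xᵀ * M.Q * x).trace +
        ((M.B * u + replicateCol Unit M.wbar)ᵀ * (M.B * u + replicateCol Unit M.wbar)).trace := by
      rw [← e2, Matrix.mul_add, Matrix.add_mul, Matrix.trace_add]
      simp only [Matrix.transpose_mul, Matrix.mul_assoc]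
    have e4 := trace_add_sq_le (M.B * u) (replicateCol Unit M.wbar)
    have e5 : ((M.B * u)ᵀ * (M.B * u)).trace ≤ β * (uᵀ * u).trace := by
      have := trace_conj_le (psd_transpose_mul_self M.B) u
      simpa only [Matrix.transpose_mul, Matrix.mul_assoc] using this
    have e6 : β * (uᵀ * u).trace ≤ β * (b / r) := mul_le_mul_of_nonneg_left hu1 hβ0
    linarith
  have hx0 : 0 ≤ (xᵀ * x).trace := (psd_transpose_mul_self x).trace_nonneg
  constructor
  · refine Real.le_sqrt_of_sq_le ?_
    rw [trace_policyMat_sq]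
    -- The offset is recovered from the mean input, the gain and the mean state, all of which are
    -- already bounded.
    have e1 : replicateCol Unit (offset X) = u + K * x := by
      rw [hu, policyMat_mul_augMean]; abel
    have e2 := trace_add_sq_le u (K * x)
    have e3 : ((K * x)ᵀ * (K * x)).trace ≤ (Kᵀ * K).trace * (xᵀ * x).trace := by
      have := trace_conj_le (psd_transpose_mul_self K) x
      simpa only [Matrix.transpose_mul, Matrix.mul_assoc] using this
    have e4 : (Kᵀ * K).trace * (xᵀ * x).trace ≤ b / (r * w) * xb :=
      mul_le_mul hK1 hx1 hx0 (by positivity)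
    rw [e1]
    linarith
  · obtain ⟨P, hP, hPeq, hPtr⟩ := trace_weight_mul_statCov hM hμ hX
    refine ⟨P, hP, hPeq, fun v => (quad_le_trace hP v).trans ?_⟩
    refine mul_le_mul_of_nonneg_right ?_ (dotProduct_self_nonneg' v)
    rw [le_div_iff₀ hw0]
    have e1 := trace_mul_nonneg hP hw
    rw [Matrix.mul_sub, Matrix.trace_sub, Matrix.mul_smul, Matrix.mul_one, Matrix.trace_smul,
      smul_eq_mul] at e1
    linarith

theorem continuous_clm : Continuous M.clm :=
  continuous_iff_continuousAt.mpr fun X => (smoothAt_clm X).continuousAt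

theorem continuous_gain : Continuous (gain (n := n) (m := m)) :=
  continuous_iff_continuousAt.mpr fun X => (smoothAt_gain X).continuousAt

/-- The Lagrangian has compact sublevel sets inside the set of stabilizing policies. -/
theorem isCompact_sublevel (hM : M.Standing) {μ : ℝ} (hμ : 0 ≤ μ) (a : ℝ) :
    IsCompact {X | X ∈ M.stab ∧ M.lagrForm μ X ≤ a} := by
  obtain ⟨ρ, p, hbd⟩ := exists_bounds hM hμ a
  have hgc : Continuous fun X : Policy n m =>
      gramian (M.clm X) (M.Qmu μ + (gain X)ᵀ * M.R * gain X) := by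
    have h1 := continuous_clm (M := M)
    have h2 := continuous_gain (n := n) (m := m)
    unfold gramian
    fun_prop
  -- One lower bound for the Gramian on the whole ball, including policies that do not stabilize.
  obtain ⟨g, hg, hg0⟩ := exists_smul_one_le (isCompact_closedBall (0 : Policy n m) ρ)
    hgc.continuousOn (fun X _ => (gramian_posDef hM hμ X).posSemidef.transpose_eq)
  replace hg0 := hg0 fun X _ => gramian_posDef hM hμ X
  -- Enlarging p to at least g makes 1 - g/q a ratio in [0, 1), independent of the policy.
  set q := max p g with hq
  have hgq : g ≤ q := le_max_right _ _
  have hq0 : 0 < q := hg0.trans_le hgq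
  have hθ0 : 0 ≤ 1 - g / q := by rw [sub_nonneg, div_le_one hq0]; exact hgq
  have hθ1 : 1 - g / q < 1 := by have := div_pos hg0 hq0; linarith
  obtain ⟨k, hk0, hk⟩ : ∃ k : ℕ, k ≠ 0 ∧ (1 - g / q) ^ k * q < g * (1 / 2) := by
    have h1 := (tendsto_pow_atTop_nhds_zero_of_lt_one hθ0 hθ1).mul_const q
    rw [zero_mul] at h1
    obtain ⟨k, hk, hk0⟩ := ((h1.eventually (gt_mem_nhds (show 0 < g * (1 / 2) by positivity))).and
      (eventually_ne_atTop 0)).exists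
    exact ⟨k, hk0, hk⟩
  set N := (n + 1) * k with hN
  have hN0 : N ≠ 0 := Nat.mul_ne_zero (Nat.succ_ne_zero n) hk0
  -- The contraction condition with a fixed exponent is closed, certifies stability, and holds on
  -- the sublevel set. This keeps the sublevel set away from the boundary of the stabilizing
  -- policies.
  set Z : Set (Policy n m) := {X | ‖X‖ ≤ ρ ∧ ∀ v, ((M.clm X ^ N) *ᵥ v) ⬝ᵥ ((M.clm X ^ N) *ᵥ v) ≤
    1 / 2 * (v ⬝ᵥ v)} with hZ
  have hZs : Z ⊆ M.stab := fun X hX => M.mem_stab.mpr (schur_of_contraction hN0 hX.2)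
  have hZc : IsClosed Z := by
    have hZi : Z = {X | ‖X‖ ≤ ρ} ∩ ⋂ v : Fin n → ℝ, {X : Policy n m |
        ((M.clm X ^ N) *ᵥ v) ⬝ᵥ ((M.clm X ^ N) *ᵥ v) ≤ 1 / 2 * (v ⬝ᵥ v)} := by
      ext X
      simp [hZ]
    rw [hZi]
    refine IsClosed.inter (isClosed_le continuous_norm continuous_const) ?_
    refine isClosed_iInter fun v => isClosed_le ?_ continuous_const
    have h1 := continuous_clm (M := M)
    fun_prop
  have hsub : {X | X ∈ M.stab ∧ M.lagrForm μ X ≤ a} = Z ∩ M.lagrForm μ ⁻¹' Set.Iic a := by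
    ext X
    constructor
    · rintro ⟨hX, hXa⟩
      obtain ⟨hρ, P, hP, hPeq, hPp⟩ := hbd X hX hXa
      refine ⟨⟨hρ, fun v => ?_⟩, hXa⟩
      have h1 := contraction_of_bounds hg0 hgq (eq_gramian_add hPeq)
        (le_quad (hg X (by simpa using hρ))) hP
        (fun v => (hPp v).trans (mul_le_mul_of_nonneg_right (le_max_left _ _)
          (dotProduct_self_nonneg' v))) k v
      rw [← pow_mul, ← hN] at h1
      have h2 := mul_le_mul_of_nonneg_right hk.le (dotProduct_self_nonneg' v)
      refine le_of_mul_le_mul_left ?_ hg0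
      calc _ ≤ _ := h1
        _ = (1 - g / q) ^ k * q * (v ⬝ᵥ v) := by ring
        _ ≤ _ := h2
        _ = _ := by ring
    · rintro ⟨hX, hXa⟩
      exact ⟨hZs hX, hXa⟩
  rw [hsub]
  refine Metric.isCompact_of_isClosed_isBounded ?_ ?_
  · refine ContinuousOn.preimage_isClosed_of_isClosed (fun X hX => ?_) hZc isClosed_Iic
    exact (contDiffAt_lagrForm μ (hZs hX)).continuousAt.continuousWithinAt
  · refine (Metric.isBounded_closedBall (x := (0 : Policy n m)) (r := ρ)).subset fun X hX => ?_
    simpa using hX.1.1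

end Model

end RCLQR

namespace RCLQR

/-! ### Surface integrals over the sphere and the bias of one-point estimates -/

section Sphere

open Metric
open scoped Pointwise

variable {E : Type*} [NormedAddCommGroup E] [InnerProductSpace ℝ E] [FiniteDimensional ℝ E]
  [MeasurableSpace E] [BorelSpace E]

/-- The self-map of the unit sphere induced by a linear isometry. -/
def sphereMap (U : E ≃ₗᵢ[ℝ] E) (u : sphere (0 : E) 1) : sphere (0 : E) 1 :=
  ⟨U u, by simp⟩

theorem measurePreserving_sphereMap (U : E ≃ₗᵢ[ℝ] E) :
    MeasurePreserving (sphereMap U) (volume : Measure E).toSphere (volume : Measure E).toSphere := by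
  have hc : Continuous (sphereMap U) :=
    Continuous.subtype_mk (U.continuous.comp continuous_subtype_val) _
  refine ⟨hc.measurable, ?_⟩
  ext s hs
  rw [Measure.map_apply hc.measurable hs, Measure.toSphere_apply' _ hs,
    Measure.toSphere_apply' _ (hc.measurable hs)]
  congr 1
  have h1 : Set.Ioo (0 : ℝ) 1 • ((↑) '' (sphereMap U ⁻¹' s) : Set E) =
      U ⁻¹' (Set.Ioo (0 : ℝ) 1 • ((↑) '' s : Set E)) := by
    ext x
    simp only [Set.mem_smul, Set.mem_image, Set.mem_preimage]
    constructor
    · rintro ⟨c, hc, _, ⟨u, hu, rfl⟩, rfl⟩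
      exact ⟨c, hc, _, ⟨_, hu, rfl⟩, by simp [sphereMap]⟩
    · rintro ⟨c, hc, _, ⟨u, hu, rfl⟩, h⟩
      refine ⟨c, hc, _, ⟨sphereMap U.symm u, ?_, rfl⟩, ?_⟩
      · have : sphereMap U (sphereMap U.symm u) = u := by ext; simp [sphereMap]
        simpa [this] using hu
      · apply U.injective
        rw [← h]
        simp [sphereMap]
  rw [h1]
  exact U.measurePreserving.measure_preimage_equiv (f := U.toMeasurableEquiv) _

theorem integral_sphere_comp (U : E ≃ₗᵢ[ℝ] E) (f : E → ℝ) :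
    ∫ u : sphere (0 : E) 1, f (U u) ∂(volume : Measure E).toSphere =
      ∫ u : sphere (0 : E) 1, f u ∂(volume : Measure E).toSphere := by
  have hc : Continuous (sphereMap U) :=
    Continuous.subtype_mk (U.continuous.comp continuous_subtype_val) _
  have hi : Continuous (sphereMap U.symm) :=
    Continuous.subtype_mk (U.symm.continuous.comp continuous_subtype_val) _
  let e : sphere (0 : E) 1 ≃ᵐ sphere (0 : E) 1 :=
    { toFun := sphereMap U
      invFun := sphereMap U.symm
      left_inv := fun u => by ext; simp [sphereMap]
      right_inv := fun u => by ext; simp [sphereMap]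
      measurable_toFun := hc.measurable
      measurable_invFun := hi.measurable }
  exact MeasurePreserving.integral_comp' (f := e) (measurePreserving_sphereMap U)
    (fun u : sphere (0 : E) 1 => f u)

theorem integral_sphere_inner (v : E) :
    ∫ u : sphere (0 : E) 1, inner ℝ v (u : E) ∂(volume : Measure E).toSphere = 0 := by
  have h := integral_sphere_comp (LinearIsometryEquiv.neg ℝ (E := E)) fun u => inner ℝ v u
  simp only [LinearIsometryEquiv.coe_neg, inner_neg_right, integral_neg] at h
  linarith

omit [InnerProductSpace ℝ E] [FiniteDimensional ℝ E] [MeasurableSpace E] [BorelSpace E] in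
theorem continuous_sphere_of_continuousOn {F : Type*} [TopologicalSpace F] {f : E → F} {s : Set E}
    (hf : ContinuousOn f s) {g : sphere (0 : E) 1 → E} (hg : Continuous g) (hgs : ∀ u, g u ∈ s) :
    Continuous fun u => f (g u) := hf.comp_continuous hg hgs

theorem integrable_sphere_of_continuous {F : Type*} [NormedAddCommGroup F] {f : sphere (0 : E) 1 → F}
    (hf : Continuous f) : Integrable f (volume : Measure E).toSphere :=
  hf.integrable_of_hasCompactSupport (HasCompactSupport.of_compactSpace f)

/-- The derivative along an infinitesimal rotation integrates to zero over the sphere. -/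
theorem integral_sphere_skew {f : E → ℝ} {f' : E → E →L[ℝ] ℝ}
    (hf : ∀ x ∈ sphere (0 : E) 1, HasFDerivAt f (f' x) x) (hf' : ContinuousOn f' (sphere 0 1))
    {A : E →L[ℝ] E} (hA : A ∈ skewAdjoint (E →L[ℝ] E)) :
    ∫ u : sphere (0 : E) 1, f' u (A u) ∂(volume : Measure E).toSphere = 0 := by
  let : NormedAlgebra ℚ (E →L[ℝ] E) := NormedAlgebra.restrictScalars ℚ ℝ _
  -- The exponential of a skew-adjoint operator is an isometry. The integral of f composed with
  -- exp(tA) is thus constant in t, and the claim is its derivative at t = 0, taken under the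
  -- integral sign.
  have hU : ∀ t : ℝ, NormedSpace.exp (t • A) ∈ unitary (E →L[ℝ] E) := fun t =>
    NormedSpace.exp_mem_unitary_of_mem_skewAdjoint (skewAdjoint.smul_mem t hA)
  let U : ℝ → E ≃ₗᵢ[ℝ] E := fun t => Unitary.linearIsometryEquiv ⟨_, hU t⟩
  have hUa : ∀ t x, U t x = NormedSpace.exp (t • A) x := fun t x => rfl
  have hmem : ∀ t (u : sphere (0 : E) 1), U t u ∈ sphere (0 : E) 1 := fun t u => by simp
  have hfc : ContinuousOn f (sphere 0 1) := fun x hx => (hf x hx).continuousAt.continuousWithinAt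
  obtain ⟨C, hC⟩ := (isCompact_sphere (0 : E) 1).exists_bound_of_continuousOn hf'
  have hUc : ∀ t, Continuous fun u : sphere (0 : E) 1 => U t (u : E) := fun t =>
    (U t).continuous.comp continuous_subtype_val
  have h1 := hasDerivAt_integral_of_dominated_loc_of_deriv_le
    (μ := (volume : Measure E).toSphere) (x₀ := (0 : ℝ)) (s := Set.univ)
    (F := fun t (u : sphere (0 : E) 1) => f (U t u))
    (F' := fun t (u : sphere (0 : E) 1) => f' (U t u) (A (U t u))) (bound := fun _ => C * ‖A‖)
    univ_mem
    (Eventually.of_forall fun t =>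
      (integrable_sphere_of_continuous (continuous_sphere_of_continuousOn hfc (hUc t)
        (hmem t))).aestronglyMeasurable)
    (integrable_sphere_of_continuous (continuous_sphere_of_continuousOn hfc (hUc 0) (hmem 0)))
    (integrable_sphere_of_continuous ((continuous_sphere_of_continuousOn hf' (hUc 0)
      (hmem 0)).clm_apply (A.continuous.comp (hUc 0)))).aestronglyMeasurable
    (ae_of_all _ fun u t _ => by
      have e1 := hC _ (hmem t u)
      have e2 : ‖U t (u : E)‖ = 1 := by simp
      calc _ ≤ ‖f' (U t u)‖ * ‖A (U t u)‖ := (f' (U t u)).le_opNorm _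
        _ ≤ C * (‖A‖ * ‖U t (u : E)‖) :=
          mul_le_mul e1 (A.le_opNorm _) (norm_nonneg _) ((norm_nonneg _).trans e1)
        _ = C * ‖A‖ := by rw [e2, mul_one])
    (integrable_const _)
    (ae_of_all _ fun u t _ => by
      have e1 : HasDerivAt (fun t : ℝ => U t (u : E)) (A (U t u)) t := by
        have e2 := (hasDerivAt_exp_smul_const' (𝕂 := ℝ) A t).clm_apply
          (hasDerivAt_const t (u : E))
        simpa [hUa] using e2
      exact (hf _ (hmem t u)).comp_hasDerivAt t e1)
  have h2 : (fun t : ℝ => ∫ u : sphere (0 : E) 1, f (U t u) ∂(volume : Measure E).toSphere) =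
      fun _ => ∫ u : sphere (0 : E) 1, f u ∂(volume : Measure E).toSphere := by
    ext t
    exact integral_sphere_comp (U t) f
  have h3 := h1.2
  rw [h2] at h3
  have h4 := h3.unique (hasDerivAt_const _ _)
  simpa [hUa] using h4

/-- The infinitesimal rotation in the plane of two vectors. -/
noncomputable def planeRot (v w : E) : E →L[ℝ] E :=
  (innerSL ℝ w).smulRight v - (innerSL ℝ v).smulRight w

omit [FiniteDimensional ℝ E] [MeasurableSpace E] [BorelSpace E] in
theorem planeRot_apply (v w u : E) :
    planeRot v w u = inner ℝ w u • v - inner ℝ v u • w := by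
  simp [planeRot]

omit [MeasurableSpace E] [BorelSpace E] in
theorem planeRot_mem (v w : E) : planeRot v w ∈ skewAdjoint (E →L[ℝ] E) := by
  rw [skewAdjoint.mem_iff, ContinuousLinearMap.star_eq_adjoint]
  symm
  rw [ContinuousLinearMap.eq_adjoint_iff]
  intro x y
  simp only [_root_.neg_apply, planeRot_apply, inner_neg_left, inner_sub_left,
    inner_sub_right, inner_smul_left, inner_smul_right, RCLike.conj_to_real]
  rw [real_inner_comm w x, real_inner_comm v x]
  ring

/-- The radial differential identity for the first spherical moments of a function. -/
theorem integral_sphere_identity {h : E → ℝ} {h' : E → E →L[ℝ] ℝ} {s : ℝ} (hs : 0 ≤ s)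
    (hh : ∀ x ∈ sphere (0 : E) s, HasFDerivAt h (h' x) x)
    (hh' : ContinuousOn h' (sphere 0 s)) (v : E) :
    s * ∫ u : sphere (0 : E) 1, h' (s • (u : E)) u * inner ℝ v (u : E)
        ∂(volume : Measure E).toSphere +
      ((Module.finrank ℝ E : ℝ) - 1) * ∫ u : sphere (0 : E) 1, h (s • (u : E)) * inner ℝ v (u : E)
        ∂(volume : Measure E).toSphere =
      s * ∫ u : sphere (0 : E) 1, h' (s • (u : E)) v ∂(volume : Measure E).toSphere := by
  set b := stdOrthonormalBasis ℝ E
  set σ := (volume : Measure E).toSphere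
  have hmem : ∀ x ∈ sphere (0 : E) 1, s • x ∈ sphere (0 : E) s := by
    intro x hx
    rw [mem_sphere_zero_iff_norm] at hx ⊢
    rw [norm_smul, hx, mul_one, Real.norm_of_nonneg hs]
  have hcs : Continuous fun x : E => s • x := continuous_const_smul s
  have hhc : ContinuousOn h (sphere (0 : E) s) :=
    fun x hx => (hh x hx).continuousAt.continuousWithinAt
  have c1 : Continuous fun u : sphere (0 : E) 1 => h (s • (u : E)) :=
    continuous_sphere_of_continuousOn hhc (hcs.comp continuous_subtype_val) fun u => hmem u u.2
  have c2 : Continuous fun u : sphere (0 : E) 1 => h' (s • (u : E)) :=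
    continuous_sphere_of_continuousOn hh' (hcs.comp continuous_subtype_val) fun u => hmem u u.2
  have c3 : Continuous fun u : sphere (0 : E) 1 => inner ℝ v (u : E) := by fun_prop
  -- Each coordinate function times h is differentiated along the rotation in the plane of v and the
  -- basis vector b i.
  have hzero : ∀ i, ∫ u : sphere (0 : E) 1, (inner ℝ (b i) (u : E) *
      (s * h' (s • (u : E)) (planeRot v (b i) u)) +
      h (s • (u : E)) * inner ℝ (b i) (planeRot v (b i) u)) ∂σ = 0 := by
    intro i
    have h1 := integral_sphere_skew (f := fun x => inner ℝ (b i) x * h (s • x))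
      (f' := fun x => inner ℝ (b i) x • (s • h' (s • x)) + h (s • x) • innerSL ℝ (b i))
      (fun x hx => by
        have e1 : HasFDerivAt (fun x : E => h (s • x)) (s • h' (s • x)) x := by
          have e2 := (hh _ (hmem x hx)).comp x
            ((ContinuousLinearMap.id ℝ E).hasFDerivAt.const_smul s)
          refine e2.congr_fderiv ?_
          ext y
          simp
        exact ((innerSL ℝ (b i)).hasFDerivAt (x := x)).mul e1)
      (by
        have e1 : ContinuousOn (fun x : E => h' (s • x)) (sphere 0 1) :=
          hh'.comp hcs.continuousOn hmem
        have e2 : ContinuousOn (fun x : E => h (s • x)) (sphere 0 1) :=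
          hhc.comp hcs.continuousOn hmem
        have e3 : ContinuousOn (fun x : E => inner ℝ (b i) x) (sphere 0 1) := by fun_prop
        exact (e3.smul (e1.const_smul s)).add (e2.smul continuousOn_const))
      (planeRot_mem v (b i))
    simpa using h1
  -- Summing over an orthonormal basis, the rotations weighted by ⟨b i, u⟩ add up to the tangential
  -- part of v, and differentiating the coordinates contributes -(d - 1)⟨v, u⟩.
  have hsum : ∀ u : sphere (0 : E) 1, ∑ i, (inner ℝ (b i) (u : E) *
      (s * h' (s • (u : E)) (planeRot v (b i) u)) +
      h (s • (u : E)) * inner ℝ (b i) (planeRot v (b i) u)) =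
      s * h' (s • (u : E)) v - s * (h' (s • (u : E)) u * inner ℝ v (u : E)) -
      ((Module.finrank ℝ E : ℝ) - 1) * (h (s • (u : E)) * inner ℝ v (u : E)) := by
    intro u
    have hu : inner ℝ (u : E) (u : E) = (1 : ℝ) := by
      rw [real_inner_self_eq_norm_sq]; simp
    have e1 : ∑ i, inner ℝ (b i) (u : E) • planeRot v (b i) u = v - inner ℝ v (u : E) • (u : E) := by
      simp only [planeRot_apply, smul_sub, smul_smul, Finset.sum_sub_distrib]
      rw [← Finset.sum_smul]
      have e2 : ∑ i, inner ℝ (b i) (u : E) * inner ℝ (b i) (u : E) = (1 : ℝ) := by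
        refine Eq.trans ?_ ((b.sum_inner_mul_inner (u : E) (u : E)).trans hu)
        exact Finset.sum_congr rfl fun i _ => by rw [real_inner_comm]
      have e3 : ∑ i, (inner ℝ (b i) (u : E) * inner ℝ v (u : E)) • b i =
          inner ℝ v (u : E) • (u : E) := by
        have e4 := congrArg (fun x : E => (inner ℝ v (u : E) : ℝ) • x) (b.sum_repr' (u : E))
        refine Eq.trans ?_ e4
        simp only [Finset.smul_sum]
        exact Finset.sum_congr rfl fun i _ => by rw [smul_smul, mul_comm]
      rw [e2, e3, one_smul]
    have e4 : ∑ i, inner ℝ (b i) (planeRot v (b i) u) =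
        -(((Module.finrank ℝ E : ℝ) - 1) * inner ℝ v (u : E)) := by
      simp only [planeRot_apply, inner_sub_right, inner_smul_right, Finset.sum_sub_distrib]
      have e5 : ∑ i, inner ℝ (b i) (u : E) * inner ℝ (b i) v = (inner ℝ v (u : E) : ℝ) := by
        rw [← b.sum_inner_mul_inner]
        exact Finset.sum_congr rfl fun i _ => by rw [mul_comm, real_inner_comm]
      have e6 : ∑ i, inner ℝ v (u : E) * inner ℝ (b i) (b i) =
          (Module.finrank ℝ E : ℝ) * inner ℝ v (u : E) := by
        simp
      rw [e5, e6]; ring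
    rw [Finset.sum_add_distrib, ← Finset.mul_sum, e4]
    have e7 : ∑ i, inner ℝ (b i) (u : E) * (s * h' (s • (u : E)) (planeRot v (b i) u)) =
        s * h' (s • (u : E)) (∑ i, inner ℝ (b i) (u : E) • planeRot v (b i) u) := by
      rw [map_sum, Finset.mul_sum]
      refine Finset.sum_congr rfl fun i _ => ?_
      rw [map_smul, smul_eq_mul]; ring
    rw [e7, e1, map_sub, map_smul, smul_eq_mul]
    ring
  have hint : ∀ i, Integrable (fun u : sphere (0 : E) 1 => inner ℝ (b i) (u : E) *
      (s * h' (s • (u : E)) (planeRot v (b i) u)) +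
      h (s • (u : E)) * inner ℝ (b i) (planeRot v (b i) u)) σ := by
    intro i
    refine integrable_sphere_of_continuous ?_
    have e1 : Continuous fun u : sphere (0 : E) 1 => planeRot v (b i) (u : E) :=
      (planeRot v (b i)).continuous.comp continuous_subtype_val
    have e2 : Continuous fun u : sphere (0 : E) 1 => inner ℝ (b i) (u : E) := by fun_prop
    exact (e2.mul (continuous_const.mul (c2.clm_apply e1))).add
      (c1.mul (continuous_const.inner e1))
  have hI : ∫ u : sphere (0 : E) 1, (s * h' (s • (u : E)) v -
      s * (h' (s • (u : E)) u * inner ℝ v (u : E)) -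
      ((Module.finrank ℝ E : ℝ) - 1) * (h (s • (u : E)) * inner ℝ v (u : E))) ∂σ = 0 := by
    simp only [← hsum]
    rw [integral_finsetSum _ fun i _ => hint i]
    exact Finset.sum_eq_zero fun i _ => hzero i
  have i1 : Integrable (fun u : sphere (0 : E) 1 => s * h' (s • (u : E)) v) σ :=
    integrable_sphere_of_continuous (continuous_const.mul (c2.clm_apply continuous_const))
  have i2 : Integrable (fun u : sphere (0 : E) 1 =>
      s * (h' (s • (u : E)) u * inner ℝ v (u : E))) σ :=
    integrable_sphere_of_continuous
      (continuous_const.mul ((c2.clm_apply continuous_subtype_val).mul c3))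
  have i3 : Integrable (fun u : sphere (0 : E) 1 =>
      ((Module.finrank ℝ E : ℝ) - 1) * (h (s • (u : E)) * inner ℝ v (u : E))) σ :=
    integrable_sphere_of_continuous (continuous_const.mul (c1.mul c3))
  have i4 := integral_sub (i1.sub i2) i3
  simp only [Pi.sub_apply] at i4
  rw [i4, integral_sub i1 i2, integral_const_mul, integral_const_mul, integral_const_mul] at hI
  linarith

/-- Derivative in the radius of the first spherical moments of a function. -/
theorem hasDerivAt_sphere_moment {h : E → ℝ} {h' : E → E →L[ℝ] ℝ} {ρ : ℝ}
    (hh : ∀ x ∈ ball (0 : E) ρ, HasFDerivAt h (h' x) x) (hh' : ContinuousOn h' (ball 0 ρ))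
    (v : E) {s : ℝ} (hs : |s| < ρ) :
    HasDerivAt (fun s : ℝ => ∫ u : sphere (0 : E) 1, h (s • (u : E)) * inner ℝ v (u : E)
        ∂(volume : Measure E).toSphere)
      (∫ u : sphere (0 : E) 1, h' (s • (u : E)) u * inner ℝ v (u : E)
        ∂(volume : Measure E).toSphere) s := by
  obtain ⟨q, hq1, hq2⟩ := exists_between hs
  have hnorm : ∀ (t : ℝ) (u : sphere (0 : E) 1), ‖t • (u : E)‖ = |t| := fun t u => by
    rw [norm_smul, norm_eq_of_mem_sphere, mul_one, Real.norm_eq_abs]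
  have hmem : ∀ t : ℝ, |t| < ρ → ∀ u : sphere (0 : E) 1, t • (u : E) ∈ ball (0 : E) ρ :=
    fun t ht u => by rw [mem_ball_zero_iff, hnorm]; exact ht
  have hhc : ContinuousOn h (ball (0 : E) ρ) :=
    fun x hx => (hh x hx).continuousAt.continuousWithinAt
  have hcs : ∀ t : ℝ, Continuous fun u : sphere (0 : E) 1 => t • (u : E) := fun t => by fun_prop
  have c3 : Continuous fun u : sphere (0 : E) 1 => inner ℝ v (u : E) := by fun_prop
  have hsub : closedBall (0 : E) q ⊆ ball 0 ρ := closedBall_subset_ball hq2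
  obtain ⟨C, hC⟩ := (isCompact_closedBall (0 : E) q).exists_bound_of_continuousOn (hh'.mono hsub)
  have hnhds : {t : ℝ | |t| < q} ∈ 𝓝 s :=
    (isOpen_lt continuous_abs continuous_const).mem_nhds hq1
  refine (hasDerivAt_integral_of_dominated_loc_of_deriv_le
    (μ := (volume : Measure E).toSphere) (x₀ := s) (s := {t : ℝ | |t| < q})
    (F := fun t (u : sphere (0 : E) 1) => h (t • (u : E)) * inner ℝ v (u : E))
    (F' := fun t (u : sphere (0 : E) 1) => h' (t • (u : E)) u * inner ℝ v (u : E))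
    (bound := fun _ => C * ‖v‖) hnhds ?_ ?_ ?_ ?_ (integrable_const _) ?_).2
  · filter_upwards [hnhds] with t ht
    exact (integrable_sphere_of_continuous ((continuous_sphere_of_continuousOn hhc (hcs t)
      (hmem t (lt_trans ht hq2))).mul c3)).aestronglyMeasurable
  · exact integrable_sphere_of_continuous ((continuous_sphere_of_continuousOn hhc (hcs s)
      (hmem s hs)).mul c3)
  · exact (integrable_sphere_of_continuous (((continuous_sphere_of_continuousOn hh' (hcs s)
      (hmem s hs)).clm_apply continuous_subtype_val).mul c3)).aestronglyMeasurable
  · refine ae_of_all _ fun u t ht => ?_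
    have e1 := hC (t • (u : E)) (by
      rw [mem_closedBall_zero_iff, hnorm]; exact le_of_lt ht)
    have e2 : ‖(u : E)‖ = 1 := norm_eq_of_mem_sphere u
    have e3 : ‖h' (t • (u : E)) u‖ ≤ C := by
      refine ((h' (t • (u : E))).le_opNorm _).trans ?_
      rw [e2, mul_one]; exact e1
    have e4 : ‖(inner ℝ v (u : E) : ℝ)‖ ≤ ‖v‖ := by
      refine (norm_inner_le_norm v (u : E)).trans ?_
      rw [e2, mul_one]
    rw [norm_mul]
    exact mul_le_mul e3 e4 (norm_nonneg _) ((norm_nonneg _).trans e3)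
  · refine ae_of_all _ fun u t ht => ?_
    have e1 : HasDerivAt (fun t : ℝ => t • (u : E)) (u : E) t := by
      simpa using (hasDerivAt_id t).smul_const (u : E)
    exact ((hh _ (hmem t (lt_trans ht hq2) u)).comp_hasDerivAt t e1).mul_const _

/-- The one-point gradient estimate on a sphere approximates the gradient at the centre, with an
error that does not depend on the dimension. -/
theorem abs_sphere_moment_sub_le {h : E → ℝ} {h' : E → E →L[ℝ] ℝ} {r ρ β : ℝ} (hr : 0 < r)
    (hρ : r < ρ) (hh : ∀ x ∈ ball (0 : E) ρ, HasFDerivAt h (h' x) x)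
    (hh' : ContinuousOn h' (ball 0 ρ)) (hd : 0 < Module.finrank ℝ E) (hβ : 0 ≤ β)
    (hlip : ∀ x, ‖x‖ ≤ r → ‖h' x - h' 0‖ ≤ β * ‖x‖) (v : E) :
    |(Module.finrank ℝ E : ℝ) / r * ∫ u : sphere (0 : E) 1, h (r • (u : E)) * inner ℝ v (u : E)
        ∂(volume : Measure E).toSphere -
      (volume : Measure E).toSphere.real Set.univ * h' 0 v| ≤
      (volume : Measure E).toSphere.real Set.univ * (β * r * ‖v‖) := by
  set σ := (volume : Measure E).toSphere with hσ
  set d := Module.finrank ℝ E with hd'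
  obtain ⟨k, hk⟩ : ∃ k, d = k + 1 := ⟨d - 1, by omega⟩
  set a : ℝ → ℝ := fun s => ∫ u : sphere (0 : E) 1, h (s • (u : E)) * inner ℝ v (u : E) ∂σ with ha
  set a' : ℝ → ℝ := fun s => ∫ u : sphere (0 : E) 1, h' (s • (u : E)) u * inner ℝ v (u : E) ∂σ
    with ha'
  set b : ℝ → ℝ := fun s => ∫ u : sphere (0 : E) 1, h' (s • (u : E)) v ∂σ with hb
  set S := σ.real Set.univ with hS
  have hS0 : 0 ≤ S := measureReal_nonneg
  have hnorm : ∀ (t : ℝ) (u : sphere (0 : E) 1), ‖t • (u : E)‖ = |t| := fun t u => by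
    rw [norm_smul, norm_eq_of_mem_sphere, mul_one, Real.norm_eq_abs]
  have hderiv : ∀ s : ℝ, |s| < ρ → HasDerivAt a (a' s) s := fun s hs =>
    hasDerivAt_sphere_moment hh hh' v hs
  -- With k = d - 1 the spherical identity reads s a' + k a = s b, so the derivative of s^k a is s^k
  -- b. For a linear function b is constant, and the Lipschitz bound controls the deviation of b
  -- from that constant.
  have hid : ∀ s : ℝ, 0 ≤ s → s < ρ → s * a' s + (k : ℝ) * a s = s * b s := by
    intro s hs0 hs
    have hsub : sphere (0 : E) s ⊆ ball 0 ρ := fun x hx => by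
      rw [mem_sphere_zero_iff_norm] at hx
      rw [mem_ball_zero_iff, hx]; exact hs
    have e1 := integral_sphere_identity hs0 (fun x hx => hh x (hsub hx)) (hh'.mono hsub) v
    rw [← hd', hk] at e1
    push_cast at e1
    rw [add_sub_cancel_right] at e1
    exact e1
  have hb0 : ∀ s : ℝ, 0 ≤ s → s ≤ r → |b s - S * h' 0 v| ≤ S * (β * s * ‖v‖) := by
    intro s hs0 hs
    have e1 : b s - S * h' 0 v = ∫ u : sphere (0 : E) 1, (h' (s • (u : E)) - h' 0) v ∂σ := by
      have i1 : Integrable (fun u : sphere (0 : E) 1 => h' (s • (u : E)) v) σ := by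
        refine integrable_sphere_of_continuous (Continuous.clm_apply ?_ continuous_const)
        refine continuous_sphere_of_continuousOn hh' (by fun_prop) fun u => ?_
        rw [mem_ball_zero_iff, hnorm, abs_of_nonneg hs0]
        exact hs.trans_lt hρ
      simp only [_root_.sub_apply]
      rw [integral_sub i1 (integrable_const _), integral_const, smul_eq_mul]
    rw [e1, ← Real.norm_eq_abs]
    have e2 := norm_integral_le_of_norm_le_const (μ := σ) (C := β * s * ‖v‖)
      (f := fun u : sphere (0 : E) 1 => (h' (s • (u : E)) - h' 0) v) (ae_of_all _ fun u => by
        have e3 := hlip (s • (u : E)) (by rw [hnorm, abs_of_nonneg hs0]; exact hs)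
        rw [hnorm, abs_of_nonneg hs0] at e3
        exact ((h' (s • (u : E)) - h' 0).le_opNorm v).trans
          (mul_le_mul_of_nonneg_right e3 (norm_nonneg _)))
    rwa [mul_comm] at e2
  have ha0 : a 0 = 0 := by
    simp only [ha, zero_smul]
    rw [integral_const_mul, integral_sphere_inner, mul_zero]
  have hder : ∀ s ∈ Set.Ioo (0 : ℝ) r, HasDerivAt
      (fun s => s ^ k * a s - s ^ (k + 1) / (k + 1) * (S * h' 0 v))
      (s ^ k * (b s - S * h' 0 v)) s := by
    intro s hs
    have hsρ : |s| < ρ := by rw [abs_of_pos hs.1]; exact hs.2.trans hρ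
    have e1 := ((hasDerivAt_pow k s).mul (hderiv s hsρ)).sub
      (((hasDerivAt_pow (k + 1) s).div_const ((k : ℝ) + 1)).mul_const (S * h' 0 v))
    refine e1.congr_deriv ?_
    have e2 := hid s hs.1.le (hs.2.trans hρ)
    have e3 : (k : ℝ) * s ^ (k - 1) * a s + s ^ k * a' s = s ^ k * b s := by
      rcases Nat.eq_zero_or_pos k with hk0 | hk0
      · rw [hk0] at e2 ⊢
        simp only [CharP.cast_eq_zero, zero_mul, add_zero, pow_zero, one_mul, zero_add] at e2 ⊢
        exact mul_left_cancel₀ hs.1.ne' e2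
      · obtain ⟨l, rfl⟩ : ∃ l, k = l + 1 := ⟨k - 1, by omega⟩
        rw [Nat.add_sub_cancel, pow_succ]
        calc _ = s ^ l * (s * a' s + ((l + 1 : ℕ) : ℝ) * a s) := by ring
          _ = _ := by rw [e2]; ring
    rw [e3]
    push_cast
    field_simp
  have hcont : ContinuousOn (fun s => s ^ k * a s - s ^ (k + 1) / (k + 1) * (S * h' 0 v))
      (Set.Icc 0 r) := by
    have e1 : ContinuousOn a (Set.Icc 0 r) := fun s hs =>
      (hderiv s (by rw [abs_of_nonneg hs.1]; exact hs.2.trans_lt hρ)).continuousAt.continuousWithinAt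
    fun_prop
  have hB : ∀ s : ℝ, HasDerivAt (fun s : ℝ => S * (β * ‖v‖) * (s ^ (k + 2) / (k + 2)))
      (S * (β * ‖v‖) * s ^ (k + 1)) s := by
    intro s
    have e1 := ((hasDerivAt_pow (k + 2) s).div_const ((k : ℝ) + 2)).const_mul (S * (β * ‖v‖))
    refine e1.congr_deriv ?_
    push_cast
    field_simp
  -- Both signs are compared with an explicit primitive of the error bound; monotonicity from 0 to r
  -- plays the part of integration.
  have hmono : ∀ ε : ℝ, |ε| = 1 → MonotoneOn (fun s => S * (β * ‖v‖) * (s ^ (k + 2) / (k + 2)) +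
      ε * (s ^ k * a s - s ^ (k + 1) / (k + 1) * (S * h' 0 v))) (Set.Icc 0 r) := by
    intro ε hε
    have hD : ∀ s ∈ interior (Set.Icc (0 : ℝ) r), HasDerivAt
        (fun s => S * (β * ‖v‖) * (s ^ (k + 2) / (k + 2)) +
          ε * (s ^ k * a s - s ^ (k + 1) / (k + 1) * (S * h' 0 v)))
        (S * (β * ‖v‖) * s ^ (k + 1) + ε * (s ^ k * (b s - S * h' 0 v))) s := by
      intro s hs
      rw [interior_Icc] at hs
      exact (hB s).add ((hder s hs).const_mul ε)
    refine monotoneOn_of_deriv_nonneg (convex_Icc _ _) ?_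
      (fun s hs => (hD s hs).differentiableAt.differentiableWithinAt) fun s hs => ?_
    · exact ContinuousOn.add (by fun_prop) (continuousOn_const.mul hcont)
    · rw [(hD s hs).deriv]
      rw [interior_Icc] at hs
      have e1 := hb0 s hs.1.le hs.2.le
      have e2 : |ε * (s ^ k * (b s - S * h' 0 v))| ≤ s ^ k * (S * (β * s * ‖v‖)) := by
        rw [abs_mul, hε, one_mul, abs_mul, abs_of_nonneg (pow_nonneg hs.1.le k)]
        exact mul_le_mul_of_nonneg_left e1 (pow_nonneg hs.1.le k)
      have e3 : s ^ k * (S * (β * s * ‖v‖)) = S * (β * ‖v‖) * s ^ (k + 1) := by ring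
      have e4 := neg_abs_le (ε * (s ^ k * (b s - S * h' 0 v)))
      linarith
  have hz : (0 : ℝ) ∈ Set.Icc 0 r := ⟨le_rfl, hr.le⟩
  have hrr : r ∈ Set.Icc 0 r := ⟨hr.le, le_rfl⟩
  have m1 := hmono 1 (by simp) hz hrr hr.le
  have m2 := hmono (-1) (by simp) hz hrr hr.le
  simp only [ha0, mul_zero, zero_div, zero_mul, sub_zero, ne_eq, Nat.add_eq_zero_iff,
    OfNat.ofNat_ne_zero, one_ne_zero, and_false, not_false_eq_true, zero_pow, add_zero] at m1 m2
  have hrk : 0 < r ^ k := pow_pos hr k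
  have key : |r ^ k * a r - r ^ (k + 1) / (k + 1) * (S * h' 0 v)| ≤
      S * (β * ‖v‖) * (r ^ (k + 2) / (k + 2)) := by
    rw [abs_le]; constructor <;> linarith
  have e1 : (d : ℝ) / r * a r - S * h' 0 v = ((k : ℝ) + 1) / r ^ (k + 1) *
      (r ^ k * a r - r ^ (k + 1) / (k + 1) * (S * h' 0 v)) := by
    rw [hk]; push_cast; field_simp; ring
  rw [e1, abs_mul, abs_of_pos (by positivity)]
  calc _ ≤ ((k : ℝ) + 1) / r ^ (k + 1) * (S * (β * ‖v‖) * (r ^ (k + 2) / (k + 2))) :=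
        mul_le_mul_of_nonneg_left key (by positivity)
    _ = S * (β * r * ‖v‖) * (((k : ℝ) + 1) / (k + 2)) := by field_simp; ring
    _ ≤ S * (β * r * ‖v‖) * 1 := by
        refine mul_le_mul_of_nonneg_left ?_ (by positivity)
        rw [div_le_one (by positivity)]; linarith
    _ = _ := mul_one _

end Sphere

end RCLQR

namespace RCLQR

/-! ### Processes driven by independent inputs -/

section Chain

open ProbabilityTheory

variable {α β : Type*} [MeasurableSpace α] [MeasurableSpace β]

/-- A process driven by a sequence of inputs. -/
def chain (step : β → α → β) (z₀ : β) (ω : ℕ → α) : ℕ → β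
  | 0 => z₀
  | k + 1 => step (chain step z₀ ω k) (ω k)

variable {step : β → α → β} {z₀ : β}

/-- The state at time k depends only on the inputs before time k. Independence from the input at
time k and joint measurability both come from this factorization. -/
theorem exists_chain_factor (hstep : Measurable fun q : β × α => step q.1 q.2) (k : ℕ) :
    ∃ g : (Finset.range k → α) → β, Measurable g ∧
      ∀ ω : ℕ → α, chain step z₀ ω k = g fun i => ω i := by
  induction k with
  | zero => exact ⟨fun _ => z₀, measurable_const, fun _ => rfl⟩
  | succ k ih =>
    obtain ⟨g, hg, h⟩ := ih
    refine ⟨fun y => step (g fun i => y ⟨i, by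
        have := Finset.mem_range.mp i.2
        exact Finset.mem_range.mpr (by omega)⟩) (y ⟨k, Finset.self_mem_range_succ k⟩), ?_, ?_⟩
    · refine hstep.comp (Measurable.prodMk (hg.comp ?_) (measurable_pi_apply _))
      exact measurable_pi_lambda _ fun i => measurable_pi_apply _
    · intro ω
      rw [chain, h]

theorem measurable_chain (hstep : Measurable fun q : β × α => step q.1 q.2) (k : ℕ) :
    Measurable fun ω => chain step z₀ ω k := by
  obtain ⟨g, hg, h⟩ := exists_chain_factor (z₀ := z₀) hstep k
  simp only [h]
  exact hg.comp (measurable_pi_lambda _ fun i => measurable_pi_apply _)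

theorem indepFun_chain (ν : Measure α) [IsProbabilityMeasure ν]
    (hstep : Measurable fun q : β × α => step q.1 q.2) (k : ℕ) :
    IndepFun (fun ω => chain step z₀ ω k) (fun ω : ℕ → α => ω k)
      (Measure.infinitePi fun _ : ℕ => ν) := by
  obtain ⟨g, hg, h⟩ := exists_chain_factor (z₀ := z₀) hstep k
  have h1 : iIndepFun (fun (i : ℕ) (ω : ℕ → α) => ω i) (Measure.infinitePi fun _ : ℕ => ν) :=
    iIndepFun_infinitePi (X := fun _ => id) fun _ => measurable_id
  have h2 := h1.indepFun_finset (Finset.range k) {k} (by simp) fun i => measurable_pi_apply i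
  have h3 := h2.comp hg (measurable_pi_apply (⟨k, by simp⟩ : ({k} : Finset ℕ)))
  simp only [h]
  exact h3

theorem map_chain_prod (ν : Measure α) [IsProbabilityMeasure ν]
    (hstep : Measurable fun q : β × α => step q.1 q.2) (k : ℕ) :
    (Measure.infinitePi fun _ : ℕ => ν).map (fun ω => (chain step z₀ ω k, ω k)) =
      ((Measure.infinitePi fun _ : ℕ => ν).map fun ω => chain step z₀ ω k).prod ν := by
  have h := (indepFun_iff_map_prod_eq_prod_map_map (measurable_chain hstep k).aemeasurable
    (measurable_pi_apply k).aemeasurable).mp (indepFun_chain (z₀ := z₀) ν hstep k)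
  rw [h]
  congr 1
  exact (measurePreserving_eval_infinitePi (fun _ : ℕ => ν) k).map_eq

end Chain

/-! ### A strong law for bounded martingale differences -/

section LLN

/-- Between consecutive squares k² and (k+1)² there are at most 2k steps of size D, so interpolating
from the squares costs at most 2D/k after normalization. -/
theorem tendsto_div_of_tendsto_sq {a : ℕ → ℝ} {D : ℝ} (hD : ∀ t, |a (t + 1) - a t| ≤ D)
    (h : Tendsto (fun k : ℕ => a (k ^ 2) / (k : ℝ) ^ 2) atTop (𝓝 0)) :
    Tendsto (fun T : ℕ => (T : ℝ)⁻¹ * a T) atTop (𝓝 0) := by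
  have hD0 : 0 ≤ D := (abs_nonneg _).trans (hD 0)
  have hsq : Tendsto Nat.sqrt atTop atTop :=
    tendsto_atTop.mpr fun b => by
      filter_upwards [eventually_ge_atTop (b * b)] with T hT
      exact Nat.le_sqrt.mpr hT
  have hincr : ∀ s t : ℕ, |a (s + t) - a s| ≤ D * t := by
    intro s t
    induction t with
    | zero => simp
    | succ t ih =>
      have h1 : a (s + (t + 1)) - a s = (a (s + t + 1) - a (s + t)) + (a (s + t) - a s) := by
        rw [← add_assoc]; ring
      rw [h1]
      refine (abs_add_le _ _).trans ?_
      push_cast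
      linarith [hD (s + t)]
  have h1 : Tendsto (fun T : ℕ => |a (T.sqrt ^ 2) / (T.sqrt : ℝ) ^ 2| + 2 * D / (T.sqrt : ℝ)) atTop
      (𝓝 (|0| + 0)) := by
    refine Tendsto.add ((h.comp hsq).abs) ?_
    exact tendsto_const_nhds.div_atTop (tendsto_natCast_atTop_atTop.comp hsq)
  rw [abs_zero, add_zero] at h1
  refine squeeze_zero_norm' ?_ h1
  filter_upwards [eventually_ge_atTop 1] with T hT
  have hk : 1 ≤ T.sqrt := Nat.le_sqrt.mpr (by simpa using hT)
  have hk1 : T.sqrt ^ 2 ≤ T := by rw [pow_two]; exact Nat.sqrt_le T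
  have hk2 : T - T.sqrt ^ 2 ≤ 2 * T.sqrt := by
    have := Nat.sqrt_le_add T
    rw [pow_two]; omega
  have hTa : |a T| ≤ |a (T.sqrt ^ 2)| + D * (2 * T.sqrt) := by
    have h2 := hincr (T.sqrt ^ 2) (T - T.sqrt ^ 2)
    rw [Nat.add_sub_cancel' hk1] at h2
    have h3 : D * ((T - T.sqrt ^ 2 : ℕ) : ℝ) ≤ D * (2 * T.sqrt) :=
      mul_le_mul_of_nonneg_left (by exact_mod_cast hk2) hD0
    have h4 := abs_sub_abs_le_abs_sub (a T) (a (T.sqrt ^ 2))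
    linarith
  have hkr : (0 : ℝ) < T.sqrt := by exact_mod_cast hk
  have hTr : ((T.sqrt : ℝ)) ^ 2 ≤ T := by exact_mod_cast hk1
  have hT0 : (0 : ℝ) < T := by exact_mod_cast hT
  rw [norm_mul, norm_inv, Real.norm_natCast, Real.norm_eq_abs, abs_div,
    abs_of_pos (pow_pos hkr 2)]
  have h5 : |a (T.sqrt ^ 2)| / (T.sqrt : ℝ) ^ 2 + 2 * D / T.sqrt =
      (|a (T.sqrt ^ 2)| + D * (2 * T.sqrt)) / (T.sqrt : ℝ) ^ 2 := by
    field_simp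
  rw [h5, inv_mul_eq_div]
  exact div_le_div₀ (by positivity) hTa (by positivity) hTr

/-- Along the squares the normalized second moments are at most D²/k², which is summable. The
squared normalized sums are thus almost surely summable and tend to zero; bounded increments fill in
the other times. -/
theorem ae_tendsto_div_of_sq_le {Ω : Type*} [MeasurableSpace Ω] {P : Measure Ω}
    {S : ℕ → Ω → ℝ} {D : ℝ} (hm : ∀ t, Measurable (S t))
    (hD : ∀ᵐ ω ∂P, ∀ t, |S (t + 1) ω - S t ω| ≤ D)
    (hi : ∀ t, Integrable (fun ω => S t ω ^ 2) P) (h : ∀ t : ℕ, ∫ ω, S t ω ^ 2 ∂P ≤ D ^ 2 * t) :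
    ∀ᵐ ω ∂P, Tendsto (fun T : ℕ => (T : ℝ)⁻¹ * S T ω) atTop (𝓝 0) := by
  have hle : ∀ k : ℕ, ∫⁻ ω, ENNReal.ofReal ((S ((k + 1) ^ 2) ω / ((k + 1 : ℕ) : ℝ) ^ 2) ^ 2) ∂P ≤
      ENNReal.ofReal (D ^ 2 * (1 / ((k + 1 : ℕ) : ℝ) ^ 2)) := by
    intro k
    have hk : (0 : ℝ) < ((k + 1 : ℕ) : ℝ) := by positivity
    rw [← ofReal_integral_eq_lintegral_ofReal]
    · refine ENNReal.ofReal_le_ofReal ?_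
      simp only [div_pow]
      rw [integral_div, div_le_iff₀ (by positivity)]
      refine (h _).trans (le_of_eq ?_)
      push_cast
      field_simp
    · simp only [div_pow]
      exact (hi _).div_const _
    · exact ae_of_all _ fun ω => sq_nonneg _
  have hsum : ∑' k : ℕ, ENNReal.ofReal (D ^ 2 * (1 / ((k + 1 : ℕ) : ℝ) ^ 2)) ≠ ⊤ := by
    have h1 : Summable fun k : ℕ => D ^ 2 * (1 / ((k + 1 : ℕ) : ℝ) ^ 2) :=
      Summable.mul_left _ ((summable_nat_add_iff 1).mpr
        (Real.summable_one_div_nat_pow.mpr one_lt_two))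
    rw [← ENNReal.ofReal_tsum_of_nonneg (fun k => by positivity) h1]
    exact ENNReal.ofReal_ne_top
  have hfin : ∫⁻ ω, ∑' k : ℕ, ENNReal.ofReal
      ((S ((k + 1) ^ 2) ω / ((k + 1 : ℕ) : ℝ) ^ 2) ^ 2) ∂P ≠ ⊤ := by
    rw [lintegral_tsum fun k => by
      have := hm ((k + 1) ^ 2)
      fun_prop]
    exact ne_top_of_le_ne_top hsum (ENNReal.tsum_le_tsum hle)
  have hae := ae_lt_top' (by
    refine Measurable.aemeasurable (Measurable.tsum fun k => ?_)
    have := hm ((k + 1) ^ 2)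
    fun_prop) hfin
  filter_upwards [hae, hD] with ω hω hDω
  refine tendsto_div_of_tendsto_sq hDω ?_
  have h1 := ENNReal.tendsto_atTop_zero_of_tsum_ne_top hω.ne
  have h2 := (ENNReal.tendsto_toReal ENNReal.zero_ne_top).comp h1
  simp only [Function.comp_def, ENNReal.toReal_ofReal (sq_nonneg _), ENNReal.toReal_zero] at h2
  have h3 := h2.sqrt
  simp only [Real.sqrt_sq_eq_abs, Real.sqrt_zero] at h3
  have h4 := (tendsto_zero_iff_abs_tendsto_zero _).mpr h3
  exact (tendsto_add_atTop_iff_nat 1).mp h4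

variable {α β : Type*} [MeasurableSpace α] [MeasurableSpace β]
variable {step : β → α → β} {z₀ : β}

omit [MeasurableSpace α] [MeasurableSpace β] in
-- Carrying the running sum as an extra coordinate makes the pair a chain again, so the sum is
-- independent of the next input jointly with the state.
theorem chain_prod_sum (φ : β → ℝ) (ψ : α → ℝ) (ω : ℕ → α) (k : ℕ) :
    chain (fun (q : β × ℝ) w => (step q.1 w, q.2 + φ q.1 * ψ w)) (z₀, (0 : ℝ)) ω k =
      (chain step z₀ ω k, ∑ t ∈ Finset.range k, φ (chain step z₀ ω t) * ψ (ω t)) := by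
  induction k with
  | zero => rfl
  | succ k ih => rw [chain, ih, Finset.sum_range_succ, chain]

/-- Law of large numbers for the product of a bounded predictable process and bounded centered
independent variables. -/
theorem ae_tendsto_average_chain (ν : Measure α) [IsProbabilityMeasure ν]
    (hstep : Measurable fun q : β × α => step q.1 q.2) {φ : β → ℝ} {ψ : α → ℝ}
    (hφ : Measurable φ) (hψ : Measurable ψ) {C D : ℝ} (hC0 : 0 ≤ C)
    (hC : ∀ᵐ ω ∂(Measure.infinitePi fun _ : ℕ => ν), ∀ t, |φ (chain step z₀ ω t)| ≤ C)
    (hD : ∀ᵐ w ∂ν, |ψ w| ≤ D) (hψ0 : ∫ w, ψ w ∂ν = 0) :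
    ∀ᵐ ω ∂(Measure.infinitePi fun _ : ℕ => ν), Tendsto (fun T : ℕ => (T : ℝ)⁻¹ *
      ∑ t ∈ Finset.range T, φ (chain step z₀ ω t) * ψ (ω t)) atTop (𝓝 0) := by
  set P := Measure.infinitePi fun _ : ℕ => ν with hP
  have hev : ∀ t, MeasurePreserving (fun ω : ℕ → α => ω t) P ν := fun t =>
    measurePreserving_eval_infinitePi (fun _ : ℕ => ν) t
  have hDt : ∀ᵐ ω ∂P, ∀ t, |ψ (ω t)| ≤ D :=
    ae_all_iff.mpr fun t => (hev t).quasiMeasurePreserving.ae hD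
  set S : ℕ → (ℕ → α) → ℝ := fun T ω => ∑ t ∈ Finset.range T, φ (chain step z₀ ω t) * ψ (ω t)
    with hS
  have hm : ∀ T, Measurable (S T) := fun T =>
    Finset.measurable_fun_sum _ fun t _ =>
      (hφ.comp (measurable_chain hstep t)).mul (hψ.comp (measurable_pi_apply t))
  have hb : ∀ᵐ ω ∂P, ∀ t, |φ (chain step z₀ ω t) * ψ (ω t)| ≤ C * D := by
    filter_upwards [hC, hDt] with ω h1 h2 t
    rw [abs_mul]
    exact mul_le_mul (h1 t) (h2 t) (abs_nonneg _) hC0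
  have hSb : ∀ᵐ ω ∂P, ∀ T : ℕ, |S T ω| ≤ T * (C * D) := by
    filter_upwards [hb] with ω h1 T
    refine (Finset.abs_sum_le_sum_abs _ _).trans ?_
    refine (Finset.sum_le_sum fun t _ => h1 t).trans ?_
    simp
  have hbdd : ∀ {f : (ℕ → α) → ℝ} {B : ℝ}, Measurable f → (∀ᵐ ω ∂P, |f ω| ≤ B) → Integrable f P :=
    fun hf hB => Integrable.of_bound hf.aestronglyMeasurable _ hB
  have hi : ∀ T, Integrable (fun ω => S T ω ^ 2) P := fun T => by
    refine hbdd ((hm T).pow_const 2) (B := (T * (C * D)) ^ 2) ?_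
    filter_upwards [hSb] with ω h1
    rw [abs_pow]
    exact pow_le_pow_left₀ (abs_nonneg _) (h1 T) 2
  refine ae_tendsto_div_of_sq_le (D := C * D) hm ?_ hi ?_
  · filter_upwards [hb] with ω h1 t
    simpa [hS, Finset.sum_range_succ] using h1 t
  · intro T
    induction T with
    | zero => simp
    | succ T ih =>
      have hstep' : Measurable fun q : (β × ℝ) × α =>
          ((fun (q : β × ℝ) w => (step q.1 w, q.2 + φ q.1 * ψ w)) q.1 q.2 : β × ℝ) := by
        refine Measurable.prodMk ?_ ?_
        · exact hstep.comp ((measurable_fst.comp measurable_fst).prodMk measurable_snd)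
        · exact (measurable_snd.comp measurable_fst).add
            ((hφ.comp (measurable_fst.comp measurable_fst)).mul (hψ.comp measurable_snd))
      have hind := indepFun_chain (step := fun (q : β × ℝ) w => (step q.1 w, q.2 + φ q.1 * ψ w))
        (z₀ := (z₀, (0 : ℝ))) ν hstep' T
      have hind2 := hind.comp (φ := fun q : β × ℝ => q.2 * φ q.1) (ψ := ψ)
        (measurable_snd.mul (hφ.comp measurable_fst)) hψ
      -- The next input is centered and independent of the past, so the increments are orthogonal
      -- and the second moment grows linearly.
      have hcross : ∫ ω, (S T ω * φ (chain step z₀ ω T)) * ψ (ω T) ∂P = 0 := by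
        have h1 := hind2.integral_fun_mul_eq_mul_integral
          (((measurable_snd.mul (hφ.comp measurable_fst)).comp
            (measurable_chain (step := fun (q : β × ℝ) w => (step q.1 w, q.2 + φ q.1 * ψ w))
              (z₀ := (z₀, (0 : ℝ))) hstep' T)).aestronglyMeasurable)
          ((hψ.comp (measurable_pi_apply T)).aestronglyMeasurable)
        simp only [Function.comp_def, chain_prod_sum] at h1
        rw [h1]
        have h2 : ∫ ω : ℕ → α, ψ (ω T) ∂P = 0 := by
          rw [← hψ0, ← (hev T).map_eq, integral_map (hev T).measurable.aemeasurable
            hψ.aestronglyMeasurable]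
        rw [h2, mul_zero]
      have i1 : Integrable (fun ω => (S T ω * φ (chain step z₀ ω T)) * ψ (ω T)) P := by
        refine hbdd (((hm T).mul (hφ.comp (measurable_chain hstep T))).mul
          (hψ.comp (measurable_pi_apply T))) (B := (T * (C * D)) * (C * D)) ?_
        filter_upwards [hSb, hb] with ω h1 h2
        rw [mul_assoc, abs_mul]
        exact mul_le_mul (h1 T) (h2 T) (abs_nonneg _) ((abs_nonneg _).trans (h1 T))
      have hb2 : ∀ᵐ ω ∂P, |(φ (chain step z₀ ω T) * ψ (ω T)) ^ 2| ≤ (C * D) ^ 2 := by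
        filter_upwards [hb] with ω h2
        rw [abs_pow]
        exact pow_le_pow_left₀ (abs_nonneg _) (h2 T) 2
      have i2 : Integrable (fun ω => (φ (chain step z₀ ω T) * ψ (ω T)) ^ 2) P :=
        hbdd (((hφ.comp (measurable_chain hstep T)).mul
          (hψ.comp (measurable_pi_apply T))).pow_const 2) hb2
      have h3 : ∫ ω, (φ (chain step z₀ ω T) * ψ (ω T)) ^ 2 ∂P ≤ (C * D) ^ 2 := by
        have h4 : ∫ ω, (φ (chain step z₀ ω T) * ψ (ω T)) ^ 2 ∂P ≤ ∫ _ω, (C * D) ^ 2 ∂P :=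
          integral_mono_ae i2 (integrable_const _) (hb2.mono fun ω h => (le_abs_self _).trans h)
        simpa using h4
      have h5 : ∀ ω, S (T + 1) ω ^ 2 = S T ω ^ 2 +
          2 * ((S T ω * φ (chain step z₀ ω T)) * ψ (ω T)) +
          (φ (chain step z₀ ω T) * ψ (ω T)) ^ 2 := by
        intro ω
        simp only [hS, Finset.sum_range_succ]
        ring
      change ∫ ω, S (T + 1) ω ^ 2 ∂P ≤ _
      have ih' : ∫ ω, S T ω ^ 2 ∂P ≤ (C * D) ^ 2 * T := ih
      rw [integral_congr_ae (ae_of_all P h5)]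
      have e := integral_add ((hi T).add (i1.const_mul 2)) i2
      simp only [Pi.add_apply] at e
      rw [e, integral_add (hi T) (i1.const_mul 2),
        integral_const_mul, hcross]
      push_cast
      linarith

end LLN

end RCLQR

namespace RCLQR

/-! ### Pathwise averages of stable linear systems -/

section Deterministic

variable {n : ℕ}

open scoped Matrix.Norms.Operator in
/-- Input-to-state bound of a stable linear system. -/
theorem Schur.exists_norm_le {F : Matrix (Fin n) (Fin n) ℝ} (h : Schur F) :
    ∃ c : ℝ, 0 ≤ c ∧ ∀ (y e : ℕ → Fin n → ℝ) (v : ℝ), (∀ t, y (t + 1) = F *ᵥ y t + e t) →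
      (∀ t, ‖e t‖ ≤ v) → ∀ t, ‖y t‖ ≤ c * (‖y 0‖ + v) := by
  have hs := h.summable_norm
  refine ⟨∑' t : ℕ, ‖F ^ t‖, tsum_nonneg fun t => norm_nonneg _, fun y e v hy he t => ?_⟩
  have hv : 0 ≤ v := (norm_nonneg _).trans (he 0)
  have hrep : ∀ t, y t = F ^ t *ᵥ y 0 + ∑ s ∈ Finset.range t, F ^ s *ᵥ e (t - 1 - s) := by
    intro t
    induction t with
    | zero => simp
    | succ t ih =>
      rw [hy, Finset.sum_range_succ', ih, Matrix.mulVec_add, Matrix.mulVec_mulVec, ← pow_succ']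
      simp only [add_tsub_cancel_right, pow_zero, Matrix.one_mulVec, tsub_zero]
      rw [add_assoc, Matrix.mulVec_sum]
      congr 2
      refine Finset.sum_congr rfl fun s _ => ?_
      rw [Matrix.mulVec_mulVec, ← pow_succ']
      congr 2
      omega
  rw [hrep t]
  have h1 : ‖∑ s ∈ Finset.range t, F ^ s *ᵥ e (t - 1 - s)‖ ≤ (∑' t : ℕ, ‖F ^ t‖) * v := by
    refine (norm_sum_le _ _).trans ?_
    refine (Finset.sum_le_sum (g := fun s => ‖F ^ s‖ * v) fun s _ => ?_).trans ?_
    · exact (Matrix.linfty_opNorm_mulVec _ _).trans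
        (mul_le_mul_of_nonneg_left (he _) (norm_nonneg _))
    · rw [← Finset.sum_mul]
      exact mul_le_mul_of_nonneg_right (hs.sum_le_tsum _ fun i _ => norm_nonneg _) hv
  have h2 : ‖F ^ t *ᵥ y 0‖ ≤ (∑' t : ℕ, ‖F ^ t‖) * ‖y 0‖ :=
    (Matrix.linfty_opNorm_mulVec _ _).trans
      (mul_le_mul_of_nonneg_right (hs.le_tsum t fun i _ => norm_nonneg _) (norm_nonneg _))
  refine (norm_add_le _ _).trans ?_
  rw [mul_add]
  exact add_le_add h2 h1

theorem tendsto_inv_smul_sub_of_bounded {E : Type*} [NormedAddCommGroup E] [NormedSpace ℝ E]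
    {f : ℕ → E} {C : ℝ} (hf : ∀ t, ‖f t‖ ≤ C) :
    Tendsto (fun T : ℕ => (T : ℝ)⁻¹ • (f 0 - f T)) atTop (𝓝 0) := by
  refine squeeze_zero_norm (a := fun T : ℕ => (T : ℝ)⁻¹ * (C + C)) (fun T => ?_) ?_
  · rw [norm_smul, norm_inv, Real.norm_natCast]
    exact mul_le_mul_of_nonneg_left ((norm_sub_le _ _).trans (add_le_add (hf 0) (hf T)))
      (by positivity)
  · simpa using (tendsto_inv_atTop_nhds_zero_nat (𝕜 := ℝ)).mul_const (C + C)

/-- Time averages of a bounded trajectory of a stable system with averaging-to-zero input. -/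
theorem Schur.tendsto_average {F : Matrix (Fin n) (Fin n) ℝ} (h : Schur F) {y e : ℕ → Fin n → ℝ}
    {C : ℝ} (hy : ∀ t, y (t + 1) = F *ᵥ y t + e t) (hC : ∀ t, ‖y t‖ ≤ C)
    (he : Tendsto (fun T : ℕ => (T : ℝ)⁻¹ • ∑ t ∈ Finset.range T, e t) atTop (𝓝 0)) :
    Tendsto (fun T : ℕ => (T : ℝ)⁻¹ • ∑ t ∈ Finset.range T, y t) atTop (𝓝 0) := by
  have hu := (Matrix.isUnit_iff_isUnit_det _).mp h.isUnit_one_sub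
  have h1 : ∀ T : ℕ, ∑ t ∈ Finset.range T, y t =
      (1 - F)⁻¹ *ᵥ ((y 0 - y T) + ∑ t ∈ Finset.range T, e t) := by
    intro T
    have h2 : (1 - F) *ᵥ ∑ t ∈ Finset.range T, y t = (y 0 - y T) + ∑ t ∈ Finset.range T, e t := by
      rw [Matrix.mulVec_sum, ← Finset.sum_range_sub' y T, ← Finset.sum_add_distrib]
      refine Finset.sum_congr rfl fun t _ => ?_
      rw [hy, Matrix.sub_mulVec, Matrix.one_mulVec]
      abel
    rw [← h2, Matrix.mulVec_mulVec, Matrix.nonsing_inv_mul _ hu, Matrix.one_mulVec]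
  have h3 := (tendsto_inv_smul_sub_of_bounded hC).add he
  have h4 : Continuous fun x : Fin n → ℝ => (1 - F)⁻¹ *ᵥ x :=
    continuous_const.matrix_mulVec continuous_id
  have h5 := (h4.tendsto _).comp h3
  rw [add_zero, Matrix.mulVec_zero] at h5
  refine h5.congr fun T => ?_
  rw [Function.comp_apply, h1, ← smul_add, Matrix.mulVec_smul]

open scoped Matrix.Norms.Operator in
/-- Time averages of the outer products of a bounded trajectory of a stable system. -/
theorem Schur.tendsto_average_vecMulVec {F W : Matrix (Fin n) (Fin n) ℝ} (h : Schur F)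
    {y e : ℕ → Fin n → ℝ}
    {C : ℝ} (hy : ∀ t, y (t + 1) = F *ᵥ y t + e t) (hC : ∀ t, ‖y t‖ ≤ C)
    (hye : Tendsto (fun T : ℕ => (T : ℝ)⁻¹ • ∑ t ∈ Finset.range T, vecMulVec (y t) (e t)) atTop
      (𝓝 0))
    (he : Tendsto (fun T : ℕ => (T : ℝ)⁻¹ • ∑ t ∈ Finset.range T, vecMulVec (e t) (e t)) atTop
      (𝓝 W)) :
    Tendsto (fun T : ℕ => (T : ℝ)⁻¹ • ∑ t ∈ Finset.range T, vecMulVec (y t) (y t)) atTop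
      (𝓝 (lyap F W)) := by
  refine h.tendsto_lyap ?_
  have hC0 : 0 ≤ C := (norm_nonneg _).trans (hC 0)
  have hi : ∀ t i, ‖y t i‖ ≤ C := fun t i => (norm_le_pi_norm (y t) i).trans (hC t)
  have h0 : Tendsto (fun T : ℕ => (T : ℝ)⁻¹ • (vecMulVec (y 0) (y 0) - vecMulVec (y T) (y T)))
      atTop (𝓝 0) := by
    refine tendsto_pi_nhds.mpr fun i => tendsto_pi_nhds.mpr fun j => ?_
    exact tendsto_inv_smul_sub_of_bounded (f := fun t => y t i * y t j) (C := C * C) fun t => by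
      rw [norm_mul]
      exact mul_le_mul (hi t i) (hi t j) (norm_nonneg _) hC0
  have h1 := hye.const_mul F
  have h2 : Tendsto (fun T : ℕ => (F * ((T : ℝ)⁻¹ • ∑ t ∈ Finset.range T,
      vecMulVec (y t) (e t)))ᵀ) atTop (𝓝 0) := by
    have := (Continuous.matrix_transpose continuous_id).continuousAt.tendsto.comp h1
    simpa [Function.comp_def] using this
  have h3 := ((h0.add h1).add h2).add he
  simp only [Matrix.mul_zero, add_zero, zero_add] at h3
  refine h3.congr fun T => ?_
  have h4 : ∀ t, vecMulVec (y (t + 1)) (y (t + 1)) = F * vecMulVec (y t) (y t) * Fᵀ +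
      F * vecMulVec (y t) (e t) + (F * vecMulVec (y t) (e t))ᵀ + vecMulVec (e t) (e t) := by
    intro t
    rw [hy, Matrix.mul_vecMulVec, Matrix.vecMulVec_mul, Matrix.vecMul_transpose,
      Matrix.mul_vecMulVec, Matrix.transpose_vecMulVec, Matrix.add_vecMulVec, Matrix.vecMulVec_add,
      Matrix.vecMulVec_add]
    abel
  -- Summing the recursion for the outer products telescopes: the Lyapunov defect of the averaged
  -- outer product consists of boundary terms, cross terms and the noise average.
  have h5 : vecMulVec (y 0) (y 0) - vecMulVec (y T) (y T) +
      F * (∑ t ∈ Finset.range T, vecMulVec (y t) (e t)) +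
      (F * (∑ t ∈ Finset.range T, vecMulVec (y t) (e t)))ᵀ +
      ∑ t ∈ Finset.range T, vecMulVec (e t) (e t) =
      ∑ t ∈ Finset.range T, vecMulVec (y t) (y t) -
        F * (∑ t ∈ Finset.range T, vecMulVec (y t) (y t)) * Fᵀ := by
    rw [← Finset.sum_range_sub' (fun t => vecMulVec (y t) (y t)) T]
    simp only [Finset.mul_sum, Finset.sum_mul, Matrix.transpose_sum, ← Finset.sum_add_distrib,
      ← Finset.sum_sub_distrib]
    refine Finset.sum_congr rfl fun t _ => ?_
    rw [h4]
    abel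
  simp only [Matrix.mul_smul, Matrix.smul_mul, Matrix.transpose_smul]
  rw [← smul_add, ← smul_add, ← smul_add, ← smul_sub, h5]

end Deterministic

/-! ### Almost sure averages of the centered closed loop -/

namespace Model

variable {n m : ℕ} {M : Model n m}

theorem ae_norm_le (hM : M.Standing) : ∃ v : ℝ, 0 < v ∧ ∀ᵐ w ∂M.noiseLaw, ‖w‖ ≤ v := by
  obtain ⟨v, hv, h⟩ := hM.noise_bounded
  refine ⟨v, hv, h.mono fun w hw => (pi_norm_le_iff_of_nonneg hv.le).mpr fun i => ?_⟩
  refine le_trans ?_ hw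
  rw [Real.norm_eq_abs, ← Real.sqrt_sq_eq_abs]
  refine Real.sqrt_le_sqrt ?_
  rw [pow_two]
  exact Finset.single_le_sum (f := fun i => w i * w i) (fun j _ => mul_self_nonneg _)
    (Finset.mem_univ i)

theorem integrable_noise (hM : M.Standing) {f : (Fin n → ℝ) → ℝ} (hf : Continuous f) :
    Integrable f M.noiseLaw := by
  have := hM.noise_prob
  obtain ⟨v, -, h⟩ := ae_norm_le hM
  obtain ⟨C, hC⟩ := (isCompact_closedBall (0 : Fin n → ℝ) v).exists_bound_of_continuousOn
    hf.continuousOn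
  refine Integrable.of_bound hf.aestronglyMeasurable C (h.mono fun w hw => ?_)
  exact hC w (by simpa using hw)

theorem integral_centered (hM : M.Standing) (i : Fin n) :
    ∫ w, (w i - M.wbar i) ∂M.noiseLaw = 0 := by
  have := hM.noise_prob
  rw [integral_sub (integrable_noise hM (by fun_prop)) (integrable_const _)]
  simp [wbar]

theorem integral_centered_mul (hM : M.Standing) (i j : Fin n) :
    ∫ w, ((w i - M.wbar i) * (w j - M.wbar j) - M.W i j) ∂M.noiseLaw = 0 := by
  have := hM.noise_prob
  rw [integral_sub (integrable_noise hM (by fun_prop)) (integrable_const _)]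
  simp [W]

/-- One step of the closed loop in coordinates centered at the stationary mean. -/
noncomputable def centStep (M : Model n m) (X : Policy n m) (y w : Fin n → ℝ) : Fin n → ℝ :=
  M.clm X *ᵥ y + (w - M.wbar)

theorem measurable_centStep (X : Policy n m) :
    Measurable fun q : (Fin n → ℝ) × (Fin n → ℝ) => M.centStep X q.1 q.2 := by
  refine Continuous.measurable ?_
  unfold centStep
  exact (continuous_const.matrix_mulVec continuous_fst).add (continuous_snd.sub continuous_const)

/-- The stationary mean as a vector. -/
noncomputable def meanVec (M : Model n m) (X : Policy n m) : Fin n → ℝ := fun i => M.statMean X i ()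

theorem meanVec_eq {X : Policy n m} (hX : X ∈ M.stab) :
    M.meanVec X = M.clm X *ᵥ M.meanVec X + (M.B *ᵥ offset X + M.wbar) := by
  have h := statMean_eq hX
  ext i
  have h1 := congrFun (congrFun h i) ()
  rw [meanVec, h1]
  rfl

/-- Subtracting the stationary mean removes the offset and the mean of the noise, leaving a linear
chain driven by centered noise. -/
theorem state_eq {X : Policy n m} (hX : X ∈ M.stab) (x₀ : Fin n → ℝ) (ω : ℕ → Fin n → ℝ) (t : ℕ) :
    M.state X (x₀, ω) t = M.meanVec X + chain (M.centStep X) (x₀ - M.meanVec X) ω t := by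
  induction t with
  | zero => simp [state, chain]
  | succ t ih =>
    rw [state, ih, chain, centStep, input]
    have h := meanVec_eq hX
    generalize chain (M.centStep X) (x₀ - M.meanVec X) ω t = y
    conv_rhs => rw [h]
    simp only [clm, Matrix.mulVec_sub, Matrix.mulVec_add, Matrix.sub_mulVec,
      Matrix.mulVec_mulVec]
    abel

/-- Uniform almost sure bound of the centered closed-loop trajectories. -/
theorem exists_norm_chain_le (hM : M.Standing) {X : Policy n m} (hX : X ∈ M.stab) :
    ∃ c v : ℝ, 0 ≤ c ∧ 0 ≤ v ∧ ∀ᵐ ω ∂(Measure.infinitePi fun _ : ℕ => M.noiseLaw),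
      (∀ t, ‖ω t - M.wbar‖ ≤ v) ∧
      ∀ y₀ t, ‖chain (M.centStep X) y₀ ω t‖ ≤ c * (‖y₀‖ + v) := by
  have := hM.noise_prob
  obtain ⟨c, hc, h⟩ := (M.mem_stab.mp hX).exists_norm_le
  obtain ⟨v, hv, hw⟩ := ae_norm_le hM
  refine ⟨c, v + ‖M.wbar‖, hc, by positivity, ?_⟩
  have hwt : ∀ᵐ ω ∂(Measure.infinitePi fun _ : ℕ => M.noiseLaw), ∀ t, ‖ω t‖ ≤ v :=
    ae_all_iff.mpr fun t =>
      (measurePreserving_eval_infinitePi (fun _ : ℕ => M.noiseLaw) t).quasiMeasurePreserving.ae hw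
  filter_upwards [hwt] with ω hω
  have h1 : ∀ t, ‖ω t - M.wbar‖ ≤ v + ‖M.wbar‖ := fun t =>
    (norm_sub_le _ _).trans (by linarith [hω t])
  refine ⟨h1, fun y₀ t => ?_⟩
  exact h (fun t => chain (M.centStep X) y₀ ω t) (fun t => ω t - M.wbar) _ (fun t => rfl) h1 t

/-- Almost surely the time averages of the centered state and of its outer products converge. -/
theorem ae_tendsto_averages (hM : M.Standing) {X : Policy n m} (hX : X ∈ M.stab)
    (y₀ : Fin n → ℝ) : ∀ᵐ ω ∂(Measure.infinitePi fun _ : ℕ => M.noiseLaw),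
      Tendsto (fun T : ℕ => (T : ℝ)⁻¹ • ∑ t ∈ Finset.range T, chain (M.centStep X) y₀ ω t) atTop
        (𝓝 0) ∧
      Tendsto (fun T : ℕ => (T : ℝ)⁻¹ • ∑ t ∈ Finset.range T,
        vecMulVec (chain (M.centStep X) y₀ ω t) (chain (M.centStep X) y₀ ω t)) atTop
        (𝓝 (M.statCov X)) := by
  have := hM.noise_prob
  obtain ⟨c, v, hc, hv, hb⟩ := exists_norm_chain_le hM hX
  obtain ⟨v', hv', hw⟩ := ae_norm_le hM
  have hbi : ∀ᵐ w ∂M.noiseLaw, ∀ i, |w i - M.wbar i| ≤ v' + ‖M.wbar‖ := by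
    filter_upwards [hw] with w h i
    exact (abs_sub _ _).trans (add_le_add ((norm_le_pi_norm w i).trans h)
      (norm_le_pi_norm M.wbar i))
  have hmeas := M.measurable_centStep X
  -- Three applications of the strong law feed the pathwise limits: to the centered noise, to the
  -- state times the noise that follows it, and to noise products minus their covariance.
  have e1 : ∀ᵐ ω ∂(Measure.infinitePi fun _ : ℕ => M.noiseLaw), ∀ i, Tendsto
      (fun T : ℕ => (T : ℝ)⁻¹ * ∑ t ∈ Finset.range T, 1 * (ω t i - M.wbar i)) atTop (𝓝 0) :=
    ae_all_iff.mpr fun i => ae_tendsto_average_chain (z₀ := y₀) M.noiseLaw hmeas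
      (φ := fun _ => 1) (ψ := fun w => w i - M.wbar i) measurable_const (by fun_prop) (C := 1)
      zero_le_one (ae_of_all _ fun ω t => by simp) (hbi.mono fun w h => h i)
      (integral_centered hM i)
  have e2 : ∀ᵐ ω ∂(Measure.infinitePi fun _ : ℕ => M.noiseLaw), ∀ p : Fin n × Fin n, Tendsto
      (fun T : ℕ => (T : ℝ)⁻¹ * ∑ t ∈ Finset.range T,
        chain (M.centStep X) y₀ ω t p.1 * (ω t p.2 - M.wbar p.2)) atTop (𝓝 0) :=
    ae_all_iff.mpr fun p => ae_tendsto_average_chain (z₀ := y₀) M.noiseLaw hmeas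
      (φ := fun y => y p.1) (ψ := fun w => w p.2 - M.wbar p.2) (by fun_prop) (by fun_prop)
      (C := c * (‖y₀‖ + v)) (by positivity)
      (hb.mono fun ω h t => (norm_le_pi_norm _ _).trans (h.2 y₀ t)) (hbi.mono fun w h => h _)
      (integral_centered hM _)
  have e3 : ∀ᵐ ω ∂(Measure.infinitePi fun _ : ℕ => M.noiseLaw), ∀ p : Fin n × Fin n, Tendsto
      (fun T : ℕ => (T : ℝ)⁻¹ * ∑ t ∈ Finset.range T,
        1 * ((ω t p.1 - M.wbar p.1) * (ω t p.2 - M.wbar p.2) - M.W p.1 p.2)) atTop (𝓝 0) :=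
    ae_all_iff.mpr fun p => ae_tendsto_average_chain (z₀ := y₀) M.noiseLaw hmeas
      (φ := fun _ => 1)
      (ψ := fun w => (w p.1 - M.wbar p.1) * (w p.2 - M.wbar p.2) - M.W p.1 p.2)
      measurable_const (by fun_prop) (C := 1)
      (D := (v' + ‖M.wbar‖) * (v' + ‖M.wbar‖) + |M.W p.1 p.2|) zero_le_one
      (ae_of_all _ fun ω t => by simp)
      (hbi.mono fun w h => (abs_sub _ _).trans (by
        rw [abs_mul]
        gcongr
        · exact h _
        · exact h _))
      (integral_centered_mul hM _ _)
  filter_upwards [hb, e1, e2, e3] with ω h0 h1 h2 h3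
  have hrec : ∀ t, chain (M.centStep X) y₀ ω (t + 1) =
    M.clm X *ᵥ chain (M.centStep X) y₀ ω t + (ω t - M.wbar) := fun t => rfl
  constructor
  · refine (M.mem_stab.mp hX).tendsto_average hrec (h0.2 y₀) ?_
    refine tendsto_pi_nhds.mpr fun i => (h1 i).congr fun T => ?_
    simp [Finset.sum_apply]
  · refine (M.mem_stab.mp hX).tendsto_average_vecMulVec hrec (h0.2 y₀) ?_ ?_
    · refine tendsto_pi_nhds.mpr fun i => tendsto_pi_nhds.mpr fun j => (h2 (i, j)).congr fun T => ?_
      simp [Matrix.sum_apply, vecMulVec_apply]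
    · refine tendsto_pi_nhds.mpr fun i => tendsto_pi_nhds.mpr fun j => ?_
      have h4 := (h3 (i, j)).add_const (M.W i j)
      rw [zero_add] at h4
      refine h4.congr' ?_
      filter_upwards [eventually_ge_atTop 1] with T hT
      have hT0 : (T : ℝ) ≠ 0 := by positivity
      simp only [one_mul, Finset.sum_sub_distrib, Finset.sum_const, Finset.card_range,
        Matrix.smul_apply, Matrix.sum_apply, vecMulVec_apply, Pi.sub_apply, smul_eq_mul,
        nsmul_eq_mul]
      field_simp
      ring

end Model

end RCLQR

namespace RCLQR

/-! ### Average costs, the oracle and the closed form -/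

namespace Model

variable {n m : ℕ} {M : Model n m}

/-- A general quadratic stage cost. -/
noncomputable def quadCost (G : Matrix (Fin n) (Fin n) ℝ) (s : Fin n → ℝ)
    (R : Matrix (Fin m) (Fin m) ℝ) (κ : ℝ) (x : Fin n → ℝ) (u : Fin m → ℝ) : ℝ :=
  x ⬝ᵥ (G *ᵥ x) + 2 * (x ⬝ᵥ s) + u ⬝ᵥ (R *ᵥ u) - κ

/-- The stationary average of a quadratic stage cost. -/
noncomputable def costLim (M : Model n m) (G : Matrix (Fin n) (Fin n) ℝ) (s : Fin n → ℝ)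
    (R : Matrix (Fin m) (Fin m) ℝ) (κ : ℝ) (X : Policy n m) : ℝ :=
  quadCost G s R κ (M.meanVec X) (input X (M.meanVec X)) +
    ((G + (gain X)ᵀ * R * gain X) * M.statCov X).trace

theorem trace_mul_vecMulVec_self (H : Matrix (Fin n) (Fin n) ℝ) (y : Fin n → ℝ) :
    (H * vecMulVec y y).trace = y ⬝ᵥ (H *ᵥ y) := by
  rw [Matrix.mul_vecMulVec, Matrix.trace_vecMulVec, dotProduct_comm]

/-- An exact second-order expansion around x. Around the stationary mean the linear term averages to
zero and the quadratic term to the covariance. The transposes in the witness appear because G and R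
are not assumed symmetric. -/
theorem exists_quadCost_add (G : Matrix (Fin n) (Fin n) ℝ) (s : Fin n → ℝ)
    (R : Matrix (Fin m) (Fin m) ℝ) (κ : ℝ) (X : Policy n m) (x : Fin n → ℝ) :
    ∃ p : Fin n → ℝ, ∀ y, quadCost G s R κ (x + y) (input X (x + y)) =
      quadCost G s R κ x (input X x) + p ⬝ᵥ y +
        ((G + (gain X)ᵀ * R * gain X) * vecMulVec y y).trace := by
  set u := input X x with hu
  refine ⟨G *ᵥ x + Gᵀ *ᵥ x + (2 : ℝ) • s - (gain X)ᵀ *ᵥ (R *ᵥ u + Rᵀ *ᵥ u), fun y => ?_⟩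
  have h1 : input X (x + y) = u - gain X *ᵥ y := by
    rw [hu, input, input, Matrix.mulVec_add]
    abel
  rw [h1, trace_mul_vecMulVec_self]
  have h2 : (Gᵀ *ᵥ x) ⬝ᵥ y = x ⬝ᵥ (G *ᵥ y) := by
    rw [Matrix.mulVec_transpose, Matrix.dotProduct_mulVec]
  have h3 : ∀ v : Fin m → ℝ, ((gain X)ᵀ *ᵥ v) ⬝ᵥ y = v ⬝ᵥ (gain X *ᵥ y) := fun v => by
    rw [Matrix.mulVec_transpose, Matrix.dotProduct_mulVec]
  have h4 : (Rᵀ *ᵥ u) ⬝ᵥ (gain X *ᵥ y) = u ⬝ᵥ (R *ᵥ (gain X *ᵥ y)) := by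
    rw [Matrix.mulVec_transpose, ← Matrix.dotProduct_mulVec]
  have h5 : y ⬝ᵥ (((gain X)ᵀ * R * gain X) *ᵥ y) =
      (gain X *ᵥ y) ⬝ᵥ (R *ᵥ (gain X *ᵥ y)) := by
    rw [← Matrix.mulVec_mulVec, ← Matrix.mulVec_mulVec, dotProduct_comm, h3, dotProduct_comm]
  simp only [quadCost, Matrix.mulVec_add, Matrix.mulVec_sub, dotProduct_add, add_dotProduct,
    sub_dotProduct, dotProduct_sub, Matrix.add_mulVec, smul_dotProduct, h2, h3, h4, h5, smul_eq_mul]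
  rw [dotProduct_comm y (G *ᵥ x), dotProduct_comm (gain X *ᵥ y) (R *ᵥ u), dotProduct_comm y s]
  ring

/-- Almost surely, the time averages of a quadratic stage cost converge. -/
theorem ae_tendsto_quadCost (hM : M.Standing) {X : Policy n m} (hX : X ∈ M.stab)
    (G : Matrix (Fin n) (Fin n) ℝ) (s : Fin n → ℝ) (R : Matrix (Fin m) (Fin m) ℝ) (κ : ℝ)
    (x₀ : Fin n → ℝ) : ∀ᵐ ω ∂(Measure.infinitePi fun _ : ℕ => M.noiseLaw),
      Tendsto (fun T : ℕ => (T : ℝ)⁻¹ * ∑ t ∈ Finset.range T,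
        quadCost G s R κ (M.state X (x₀, ω) t) (input X (M.state X (x₀, ω) t))) atTop
        (𝓝 (M.costLim G s R κ X)) := by
  obtain ⟨p, hp⟩ := exists_quadCost_add G s R κ X (M.meanVec X)
  filter_upwards [ae_tendsto_averages hM hX (x₀ - M.meanVec X)] with ω h
  obtain ⟨h1, h2⟩ := h
  set y : ℕ → Fin n → ℝ := fun t => chain (M.centStep X) (x₀ - M.meanVec X) ω t with hy
  set H := G + (gain X)ᵀ * R * gain X with hH
  have h3 : Tendsto (fun T : ℕ => quadCost G s R κ (M.meanVec X) (input X (M.meanVec X)) +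
      p ⬝ᵥ ((T : ℝ)⁻¹ • ∑ t ∈ Finset.range T, y t) +
      (H * ((T : ℝ)⁻¹ • ∑ t ∈ Finset.range T, vecMulVec (y t) (y t))).trace) atTop
      (𝓝 (quadCost G s R κ (M.meanVec X) (input X (M.meanVec X)) + p ⬝ᵥ 0 +
        (H * M.statCov X).trace)) := by
    refine (tendsto_const_nhds.add ?_).add ?_
    · exact ((continuous_const.dotProduct continuous_id).tendsto (0 : Fin n → ℝ)).comp h1
    · exact ((continuous_const.matrix_mul continuous_id).matrix_trace.tendsto (M.statCov X)).comp h2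
  rw [dotProduct_zero, add_zero] at h3
  refine h3.congr' ?_
  filter_upwards [eventually_ge_atTop 1] with T hT
  have hT0 : (T : ℝ) ≠ 0 := by positivity
  simp only [state_eq hX, hp]
  rw [Finset.sum_add_distrib, Finset.sum_add_distrib, Finset.sum_const, Finset.card_range,
    nsmul_eq_mul, dotProduct_smul, dotProduct_sum, Matrix.mul_smul, Matrix.trace_smul,
    Finset.mul_sum, Matrix.trace_sum, mul_add, mul_add, inv_mul_cancel_left₀ hT0]
  rfl

theorem abs_dotProduct_le (p y : Fin n → ℝ) : |p ⬝ᵥ y| ≤ (∑ i, |p i|) * ‖y‖ := by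
  rw [Finset.sum_mul]
  refine (Finset.abs_sum_le_sum_abs _ _).trans (Finset.sum_le_sum fun i _ => ?_)
  rw [abs_mul]
  exact mul_le_mul_of_nonneg_left (norm_le_pi_norm y i) (abs_nonneg _)

theorem abs_quad_le (H : Matrix (Fin n) (Fin n) ℝ) (y : Fin n → ℝ) :
    |(H * vecMulVec y y).trace| ≤ (∑ i, ∑ j, |H i j|) * ‖y‖ ^ 2 := by
  have h : (H * vecMulVec y y).trace = ∑ i, ∑ j, H i j * (y j * y i) := by
    simp [Matrix.trace, Matrix.mul_apply, vecMulVec_apply]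
  rw [h, Finset.sum_mul]
  refine (Finset.abs_sum_le_sum_abs _ _).trans (Finset.sum_le_sum fun i _ => ?_)
  rw [Finset.sum_mul]
  refine (Finset.abs_sum_le_sum_abs _ _).trans (Finset.sum_le_sum fun j _ => ?_)
  rw [abs_mul, abs_mul, pow_two]
  exact mul_le_mul_of_nonneg_left (mul_le_mul (norm_le_pi_norm y j) (norm_le_pi_norm y i)
    (abs_nonneg _) (norm_nonneg _)) (abs_nonneg _)

/-- The exceptional null set does not depend on the initial state, and the bound grows quadratically
in it. The second moment of the initial state thus gives an integrable majorant for dominated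
convergence. -/
theorem exists_abs_quadCost_le (hM : M.Standing) {X : Policy n m} (hX : X ∈ M.stab)
    (G : Matrix (Fin n) (Fin n) ℝ) (s : Fin n → ℝ) (R : Matrix (Fin m) (Fin m) ℝ) (κ : ℝ) :
    ∃ C : ℝ, ∀ᵐ ω ∂(Measure.infinitePi fun _ : ℕ => M.noiseLaw), ∀ x₀ t,
      |quadCost G s R κ (M.state X (x₀, ω) t) (input X (M.state X (x₀, ω) t))| ≤
        C * (1 + ‖x₀‖ ^ 2) := by
  obtain ⟨p, hp⟩ := exists_quadCost_add G s R κ X (M.meanVec X)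
  obtain ⟨c, v, hc, hv, hb⟩ := exists_norm_chain_le hM hX
  set H := G + (gain X)ᵀ * R * gain X with hH
  set q := quadCost G s R κ (M.meanVec X) (input X (M.meanVec X)) with hq
  set a := ∑ i, |p i| with ha
  set b := ∑ i, ∑ j, |H i j| with hb'
  have ha0 : 0 ≤ a := Finset.sum_nonneg fun i _ => abs_nonneg _
  have hb0 : 0 ≤ b := Finset.sum_nonneg fun i _ => Finset.sum_nonneg fun j _ => abs_nonneg _
  set d := ‖M.meanVec X‖ + v with hd
  have hd0 : 0 ≤ d := by positivity
  refine ⟨|q| + a + (a + b) * (2 * c ^ 2 * (1 + d ^ 2)), ?_⟩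
  filter_upwards [hb] with ω hω x₀ t
  have h1 := hω.2 (x₀ - M.meanVec X) t
  rw [state_eq hX, hp]
  generalize chain (M.centStep X) (x₀ - M.meanVec X) ω t = y at h1 ⊢
  have h2 : ‖y‖ ≤ c * (‖x₀‖ + d) := h1.trans (mul_le_mul_of_nonneg_left
    (by rw [hd]; linarith [norm_sub_le x₀ (M.meanVec X)]) hc)
  have h3 : ‖y‖ ^ 2 ≤ 2 * c ^ 2 * (1 + d ^ 2) * (1 + ‖x₀‖ ^ 2) := by
    have h4 : ‖y‖ ^ 2 ≤ (c * (‖x₀‖ + d)) ^ 2 := pow_le_pow_left₀ (norm_nonneg _) h2 2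
    have h5 : (‖x₀‖ + d) ^ 2 ≤ 2 * ((1 + d ^ 2) * (1 + ‖x₀‖ ^ 2)) := by
      nlinarith [sq_nonneg (‖x₀‖ - d), mul_nonneg (sq_nonneg d) (sq_nonneg ‖x₀‖)]
    rw [mul_pow] at h4
    nlinarith [mul_le_mul_of_nonneg_left h5 (sq_nonneg c)]
  have h6 : |q + p ⬝ᵥ y + (H * vecMulVec y y).trace| ≤ |q| + a * ‖y‖ + b * ‖y‖ ^ 2 := by
    refine (abs_add_le _ _).trans (add_le_add ((abs_add_le _ _).trans (add_le_add le_rfl ?_)) ?_)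
    · exact abs_dotProduct_le p y
    · exact abs_quad_le H y
  have h7 : ‖y‖ ≤ 1 + ‖y‖ ^ 2 := by nlinarith [sq_nonneg (‖y‖ - 1)]
  have h8 : a * ‖y‖ ≤ a * (1 + ‖y‖ ^ 2) := mul_le_mul_of_nonneg_left h7 ha0
  have h9 : (a + b) * ‖y‖ ^ 2 ≤ (a + b) * (2 * c ^ 2 * (1 + d ^ 2) * (1 + ‖x₀‖ ^ 2)) :=
    mul_le_mul_of_nonneg_left h3 (by positivity)
  have h10 : 0 ≤ (|q| + a) * ‖x₀‖ ^ 2 := by positivity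
  nlinarith

theorem continuous_offset : Continuous (offset : Policy n m → Fin m → ℝ) :=
  continuous_pi fun i => (EuclideanSpace.proj (𝕜 := ℝ) (i, Fin.last n)).continuous

theorem continuous_input :
    Continuous fun p : Policy n m × (Fin n → ℝ) => input p.1 p.2 :=
  (continuous_offset.comp continuous_fst).sub
    ((continuous_gain.comp continuous_fst).matrix_mulVec continuous_snd)

theorem continuous_state (M : Model n m) (t : ℕ) :
    Continuous fun p : Policy n m × Path n => M.state p.1 p.2 t := by
  induction t with
  | zero => exact continuous_fst.comp continuous_snd
  | succ t ih =>
    exact ((continuous_const.matrix_mulVec ih).add (continuous_const.matrix_mulVec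
      (continuous_input.comp (continuous_fst.prodMk ih)))).add
      ((continuous_apply t).comp (continuous_snd.comp continuous_snd))

theorem continuous_quadCost (M : Model n m) (G : Matrix (Fin n) (Fin n) ℝ) (s : Fin n → ℝ)
    (R : Matrix (Fin m) (Fin m) ℝ) (κ : ℝ) (t : ℕ) :
    Continuous fun p : Policy n m × Path n =>
      quadCost G s R κ (M.state p.1 p.2 t) (input p.1 (M.state p.1 p.2 t)) := by
  have h1 := M.continuous_state t
  have h2 : Continuous fun p : Policy n m × Path n => input p.1 (M.state p.1 p.2 t) :=
    continuous_input.comp (continuous_fst.prodMk h1)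
  exact (((h1.dotProduct (continuous_const.matrix_mulVec h1)).add
    (continuous_const.mul (h1.dotProduct continuous_const))).add
    (h2.dotProduct (continuous_const.matrix_mulVec h2))).sub continuous_const

theorem measurable_average_quadCost (M : Model n m) (G : Matrix (Fin n) (Fin n) ℝ) (s : Fin n → ℝ)
    (R : Matrix (Fin m) (Fin m) ℝ) (κ : ℝ) (T : ℕ) :
    Measurable fun p : Policy n m × Path n => (T : ℝ)⁻¹ * ∑ t ∈ Finset.range T,
      quadCost G s R κ (M.state p.1 p.2 t) (input p.1 (M.state p.1 p.2 t)) :=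
  (continuous_const.mul (continuous_finsetSum _ fun t _ =>
    M.continuous_quadCost G s R κ t)).measurable

theorem isProbabilityMeasure_pathLaw (hM : M.Standing) : IsProbabilityMeasure M.pathLaw := by
  have := hM.noise_prob
  have := hM.init_prob
  unfold pathLaw
  infer_instance

theorem ae_pathLaw_tendsto_quadCost (hM : M.Standing) {X : Policy n m} (hX : X ∈ M.stab)
    (G : Matrix (Fin n) (Fin n) ℝ) (s : Fin n → ℝ) (R : Matrix (Fin m) (Fin m) ℝ) (κ : ℝ) :
    ∀ᵐ ω ∂M.pathLaw, Tendsto (fun T : ℕ => (T : ℝ)⁻¹ * ∑ t ∈ Finset.range T,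
        quadCost G s R κ (M.state X ω t) (input X (M.state X ω t))) atTop
        (𝓝 (M.costLim G s R κ X)) := by
  have := hM.noise_prob
  have := hM.init_prob
  have hf : ∀ T : ℕ, Measurable fun ω : Path n => (T : ℝ)⁻¹ * ∑ t ∈ Finset.range T,
      quadCost G s R κ (M.state X ω t) (input X (M.state X ω t)) := fun T => by
    have h := (M.measurable_average_quadCost G s R κ T).comp
      (measurable_prodMk_left (β := Path n) (x := X))
    simpa only [Function.comp_def] using h
  have hg : Measurable fun _ : Path n => M.costLim G s R κ X := measurable_const
  have hm := measurableSet_tendsto_fun (l := atTop) hf hg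
  rw [pathLaw, Measure.ae_prod_iff_ae_ae hm]
  exact ae_of_all _ fun x₀ => ae_tendsto_quadCost hM hX G s R κ x₀

/-- The limiting expected average of a quadratic stage cost under a stabilizing policy. -/
theorem avgCost_quadCost (hM : M.Standing) {X : Policy n m} (hX : X ∈ M.stab)
    (G : Matrix (Fin n) (Fin n) ℝ) (s : Fin n → ℝ) (R : Matrix (Fin m) (Fin m) ℝ) (κ : ℝ) :
    M.avgCost (quadCost G s R κ) X = M.costLim G s R κ X := by
  have hP := isProbabilityMeasure_pathLaw hM
  have := hM.noise_prob
  have := hM.init_prob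
  obtain ⟨C, hC⟩ := exists_abs_quadCost_le hM hX G s R κ
  have hC' : ∀ᵐ ω ∂M.pathLaw, ∀ t,
      |quadCost G s R κ (M.state X ω t) (input X (M.state X ω t))| ≤ C * (1 + ‖ω.1‖ ^ 2) := by
    have h1 := Measure.quasiMeasurePreserving_snd (μ := M.initLaw)
      (ν := Measure.infinitePi fun _ : ℕ => M.noiseLaw)
    filter_upwards [h1.ae hC] with ω hω t
    exact hω ω.1 t
  have hint : Integrable (fun ω : Path n => C * (1 + ‖ω.1‖ ^ 2)) M.pathLaw := by
    have h2 : Integrable (fun x : Fin n → ℝ => ‖x‖ ^ 2) M.initLaw :=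
      (memLp_two_iff_integrable_sq_norm hM.init_sq.1).mp hM.init_sq
    have h3 : Integrable (fun ω : Path n => ‖ω.1‖ ^ 2) M.pathLaw := h2.comp_fst _
    exact ((integrable_const _).add h3).const_mul C
  refine Tendsto.limUnder_eq ?_
  have h4 := tendsto_integral_of_dominated_convergence (μ := M.pathLaw)
    (F := fun (T : ℕ) ω => (T : ℝ)⁻¹ * ∑ t ∈ Finset.range T,
        quadCost G s R κ (M.state X ω t) (input X (M.state X ω t)))
    (f := fun _ => M.costLim G s R κ X) (fun ω : Path n => C * (1 + ‖ω.1‖ ^ 2))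
    (fun T => ((M.measurable_average_quadCost G s R κ T).comp
      measurable_prodMk_left).aestronglyMeasurable) hint ?_
    (ae_pathLaw_tendsto_quadCost hM hX G s R κ)
  · simpa [integral_const_mul] using h4
  · intro T
    filter_upwards [hC'] with ω hω
    rw [norm_mul, norm_inv, Real.norm_natCast]
    have h5 : ‖∑ t ∈ Finset.range T, quadCost G s R κ (M.state X ω t)
        (input X (M.state X ω t))‖ ≤ T * (C * (1 + ‖ω.1‖ ^ 2)) := by
      refine (norm_sum_le _ _).trans ((Finset.sum_le_sum fun t _ => hω t).trans ?_)
      simp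
    have h6 : 0 ≤ C * (1 + ‖ω.1‖ ^ 2) := (abs_nonneg _).trans (hω 0)
    rcases Nat.eq_zero_or_pos T with rfl | hT
    · simpa using h6
    · have hT0 : (0 : ℝ) < T := by exact_mod_cast hT
      rwa [inv_mul_le_iff₀ hT0]

theorem stageCost_eq (μ : ℝ) :
    M.stageCost μ = quadCost (M.Qmu μ) (M.Svec μ) M.R (μ * M.tolBar) := rfl

theorem costLim_stageCost (μ : ℝ) (X : Policy n m) :
    M.costLim (M.Qmu μ) (M.Svec μ) M.R (μ * M.tolBar) X = M.lagrForm μ X := by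
  rw [lagrForm_eq, costLim, quadCost, policyMat_mul_augMean]
  have h1 : M.statMean X = replicateCol Unit (M.meanVec X) := rfl
  have h2 : replicateCol Unit (offset X) - gain X * replicateCol Unit (M.meanVec X) =
      replicateCol Unit (input X (M.meanVec X)) := rfl
  rw [h1, h2]
  have h3 : ∀ {k : ℕ} (H : Matrix (Fin k) (Fin k) ℝ) (x : Fin k → ℝ),
      ((replicateCol Unit x)ᵀ * H * replicateCol Unit x).trace = x ⬝ᵥ (H *ᵥ x) := by
    intro k H x
    rw [Matrix.mul_assoc]
    simp [Matrix.trace, Matrix.mul_apply, dotProduct, Matrix.mulVec]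
  have h4 : ((replicateCol Unit (M.meanVec X))ᵀ * replicateCol Unit (M.Svec μ)).trace =
      M.meanVec X ⬝ᵥ M.Svec μ := by
    simp [Matrix.trace, Matrix.mul_apply, dotProduct]
  rw [h3, h3, h4]
  ring

/-- On stabilizing policies the Lagrangian has the closed form `lagrForm`. -/
theorem lagr_eq (hM : M.Standing) {X : Policy n m} (hX : X ∈ M.stab) (μ : ℝ) :
    M.lagr μ X = M.lagrForm μ X := by
  have h1 : M.J X = M.costLim M.Q 0 M.R 0 X := by
    rw [← avgCost_quadCost hM hX, J]
    congr 1
    ext x u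
    simp [quadCost]
  have h2 : M.Jc X = M.costLim ((4 : ℝ) • (M.Q * M.W * M.Q)) ((2 : ℝ) • (M.Q *ᵥ M.M3)) 0 0 X := by
    rw [← avgCost_quadCost hM hX, Jc]
    congr 1
    ext x u
    simp only [quadCost, Matrix.smul_mulVec, dotProduct_smul, smul_eq_mul, Matrix.zero_mulVec,
      dotProduct_zero]
    ring
  rw [lagr, h1, h2, ← costLim_stageCost]
  simp only [costLim, quadCost, Qmu, Svec, Matrix.add_mulVec, Matrix.smul_mulVec, dotProduct_smul,
    dotProduct_add, smul_eq_mul, Matrix.zero_mulVec, dotProduct_zero, Matrix.add_mul,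
    Matrix.smul_mul, Matrix.trace_add, Matrix.trace_smul, Matrix.mul_zero, Matrix.zero_mul,
    Matrix.trace_zero]
  ring

/-- The closed form is known only for stabilizing policies. They form an open set, so the two
functions agree near X. -/
theorem gradient_lagr (hM : M.Standing) {X : Policy n m} (hX : X ∈ M.stab) (μ : ℝ) :
    gradient (M.lagr μ) X = gradient (M.lagrForm μ) X := by
  have h : M.lagr μ =ᶠ[𝓝 X] M.lagrForm μ := by
    filter_upwards [isOpen_stab.mem_nhds hX] with Y hY
    exact lagr_eq hM hY μ
  rw [gradient, gradient, h.fderiv_eq]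

/-- Almost surely, the averages that define the oracle converge to the Lagrangian. -/
theorem ae_tendsto_stageCost (hM : M.Standing) {X : Policy n m} (hX : X ∈ M.stab) (μ : ℝ) :
    ∀ᵐ ω ∂M.pathLaw, Tendsto (fun T : ℕ => (T : ℝ)⁻¹ * ∑ t ∈ Finset.range T,
        M.stageCost μ (M.state X ω t) (input X (M.state X ω t))) atTop
        (𝓝 (M.lagrForm μ X)) := by
  rw [← costLim_stageCost, stageCost_eq]
  exact ae_pathLaw_tendsto_quadCost hM hX _ _ _ _

end Model

end RCLQR

namespace RCLQR

/-! ### Existence of the minimizer and of the problem constants -/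

section LocalConstants

variable {E : Type*} [NormedAddCommGroup E] [InnerProductSpace ℝ E] [CompleteSpace E]

theorem norm_gradient_sub (f : E → ℝ) (x y : E) :
    ‖gradient f x - gradient f y‖ = ‖fderiv ℝ f x - fderiv ℝ f y‖ := by
  rw [gradient, gradient, ← map_sub, LinearIsometryEquiv.norm_map]

/-- Uniform local Lipschitz constants of a smooth function and its gradient near a compact set. -/
theorem exists_lipschitz_constants [ProperSpace E] {S K : Set E} (hS : IsOpen S) (hK : IsCompact K)
    (hKS : K ⊆ S) {f : E → ℝ} (hf : ∀ x ∈ S, ContDiffAt ℝ 2 f x) :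
    ∃ ξ β γ : ℝ, 0 < ξ ∧ 0 < β ∧ 0 < γ ∧ ∀ x ∈ K, ∀ y, ‖y - x‖ ≤ γ →
      |f y - f x| ≤ ξ * ‖y - x‖ ∧ ‖gradient f y - gradient f x‖ ≤ β * ‖y - x‖ := by
  -- A compact neighbourhood of K inside S bounds the first and second derivatives; on the convex
  -- balls of radius δ the mean value inequality gives both Lipschitz estimates.
  obtain ⟨δ, hδ, hδS⟩ := hK.exists_cthickening_subset_open hS hKS
  have hKc : IsCompact (Metric.cthickening δ K) := hK.cthickening
  have h1 : ∀ x ∈ S, ContDiffAt ℝ 1 (fderiv ℝ f) x := fun x hx =>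
    (hf x hx).fderiv_right (m := 1) (by norm_num)
  have h2 : ∀ x ∈ S, ContDiffAt ℝ 0 (fderiv ℝ (fderiv ℝ f)) x := fun x hx =>
    (h1 x hx).fderiv_right (m := 0) (by norm_num)
  obtain ⟨C, hC⟩ := hKc.exists_bound_of_continuousOn (f := fderiv ℝ f) fun x hx =>
    (h1 x (hδS hx)).continuousAt.continuousWithinAt
  obtain ⟨D, hD⟩ := hKc.exists_bound_of_continuousOn (f := fderiv ℝ (fderiv ℝ f)) fun x hx =>
    (h2 x (hδS hx)).continuousAt.continuousWithinAt
  refine ⟨max C 1, max D 1, δ, by positivity, by positivity, hδ, fun x hx y hy => ?_⟩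
  have hball : Metric.closedBall x δ ⊆ Metric.cthickening δ K :=
    Metric.closedBall_subset_cthickening hx δ
  have hyb : y ∈ Metric.closedBall x δ := by rwa [mem_closedBall_iff_norm]
  have hxb : x ∈ Metric.closedBall x δ := Metric.mem_closedBall_self hδ.le
  constructor
  · have := (convex_closedBall x δ).norm_image_sub_le_of_norm_fderiv_le (𝕜 := ℝ) (f := f)
      (fun z hz => (hf z (hδS (hball hz))).differentiableAt (by norm_num))
      (fun z hz => (hC z (hball hz)).trans (le_max_left C 1)) hxb hyb
    simpa using this
  · rw [norm_gradient_sub]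
    exact (convex_closedBall x δ).norm_image_sub_le_of_norm_fderiv_le (𝕜 := ℝ) (f := fderiv ℝ f)
      (fun z hz => (h1 z (hδS (hball hz))).differentiableAt (by norm_num))
      (fun z hz => (hD z (hball hz)).trans (le_max_left D 1)) hxb hyb

end LocalConstants

namespace Model

variable {n m : ℕ} {M : Model n m}

/-- The Lagrangian attains its minimum over the stabilizing policies. -/
theorem exists_isMin (hM : M.Standing) {μ : ℝ} (hμ : 0 ≤ μ) {X₀ : Policy n m} (hX₀ : X₀ ∈ M.stab) :
    ∃ Y ∈ M.stab, (∀ Z ∈ M.stab, M.lagrForm μ Y ≤ M.lagrForm μ Z) ∧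
      M.lagrMin μ = M.lagrForm μ Y := by
  obtain ⟨Y, hY, hmin⟩ := (isCompact_sublevel hM hμ (M.lagrForm μ X₀)).exists_isMinOn
    (f := M.lagrForm μ) ⟨X₀, hX₀, le_rfl⟩
    (fun X hX => (contDiffAt_lagrForm μ hX.1).continuousAt.continuousWithinAt)
  have hle : ∀ Z ∈ M.stab, M.lagrForm μ Y ≤ M.lagrForm μ Z := by
    intro Z hZ
    by_cases h : M.lagrForm μ Z ≤ M.lagrForm μ X₀
    · exact hmin ⟨hZ, h⟩
    · exact hY.2.trans (not_le.mp h).le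
  refine ⟨Y, hY.1, hle, IsLeast.csInf_eq ⟨⟨Y, hY.1, lagr_eq hM hY.1 μ⟩, ?_⟩⟩
  rintro _ ⟨Z, hZ, rfl⟩
  rw [lagr_eq hM hZ]
  exact hle Z hZ

theorem lagrMin_le (hM : M.Standing) {μ : ℝ} (hμ : 0 ≤ μ) {X : Policy n m} (hX : X ∈ M.stab) :
    M.lagrMin μ ≤ M.lagrForm μ X := by
  obtain ⟨Y, hY, hmin, h⟩ := exists_isMin hM hμ hX
  rw [h]
  exact hmin X hX

theorem gap₀_nonneg (hM : M.Standing) {μ : ℝ} (hμ : 0 ≤ μ) {X : Policy n m} (hX : X ∈ M.stab) :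
    0 ≤ M.gap₀ μ X := by
  rw [gap₀, lagr_eq hM hX]
  exact sub_nonneg.mpr (lagrMin_le hM hμ hX)

theorem sub10_eq (hM : M.Standing) (μ : ℝ) (X₀ : Policy n m) : M.sub10 μ X₀ =
    {X | X ∈ M.stab ∧ M.lagrForm μ X ≤ M.lagr μ X₀ + 10 * M.gap₀ μ X₀} := by
  ext X
  refine and_congr_right fun hX => ?_
  rw [lagr_eq hM hX, sub_le_iff_le_add']

theorem isCompact_sub10 (hM : M.Standing) {μ : ℝ} (hμ : 0 ≤ μ) (X₀ : Policy n m) :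
    IsCompact (M.sub10 μ X₀) := by
  rw [sub10_eq hM]
  exact isCompact_sublevel hM hμ _

theorem sub10_subset (μ : ℝ) (X₀ : Policy n m) : M.sub10 μ X₀ ⊆ M.stab := fun _ hX => hX.1

theorem mem_sub10_self (hM : M.Standing) {μ : ℝ} (hμ : 0 ≤ μ) {X₀ : Policy n m}
    (hX₀ : X₀ ∈ M.stab) : X₀ ∈ M.sub10 μ X₀ :=
  ⟨hX₀, by rw [sub_self]; linarith [gap₀_nonneg hM hμ hX₀]⟩

theorem exists_gradDominated (hM : M.Standing) {μ : ℝ} (hμ : 0 ≤ μ) {X₀ : Policy n m}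
    (hX₀ : X₀ ∈ M.stab) : ∃ lam₀ : ℝ, M.GradDominated μ (M.sub10 μ X₀) lam₀ := by
  obtain ⟨Y, hY, -, h⟩ := exists_isMin hM hμ hX₀
  obtain ⟨lam, hlam, hd⟩ := exists_gradient_dominance hM hμ (isCompact_sub10 hM hμ X₀)
    (sub10_subset μ X₀) hY
  refine ⟨lam, hlam, fun X hX => ?_⟩
  rw [gradient_lagr hM hX.1, h, lagr_eq hM hX.1]
  exact hd X hX

theorem exists_localLipschitz (hM : M.Standing) {μ : ℝ} (hμ : 0 ≤ μ) {X₀ : Policy n m}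
    (hX₀ : X₀ ∈ M.stab) : ∃ (ξ β γ : Policy n m → ℝ) (ξ₀ β₀ γ₀ : ℝ),
      M.LocalLipschitz μ ξ β γ ∧ IsLUB (ξ '' M.sub10 μ X₀) ξ₀ ∧
      IsLUB (β '' M.sub10 μ X₀) β₀ ∧ IsGLB (γ '' M.sub10 μ X₀) γ₀ ∧ 0 < γ₀ := by
  classical
  have hloc : ∀ K : Set (Policy n m), IsCompact K → K ⊆ M.stab → ∃ ξ β γ : ℝ, 0 < ξ ∧ 0 < β ∧
      0 < γ ∧ ∀ x ∈ K, ∀ y ∈ M.stab, ‖y - x‖ ≤ γ → |M.lagr μ y - M.lagr μ x| ≤ ξ * ‖y - x‖ ∧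
        ‖gradient (M.lagr μ) y - gradient (M.lagr μ) x‖ ≤ β * ‖y - x‖ := by
    intro K hK hKS
    obtain ⟨ξ, β, γ, h1, h2, h3, h⟩ := exists_lipschitz_constants isOpen_stab hK hKS
      (f := M.lagrForm μ) fun x hx => (contDiffAt_lagrForm μ hx).of_le le_top
    refine ⟨ξ, β, γ, h1, h2, h3, fun x hx y hy hxy => ?_⟩
    rw [lagr_eq hM hy, lagr_eq hM (hKS hx), gradient_lagr hM hy, gradient_lagr hM (hKS hx)]
    exact h x hx y hxy
  obtain ⟨ξ₀, β₀, γ₀, h1, h2, h3, h⟩ := hloc _ (isCompact_sub10 hM hμ X₀) (sub10_subset μ X₀)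
  have hpt : ∀ X : Policy n m, ∃ ξ β γ : ℝ, X ∈ M.stab → 0 < ξ ∧ 0 < β ∧
      0 < γ ∧ ∀ y ∈ M.stab, ‖y - X‖ ≤ γ → |M.lagr μ y - M.lagr μ X| ≤ ξ * ‖y - X‖ ∧
        ‖gradient (M.lagr μ) y - gradient (M.lagr μ) X‖ ≤ β * ‖y - X‖ := by
    intro X
    by_cases hX : X ∈ M.stab
    · obtain ⟨ξ, β, γ, h1, h2, h3, h⟩ := hloc {X} isCompact_singleton
        (Set.singleton_subset_iff.mpr hX)
      exact ⟨ξ, β, γ, fun _ => ⟨h1, h2, h3, h X rfl⟩⟩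
    · exact ⟨0, 0, 0, fun h => absurd h hX⟩
  choose ξ β γ hpt using hpt
  have hne : (M.sub10 μ X₀).Nonempty := ⟨X₀, mem_sub10_self hM hμ hX₀⟩
  have himg : ∀ (φ : Policy n m → ℝ) (c : ℝ),
      (fun X => if X ∈ M.sub10 μ X₀ then c else φ X) '' M.sub10 μ X₀ = {c} := by
    intro φ c
    rw [Set.image_congr (g := fun _ => c) fun X hX => if_pos hX, hne.image_const]
  -- The constant functions are constant on the sublevel set, so their suprema and infimum there are
  -- the uniform constants, finite and positive. Elsewhere pointwise constants suffice.
  refine ⟨fun X => if X ∈ M.sub10 μ X₀ then ξ₀ else ξ X,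
    fun X => if X ∈ M.sub10 μ X₀ then β₀ else β X,
    fun X => if X ∈ M.sub10 μ X₀ then γ₀ else γ X, ξ₀, β₀, γ₀, fun X hX => ?_, ?_, ?_, ?_, h3⟩
  · by_cases hX' : X ∈ M.sub10 μ X₀
    · simp only [if_pos hX']
      exact ⟨h1, h2, h3, h X hX'⟩
    · simp only [if_neg hX']
      exact hpt X hX
  · rw [himg]; exact isLUB_singleton
  · rw [himg]; exact isLUB_singleton
  · rw [himg]; exact isGLB_singleton

end Model

end RCLQR

namespace RCLQR

/-! ### Stopped chains with a contracting potential -/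

section StoppedChain

variable {α β : Type*} [MeasurableSpace α] [MeasurableSpace β]

theorem lintegral_chain_prod {step : β → α → β} {z₀ : β} (ν : Measure α) [IsProbabilityMeasure ν]
    (hstep : Measurable fun q : β × α => step q.1 q.2) {f : β × α → ENNReal} (hf : Measurable f)
    (k : ℕ) :
    ∫⁻ ω, f (chain step z₀ ω k, ω k) ∂(Measure.infinitePi fun _ : ℕ => ν) =
      ∫⁻ ω, ∫⁻ w, f (chain step z₀ ω k, w) ∂ν ∂(Measure.infinitePi fun _ : ℕ => ν) := by
  have h1 := measurable_chain (z₀ := z₀) hstep k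
  rw [← lintegral_map hf (h1.prodMk (measurable_pi_apply k)), map_chain_prod ν hstep,
    lintegral_prod _ hf.aemeasurable]
  exact lintegral_map (f := fun z => ∫⁻ w, f (z, w) ∂ν) hf.lintegral_prod_right' h1

/-- The step that stays put once the potential exceeds the level `b`. -/
noncomputable def stoppedStep (step : β → α → β) (V : β → ENNReal) (b : ENNReal)
    (z : β) (w : α) : β :=
  if V z ≤ b then step z w else z

variable {step : β → α → β} {V : β → ENNReal} {b : ENNReal} {z₀ : β}

theorem measurable_stoppedStep (hstep : Measurable fun q : β × α => step q.1 q.2)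
    (hV : Measurable V) : Measurable fun q : β × α => stoppedStep step V b q.1 q.2 :=
  Measurable.ite (measurableSet_le (hV.comp measurable_fst) measurable_const) hstep measurable_fst

/-- Below the level b the expected potential grows by at most c per step; above it the state is
frozen. -/
theorem lintegral_stopped_le (ν : Measure α) [IsProbabilityMeasure ν]
    (hstep : Measurable fun q : β × α => step q.1 q.2) (hV : Measurable V) {c : ENNReal}
    (h : ∀ z, V z ≤ b → ∫⁻ w, V (step z w) ∂ν ≤ V z + c) (k : ℕ) :
    ∫⁻ ω, V (chain (stoppedStep step V b) z₀ ω k) ∂(Measure.infinitePi fun _ : ℕ => ν) ≤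
      V z₀ + k * c := by
  have hm := measurable_stoppedStep (b := b) hstep hV
  induction k with
  | zero => simp [chain]
  | succ k ih =>
    have h1 := lintegral_chain_prod (z₀ := z₀) ν hm
      (f := fun q => V (stoppedStep step V b q.1 q.2)) (hV.comp hm) k
    simp only [chain]
    rw [h1]
    refine (lintegral_mono (g := fun ω => V (chain (stoppedStep step V b) z₀ ω k) + c)
      fun ω => ?_).trans ?_
    · simp only [stoppedStep]
      split_ifs with hz
      · exact h _ hz
      · simp
    · rw [lintegral_add_right _ measurable_const]
      refine (add_le_add_left ih _).trans ?_
      rw [lintegral_const, measure_univ, mul_one]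
      push_cast
      rw [add_mul, one_mul, add_assoc]

/-- A frozen state stays frozen, so being below b at time k + 1 implies the same at time k. The
expectations restricted to this event thus contract by q up to c at each step, and the condition on
s absorbs the accumulated drift. The restriction concerns time k only: the last step may land
anywhere. -/
theorem lintegral_stopped_succ_le (ν : Measure α) [IsProbabilityMeasure ν]
    (hstep : Measurable fun q : β × α => step q.1 q.2) (hV : Measurable V) {c q s : ENNReal}
    (h : ∀ z, V z ≤ b → ∫⁻ w, V (step z w) ∂ν ≤ q * V z + c) (hs : q * s + c ≤ s) (k : ℕ) :
    ∫⁻ ω, (if V (chain (stoppedStep step V b) z₀ ω k) ≤ b then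
        V (chain (stoppedStep step V b) z₀ ω (k + 1)) else 0)
        ∂(Measure.infinitePi fun _ : ℕ => ν) ≤ q ^ (k + 1) * V z₀ + s := by
  have hm := measurable_stoppedStep (b := b) hstep hV
  have hmk : ∀ k, Measurable fun ω => V (chain (stoppedStep step V b) z₀ ω k) :=
    fun k => hV.comp (measurable_chain (z₀ := z₀) hm k)
  have hstp : ∀ k, ∫⁻ ω, (if V (chain (stoppedStep step V b) z₀ ω k) ≤ b then
        V (chain (stoppedStep step V b) z₀ ω (k + 1)) else 0)
        ∂(Measure.infinitePi fun _ : ℕ => ν) ≤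
      q * ∫⁻ ω, (if V (chain (stoppedStep step V b) z₀ ω k) ≤ b then
        V (chain (stoppedStep step V b) z₀ ω k) else 0)
        ∂(Measure.infinitePi fun _ : ℕ => ν) + c := by
    intro k
    have h1 := lintegral_chain_prod (z₀ := z₀) ν hm
      (f := fun p => if V p.1 ≤ b then V (stoppedStep step V b p.1 p.2) else 0)
      (Measurable.ite (measurableSet_le (hV.comp measurable_fst) measurable_const) (hV.comp hm)
        measurable_const) k
    simp only [chain]
    rw [h1, ← lintegral_const_mul _ (Measurable.ite (measurableSet_le (hmk k) measurable_const)
      (hmk k) measurable_const)]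
    have h2 : c = ∫⁻ _ω : ℕ → α, c ∂(Measure.infinitePi fun _ : ℕ => ν) := by simp
    conv_rhs => rw [h2]
    rw [← lintegral_add_right _ measurable_const]
    refine lintegral_mono fun ω => ?_
    simp only [stoppedStep]
    split_ifs with hz
    · exact h _ hz
    · simp
  have hA : ∀ k, ∫⁻ ω, (if V (chain (stoppedStep step V b) z₀ ω k) ≤ b then
        V (chain (stoppedStep step V b) z₀ ω k) else 0)
        ∂(Measure.infinitePi fun _ : ℕ => ν) ≤ q ^ k * V z₀ + s := by
    intro k
    induction k with
    | zero =>
      refine (lintegral_mono (g := fun _ => V z₀) fun ω => ?_).trans ?_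
      · change (if V z₀ ≤ b then V z₀ else 0) ≤ V z₀
        split_ifs
        · exact le_refl _
        · exact bot_le
      · simp
    | succ k ih =>
      refine (lintegral_mono (g := fun ω => if V (chain (stoppedStep step V b) z₀ ω k) ≤ b then
        V (chain (stoppedStep step V b) z₀ ω (k + 1)) else 0) fun ω => ?_).trans ((hstp k).trans ((add_le_add_left
        (mul_le_mul_right ih q) c).trans ?_))
      · dsimp only
        by_cases hz : V (chain (stoppedStep step V b) z₀ ω k) ≤ b
        · rw [if_pos hz]
          split_ifs
          · exact le_refl _
          · exact bot_le
        · have : chain (stoppedStep step V b) z₀ ω (k + 1) =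
              chain (stoppedStep step V b) z₀ ω k := by
            simp only [chain]
            rw [stoppedStep, if_neg hz]
          rw [if_neg hz, this, if_neg hz]
      · rw [mul_add, add_assoc, pow_succ', mul_assoc]
        exact add_le_add_right hs _
  refine (hstp k).trans ((add_le_add_left (mul_le_mul_right (hA k) q) c).trans ?_)
  rw [mul_add, add_assoc, pow_succ', mul_assoc]
  exact add_le_add_right hs _

/-- A potential that contracts in expectation up to a drift is small with high probability. -/
theorem measure_stopped_compl_le (ν : Measure α) [IsProbabilityMeasure ν]
    (hstep : Measurable fun q : β × α => step q.1 q.2) (hV : Measurable V) {c q s e : ENNReal}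
    (hq : q ≤ 1) (hb : b ≠ 0) (hb' : b ≠ ⊤) (he : e ≠ 0) (he' : e ≠ ⊤)
    (h : ∀ z, V z ≤ b → ∫⁻ w, V (step z w) ∂ν ≤ q * V z + c) (hs : q * s + c ≤ s) (k : ℕ) :
    (Measure.infinitePi fun _ : ℕ => ν) {ω | ¬(V (chain (stoppedStep step V b) z₀ ω k) ≤ b ∧
      V (chain (stoppedStep step V b) z₀ ω (k + 1)) ≤ e)} ≤
      (V z₀ + k * c) / b + (q ^ (k + 1) * V z₀ + s) / e := by
  have hm := measurable_stoppedStep (b := b) hstep hV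
  have hmk : ∀ k, Measurable fun ω => V (chain (stoppedStep step V b) z₀ ω k) :=
    fun k => hV.comp (measurable_chain (z₀ := z₀) hm k)
  have h1 : ∀ z, V z ≤ b → ∫⁻ w, V (step z w) ∂ν ≤ V z + c := fun z hz =>
    (h z hz).trans (add_le_add_left (mul_le_of_le_one_left' hq) c)
  -- Failure means that the chain exceeded b by time k, or that it had not and the last step ended
  -- above e. Markov's inequality bounds each event.
  have hsub : {ω | ¬(V (chain (stoppedStep step V b) z₀ ω k) ≤ b ∧
      V (chain (stoppedStep step V b) z₀ ω (k + 1)) ≤ e)} ⊆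
      {ω | b ≤ V (chain (stoppedStep step V b) z₀ ω k)} ∪
      {ω | e ≤ if V (chain (stoppedStep step V b) z₀ ω k) ≤ b then
        V (chain (stoppedStep step V b) z₀ ω (k + 1)) else 0} := by
    intro ω hω
    by_cases hz : V (chain (stoppedStep step V b) z₀ ω k) ≤ b
    · right
      simp only [Set.mem_ofPred_eq, hz, true_and, not_le] at hω ⊢
      rw [if_pos trivial]
      exact hω.le
    · left
      exact (not_le.mp hz).le
  refine (measure_mono hsub).trans ((measure_union_le _ _).trans (add_le_add ?_ ?_))
  · refine (meas_ge_le_lintegral_div (hmk k).aemeasurable hb hb').trans ?_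
    exact ENNReal.div_le_div_right (lintegral_stopped_le ν hstep hV h1 k) _
  · refine (meas_ge_le_lintegral_div (Measurable.ite (measurableSet_le (hmk k) measurable_const)
      (hmk (k + 1)) measurable_const).aemeasurable he he').trans ?_
    exact ENNReal.div_le_div_right (lintegral_stopped_succ_le ν hstep hV h hs k) _

end StoppedChain

/-! ### The descent inequality -/

section Descent

variable {E : Type*} [NormedAddCommGroup E] [InnerProductSpace ℝ E] [CompleteSpace E]

/-- The descent inequality under a pointed Lipschitz bound of the gradient. -/
theorem le_of_norm_gradient_sub_le {f : E → ℝ} {x y : E} {β : ℝ}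
    (hf : ∀ z, ‖z - x‖ ≤ ‖y - x‖ → DifferentiableAt ℝ f z)
    (hβ : ∀ z, ‖z - x‖ ≤ ‖y - x‖ → ‖gradient f z - gradient f x‖ ≤ β * ‖z - x‖) :
    f y ≤ f x + inner ℝ (gradient f x) (y - x) + β / 2 * ‖y - x‖ ^ 2 := by
  set v := y - x with hv
  have hz : ∀ t ∈ Set.Icc (0 : ℝ) 1, ‖(x + t • v) - x‖ = t * ‖v‖ := fun t ht => by
    rw [add_sub_cancel_left, norm_smul, Real.norm_eq_abs, abs_of_nonneg ht.1]
  have hz' : ∀ t ∈ Set.Icc (0 : ℝ) 1, ‖(x + t • v) - x‖ ≤ ‖v‖ := fun t ht => by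
    rw [hz t ht]
    exact mul_le_of_le_one_left (norm_nonneg _) ht.2
  have hd : ∀ t ∈ Set.Icc (0 : ℝ) 1, HasDerivAt (fun t : ℝ => f (x + t • v) -
      t * inner ℝ (gradient f x) v - β / 2 * t ^ 2 * ‖v‖ ^ 2)
      (inner ℝ (gradient f (x + t • v)) v - inner ℝ (gradient f x) v - β * t * ‖v‖ ^ 2) t := by
    intro t ht
    have h1 : HasDerivAt (fun t : ℝ => x + t • v) v t := by
      simpa using ((hasDerivAt_id t).smul_const v).const_add x
    have h2 := (hf _ (hz' t ht)).hasGradientAt.hasFDerivAt.comp_hasDerivAt t h1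
    have h3 := (hasDerivAt_id t).mul_const (inner ℝ (gradient f x) v)
    have h4 := (((hasDerivAt_pow 2 t).const_mul (β / 2)).mul_const (‖v‖ ^ 2))
    have h5 := (h2.sub h3).sub h4
    refine h5.congr_deriv ?_
    simp only [InnerProductSpace.toDual_apply_apply]
    push_cast
    ring
  -- Along the segment, the difference between f and its quadratic upper model is decreasing. Only
  -- gradient comparisons with the base point x are needed.
  have hanti : AntitoneOn (fun t : ℝ => f (x + t • v) -
      t * inner ℝ (gradient f x) v - β / 2 * t ^ 2 * ‖v‖ ^ 2) (Set.Icc 0 1) := by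
    refine antitoneOn_of_deriv_nonpos (convex_Icc 0 1)
      (fun t ht => (hd t ht).continuousAt.continuousWithinAt) ?_ ?_
    · exact fun t ht => (hd t (interior_subset ht)).differentiableAt.differentiableWithinAt
    · intro t ht
      have ht' := interior_subset ht
      rw [(hd t ht').deriv, ← inner_sub_left]
      have h6 := real_inner_le_norm (gradient f (x + t • v) - gradient f x) v
      have h7 := mul_le_mul_of_nonneg_right (hβ _ (hz' t ht')) (norm_nonneg v)
      rw [hz t ht'] at h7
      nlinarith
  have h8 := hanti (Set.left_mem_Icc.mpr zero_le_one) (Set.right_mem_Icc.mpr zero_le_one)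
    zero_le_one
  simp only [one_smul, zero_smul, add_zero, one_mul, one_pow, zero_mul, mul_one, sub_zero, ne_eq,
    OfNat.ofNat_ne_zero, not_false_eq_true, zero_pow, mul_zero] at h8
  rw [hv, add_sub_cancel, ← hv] at h8
  linarith

end Descent

end RCLQR

namespace RCLQR

/-! ### Local bounds and the exact form of the gradient estimate -/

namespace Model

variable {n m : ℕ} {M : Model n m}

/-- A closed ball on which the Lagrangian stays bounded as long as the policy is stabilizing
consists of stabilizing policies. -/
theorem closedBall_subset_stab (hM : M.Standing) {μ : ℝ} (hμ : 0 ≤ μ) {X : Policy n m}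
    (hX : X ∈ M.stab) {ξ γ : ℝ} (hξ : 0 ≤ ξ) (hγ : 0 ≤ γ)
    (h : ∀ Y ∈ M.stab, ‖Y - X‖ ≤ γ → |M.lagrForm μ Y - M.lagrForm μ X| ≤ ξ * ‖Y - X‖) :
    Metric.closedBall X γ ⊆ M.stab := by
  set K := {Y | Y ∈ M.stab ∧ M.lagrForm μ Y ≤ M.lagrForm μ X + ξ * γ} with hK
  have hKc : IsClosed K := (isCompact_sublevel hM hμ _).isClosed
  -- The ball is connected and covered by two disjoint closed sets: a compact sublevel set, which
  -- contains X, and the policies that do not stabilize.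
  have hcov : Metric.closedBall X γ ⊆ K ∪ M.stabᶜ := by
    intro Y hY
    rw [mem_closedBall_iff_norm] at hY
    by_cases hs : Y ∈ M.stab
    · left
      refine ⟨hs, ?_⟩
      have := (le_abs_self _).trans (h Y hs hY)
      nlinarith [mul_le_mul_of_nonneg_left hY hξ]
    · exact Or.inr hs
  by_contra hne
  rw [Set.not_subset] at hne
  obtain ⟨Y, hY, hYs⟩ := hne
  obtain ⟨Z, -, hZ1, hZ2⟩ := isPreconnected_closed_iff.mp
    (convex_closedBall X γ).isPreconnected K M.stabᶜ hKc isOpen_stab.isClosed_compl hcov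
    ⟨X, Metric.mem_closedBall_self hγ, hX, by nlinarith [mul_nonneg hξ hγ]⟩ ⟨Y, hY, hYs⟩
  exact hZ2 hZ1.1

/-- Uniform local bounds of the Lagrangian and its gradient around the sublevel set. -/
def LocalBounds (M : Model n m) (μ : ℝ) (X₀ : Policy n m) (ξ₀ β₀ γ₀ : ℝ) : Prop :=
  ∀ X ∈ M.sub10 μ X₀, ∀ Y, ‖Y - X‖ ≤ γ₀ → Y ∈ M.stab ∧
    |M.lagrForm μ Y - M.lagrForm μ X| ≤ ξ₀ * ‖Y - X‖ ∧
    ‖gradient (M.lagrForm μ) Y - gradient (M.lagrForm μ) X‖ ≤ β₀ * ‖Y - X‖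

/-- The given constants speak only of stabilizing neighbours. The connectedness argument makes the
whole ball stabilizing, so steps and perturbations of length at most γ₀ are always admissible. -/
theorem LocalLipschitz.localBounds (hM : M.Standing) {μ : ℝ} (hμ : 0 ≤ μ) {X₀ : Policy n m}
    (hX₀ : X₀ ∈ M.stab) {ξ β γ : Policy n m → ℝ} {ξ₀ β₀ γ₀ : ℝ}
    (h : M.LocalLipschitz μ ξ β γ) (hξ : IsLUB (ξ '' M.sub10 μ X₀) ξ₀)
    (hβ : IsLUB (β '' M.sub10 μ X₀) β₀) (hγ : IsGLB (γ '' M.sub10 μ X₀) γ₀) :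
    0 < ξ₀ ∧ 0 < β₀ ∧ M.LocalBounds μ X₀ ξ₀ β₀ γ₀ := by
  have hmem := mem_sub10_self hM hμ hX₀
  obtain ⟨h1, h2, -, -⟩ := h X₀ hX₀
  refine ⟨h1.trans_le (hξ.1 ⟨X₀, hmem, rfl⟩), h2.trans_le (hβ.1 ⟨X₀, hmem, rfl⟩), ?_⟩
  intro X hX Y hY
  obtain ⟨k1, k2, k3, k4⟩ := h X hX.1
  have hYγ : ‖Y - X‖ ≤ γ X := hY.trans (hγ.1 ⟨X, hX, rfl⟩)
  have hsub : Metric.closedBall X (γ X) ⊆ M.stab := by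
    refine closedBall_subset_stab hM hμ hX.1 k1.le k3.le fun Z hZ hZX => ?_
    rw [← lagr_eq hM hZ, ← lagr_eq hM hX.1]
    exact (k4 Z hZ hZX).1
  have hYs : Y ∈ M.stab := hsub (by rwa [mem_closedBall_iff_norm])
  have := k4 Y hYs hYγ
  rw [lagr_eq hM hYs, lagr_eq hM hX.1, gradient_lagr hM hYs, gradient_lagr hM hX.1] at this
  refine ⟨hYs, this.1.trans ?_, this.2.trans ?_⟩
  · exact mul_le_mul_of_nonneg_right (hξ.1 ⟨X, hX, rfl⟩) (norm_nonneg _)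
  · exact mul_le_mul_of_nonneg_right (hβ.1 ⟨X, hX, rfl⟩) (norm_nonneg _)

/-- The closed form of the Lagrangian, extended by zero off the stabilizing policies. -/
noncomputable def lagrExt (M : Model n m) (μ : ℝ) : Policy n m → ℝ :=
  M.stab.indicator (M.lagrForm μ)

theorem lagrExt_eq {X : Policy n m} (hX : X ∈ M.stab) (μ : ℝ) :
    M.lagrExt μ X = M.lagrForm μ X := Set.indicator_of_mem hX _

theorem measurable_lagrExt (M : Model n m) (μ : ℝ) : Measurable (M.lagrExt μ) := by
  classical
  have h : ContinuousOn (M.lagrForm μ) M.stab := fun X hX =>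
    (contDiffAt_lagrForm μ hX).continuousAt.continuousWithinAt
  rw [lagrExt, ← Set.piecewise_eq_indicator]
  exact h.measurable_piecewise continuousOn_const isOpen_stab.measurableSet

/-- The pairs of a policy and a trajectory for which the averages of the stage cost converge to the
Lagrangian. -/
def regularPaths (M : Model n m) (μ : ℝ) : Set (Policy n m × Path n) :=
  {q | Tendsto (fun T : ℕ => (T : ℝ)⁻¹ * ∑ t ∈ Finset.range T,
    M.stageCost μ (M.state q.1 q.2 t) (input q.1 (M.state q.1 q.2 t))) atTop
    (𝓝 (M.lagrExt μ q.1))}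

theorem measurableSet_regularPaths (M : Model n m) (μ : ℝ) :
    MeasurableSet (M.regularPaths μ) := by
  have hg : Measurable fun q : Policy n m × Path n => M.lagrExt μ q.1 :=
    (M.measurable_lagrExt μ).comp measurable_fst
  exact measurableSet_tendsto_fun (l := atTop)
    (fun T => M.measurable_average_quadCost (M.Qmu μ) (M.Svec μ) M.R (μ * M.tolBar) T) hg

theorem oracle_eq {μ : ℝ} {X : Policy n m} {ω : Path n} (h : (X, ω) ∈ M.regularPaths μ) :
    M.oracle μ X ω = M.lagrExt μ X := Tendsto.limUnder_eq h

theorem ae_mem_regularPaths (hM : M.Standing) {X : Policy n m} (hX : X ∈ M.stab) (μ : ℝ) :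
    ∀ᵐ ω ∂M.pathLaw, (X, ω) ∈ M.regularPaths μ := by
  filter_upwards [ae_tendsto_stageCost hM hX μ] with ω hω
  rw [← lagrExt_eq hX] at hω
  exact hω

/-- The gradient estimate with an exact oracle. -/
noncomputable def exactEst (M : Model n m) (μ r : ℝ) (X : Policy n m)
    (U : Metric.sphere (0 : Policy n m) 1) : Policy n m :=
  (((m * (n + 1) : ℕ) : ℝ) / r * M.lagrExt μ (X + r • (U : Policy n m))) • (U : Policy n m)

theorem measurable_exactEst (M : Model n m) (μ r : ℝ) :
    Measurable fun q : Policy n m × Metric.sphere (0 : Policy n m) 1 =>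
      M.exactEst μ r q.1 q.2 := by
  have h1 : Measurable fun q : Policy n m × Metric.sphere (0 : Policy n m) 1 =>
      (q.2 : Policy n m) := measurable_subtype_coe.comp measurable_snd
  have h2 := (M.measurable_lagrExt μ).comp (measurable_fst.add (h1.const_smul r))
  exact (h2.const_mul _).smul h1

theorem gradEst_eq {μ r : ℝ} {X : Policy n m} {d : Draw n m}
    (h : (X + r • (d.1 : Policy n m), d.2) ∈ M.regularPaths μ) :
    M.gradEst μ r X d = M.exactEst μ r X d.1 := by
  rw [gradEst, oracle_eq h, exactEst]

instance isFiniteMeasure_sphereUniform : IsFiniteMeasure (sphereUniform n m) := by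
  unfold sphereUniform
  infer_instance

theorem isProbabilityMeasure_sphereUniform (hm : 0 < m) :
    IsProbabilityMeasure (sphereUniform n m) := by
  have : Nonempty (Fin m) := ⟨⟨0, hm⟩⟩
  refine ProbabilityTheory.cond_isProbabilityMeasure ?_
  rw [Measure.toSphere_apply_univ]
  refine mul_ne_zero ?_ (Metric.measure_ball_pos _ _ one_pos).ne'
  simp [hm.ne']

/-- For each direction almost every trajectory is regular. Measurability of the set of regular pairs
passes this through Fubini to the joint draw. -/
theorem ae_drawLaw_mem_regularPaths (hM : M.Standing) (μ : ℝ) {r : ℝ} {X : Policy n m}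
    (h : ∀ U : Policy n m, ‖U‖ = 1 → X + r • U ∈ M.stab) :
    ∀ᵐ d ∂M.drawLaw, (X + r • (d.1 : Policy n m), d.2) ∈ M.regularPaths μ := by
  have := isProbabilityMeasure_pathLaw hM
  have hmeas : Measurable fun d : Draw n m => (X + r • (d.1 : Policy n m), d.2) :=
    (((measurable_subtype_coe.comp measurable_fst).const_smul r).const_add X).prodMk measurable_snd
  have hms : MeasurableSet {d : Draw n m | (X + r • (d.1 : Policy n m), d.2) ∈ M.regularPaths μ} :=
    hmeas (M.measurableSet_regularPaths μ)
  rw [drawLaw, Measure.ae_prod_iff_ae_ae hms]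
  exact ae_of_all _ fun U => ae_mem_regularPaths hM (h U (by simp)) μ

theorem LocalBounds.add_smul_mem {μ : ℝ} {X₀ : Policy n m} {ξ₀ β₀ γ₀ r : ℝ}
    (h : M.LocalBounds μ X₀ ξ₀ β₀ γ₀) (hr : 0 < r) (hrγ : r ≤ γ₀) {X : Policy n m}
    (hX : X ∈ M.sub10 μ X₀) {U : Policy n m} (hU : ‖U‖ = 1) : X + r • U ∈ M.stab :=
  (h X hX _ (by
    rw [add_sub_cancel_left, norm_smul, hU, mul_one, Real.norm_eq_abs, abs_of_pos hr]
    exact hrγ)).1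

theorem LocalBounds.ae_gradEst (hM : M.Standing) {μ : ℝ} {X₀ : Policy n m} {ξ₀ β₀ γ₀ r : ℝ}
    (h : M.LocalBounds μ X₀ ξ₀ β₀ γ₀) (hr : 0 < r) (hrγ : r ≤ γ₀) {X : Policy n m}
    (hX : X ∈ M.sub10 μ X₀) :
    ∀ᵐ d ∂M.drawLaw, M.gradEst μ r X d = M.exactEst μ r X d.1 :=
  (ae_drawLaw_mem_regularPaths hM μ fun _ hU => h.add_smul_mem hr hrγ hX hU).mono
    fun _ hd => gradEst_eq hd

/-- Compactness bounds the Lagrangian on the sublevel set, and the local Lipschitz bound carries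
this to the perturbed policies at distance r. -/
theorem LocalBounds.exists_norm_exactEst_le (hM : M.Standing) {μ : ℝ} (hμ : 0 ≤ μ)
    {X₀ : Policy n m} {ξ₀ β₀ γ₀ r : ℝ}
    (h : M.LocalBounds μ X₀ ξ₀ β₀ γ₀) (hr : 0 < r) (hrγ : r ≤ γ₀) :
    ∃ C : ℝ, 0 ≤ C ∧ ∀ X ∈ M.sub10 μ X₀, ∀ U, ‖M.exactEst μ r X U‖ ≤ C := by
  obtain ⟨B, hB⟩ := (isCompact_sub10 hM hμ X₀).exists_bound_of_continuousOn (f := M.lagrForm μ)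
    fun X hX => (contDiffAt_lagrForm μ hX.1).continuousAt.continuousWithinAt
  refine ⟨((m * (n + 1) : ℕ) : ℝ) / r * |B + ξ₀ * r|, by positivity, fun X hX U => ?_⟩
  have hU : ‖(U : Policy n m)‖ = 1 := by simp
  have hmem := h.add_smul_mem hr hrγ hX hU
  rw [exactEst, norm_smul, hU, mul_one, norm_mul, Real.norm_of_nonneg (by positivity),
    lagrExt_eq hmem]
  refine mul_le_mul_of_nonneg_left (le_trans ?_ (le_abs_self _)) (by positivity)
  have hn : ‖X + r • (U : Policy n m) - X‖ = r := by
    rw [add_sub_cancel_left, norm_smul, hU, mul_one, Real.norm_eq_abs, abs_of_pos hr]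
  have h1 := (h X hX (X + r • (U : Policy n m)) (by rw [hn]; exact hrγ)).2.1
  rw [hn] at h1
  have h2 := hB X hX
  rw [Real.norm_eq_abs] at h2 ⊢
  have h3 := abs_sub_abs_le_abs_sub (M.lagrForm μ (X + r • (U : Policy n m))) (M.lagrForm μ X)
  linarith

theorem LocalBounds.norm_bounds_finite (hM : M.Standing) {μ : ℝ} (hμ : 0 ≤ μ)
    {X₀ : Policy n m} {ξ₀ β₀ γ₀ r : ℝ}
    (h : M.LocalBounds μ X₀ ξ₀ β₀ γ₀) (hr : 0 < r) (hrγ : r ≤ γ₀) :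
    M.Ginf μ r X₀ < ⊤ ∧ M.G2 μ r X₀ < ⊤ := by
  have := isProbabilityMeasure_pathLaw hM
  have hfin : IsFiniteMeasure M.drawLaw := by unfold drawLaw; infer_instance
  obtain ⟨C, hC, hb⟩ := h.exists_norm_exactEst_le hM hμ hr hrγ
  have hae : ∀ X ∈ M.sub10 μ X₀, ∀ᵐ d ∂M.drawLaw, ‖M.gradEst μ r X d‖ ≤ C := fun X hX =>
    (h.ae_gradEst hM hr hrγ hX).mono fun d hd => by rw [hd]; exact hb X hX d.1
  have henn : ∀ {x : Policy n m} {c : ℝ}, ‖x‖ ≤ c → ‖x‖ₑ ≤ ENNReal.ofReal c := fun {x c} hx => by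
    rw [← ofReal_norm]
    exact ENNReal.ofReal_le_ofReal hx
  constructor
  · refine lt_of_le_of_lt (iSup₂_le fun X hX => essSup_le_of_ae_le (ENNReal.ofReal C) ?_)
      ENNReal.ofReal_lt_top
    exact (hae X hX).mono fun d hd => henn hd
  · refine lt_of_le_of_lt (b := ENNReal.ofReal (C + C * M.drawLaw.real Set.univ) ^ 2 *
      M.drawLaw Set.univ) (iSup₂_le fun X hX => ?_)
      (ENNReal.mul_lt_top (ENNReal.pow_lt_top ENNReal.ofReal_lt_top) (measure_lt_top _ _))
    rw [← lintegral_const]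
    refine lintegral_mono_ae ((hae X hX).mono fun d hd => ?_)
    gcongr
    exact henn ((norm_sub_le _ _).trans (add_le_add hd (norm_integral_le_of_norm_le_const
      (hae X hX))))

end Model

end RCLQR

namespace RCLQR

theorem integral_sphereUniform {n m : ℕ} {F : Type*} [NormedAddCommGroup F] [NormedSpace ℝ F]
    (f : Metric.sphere (0 : Policy n m) 1 → F) : ∫ U, f U ∂(sphereUniform n m) =
      ((volume : Measure (Policy n m)).toSphere.real Set.univ)⁻¹ •
        ∫ U, f U ∂(volume : Measure (Policy n m)).toSphere := by
  rw [sphereUniform, ProbabilityTheory.cond, integral_smul_measure, Measure.restrict_univ,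
    ENNReal.toReal_inv, measureReal_def]

/-! ### Bias, potential and the one-step contraction -/

namespace Model

variable {n m : ℕ} {M : Model n m} {μ ξ₀ β₀ γ₀ r : ℝ} {X₀ X : Policy n m}

theorem measurable_exactEst_right (M : Model n m) (μ r : ℝ) (X : Policy n m) :
    Measurable (M.exactEst μ r X) := by
  have h := (M.measurable_exactEst μ r).comp
    (measurable_prodMk_left (β := Metric.sphere (0 : Policy n m) 1) (x := X))
  simpa only [Function.comp_def] using h

theorem LocalBounds.memLp_exactEst (hM : M.Standing) (hμ : 0 ≤ μ)
    (h : M.LocalBounds μ X₀ ξ₀ β₀ γ₀) (hr : 0 < r) (hrγ : r ≤ γ₀) (hX : X ∈ M.sub10 μ X₀) :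
    MemLp (M.exactEst μ r X) 2 (sphereUniform n m) := by
  obtain ⟨C, -, hb⟩ := h.exists_norm_exactEst_le hM hμ hr hrγ
  exact MemLp.of_bound (M.measurable_exactEst_right μ r X).aestronglyMeasurable C
    (ae_of_all _ fun U => hb X hX U)

/-- The bias of the one-point estimate. -/
theorem LocalBounds.norm_integral_exactEst_sub_le (hM : M.Standing) (hμ : 0 ≤ μ) (hm : 0 < m)
    (h : M.LocalBounds μ X₀ ξ₀ β₀ γ₀) (hβ : 0 ≤ β₀) (hr : 0 < r) (hrγ : r ≤ γ₀)
    (hX : X ∈ M.sub10 μ X₀) :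
    ‖∫ U, M.exactEst μ r X U ∂(sphereUniform n m) - gradient (M.lagrForm μ) X‖ ≤ β₀ * r := by
  have hprob := isProbabilityMeasure_sphereUniform (n := n) hm
  have hint := (h.memLp_exactEst hM hμ hr hrγ hX).integrable one_le_two
  set g := ∫ U, M.exactEst μ r X U ∂(sphereUniform n m) with hg
  have hdim : Module.finrank ℝ (Policy n m) = m * (n + 1) := by simp
  have hdim0 : 0 < Module.finrank ℝ (Policy n m) := by rw [hdim]; positivity
  have hγ0 : 0 ≤ γ₀ := hr.le.trans hrγ
  -- Radius r = γ₀ is allowed, whereas the spherical estimate needs smoothness on a strictly larger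
  -- open ball; compactness provides the margin.
  obtain ⟨δ, hδ, hδs⟩ := (isCompact_closedBall X γ₀).exists_thickening_subset_open
    (isOpen_stab (M := M)) fun Y hY => (h X hX Y (by rwa [← mem_closedBall_iff_norm])).1
  rw [thickening_closedBall hδ hγ0] at hδs
  have hmem : ∀ z ∈ Metric.ball (0 : Policy n m) (δ + γ₀), X + z ∈ M.stab := fun z hz =>
    hδs (by rw [mem_ball_iff_norm, add_sub_cancel_left]; simpa using hz)
  have hsm : ∀ z ∈ Metric.ball (0 : Policy n m) (δ + γ₀),
      ContDiffAt ℝ ⊤ (M.lagrForm μ) (X + z) := fun z hz => contDiffAt_lagrForm μ (hmem z hz)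
  have key := fun v => abs_sphere_moment_sub_le (E := Policy n m) (h := fun z => M.lagrForm μ (X + z))
    (h' := fun z => fderiv ℝ (M.lagrForm μ) (X + z)) (ρ := δ + γ₀) (β := β₀) hr (by linarith)
    (fun z hz => by
      have h1 := ((hsm z hz).differentiableAt (by simp)).hasFDerivAt
      have h2 : HasFDerivAt (fun z => X + z) (ContinuousLinearMap.id ℝ (Policy n m)) z :=
        (hasFDerivAt_id z).const_add X
      exact (h1.comp z h2).congr_fderiv (ContinuousLinearMap.comp_id _))
    (fun z hz => by
      have h1 : ContDiffAt ℝ 0 (fderiv ℝ (M.lagrForm μ)) (X + z) :=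
        (hsm z hz).fderiv_right (m := 0) (by simp)
      exact ContinuousAt.continuousWithinAt (ContinuousAt.comp (f := fun z => X + z)
        h1.continuousAt (by fun_prop)))
    hdim0 hβ
    (fun z hz => by
      have h1 := (h X hX (X + z) (by rw [add_sub_cancel_left]; exact hz.trans hrγ)).2.2
      rw [norm_gradient_sub, add_sub_cancel_left] at h1
      simpa using h1) v
  set σ := (volume : Measure (Policy n m)).toSphere with hσ
  have hσ0 : 0 < σ.real Set.univ := by
    rw [hσ, Measure.toSphere_real_apply_univ]
    exact mul_pos (by exact_mod_cast hdim0)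
      (ENNReal.toReal_pos (Metric.measure_ball_pos _ _ one_pos).ne' measure_ball_lt_top.ne)
  have hv : ∀ v : Policy n m, |inner ℝ v (g - gradient (M.lagrForm μ) X)| ≤ β₀ * r * ‖v‖ := by
    intro v
    have h1 : inner ℝ v g = (σ.real Set.univ)⁻¹ * ((Module.finrank ℝ (Policy n m) : ℝ) / r *
        ∫ u : Metric.sphere (0 : Policy n m) 1, M.lagrForm μ (X + r • (u : Policy n m)) *
          inner ℝ v (u : Policy n m) ∂σ) := by
      have e : ∀ U : Metric.sphere (0 : Policy n m) 1, inner ℝ v (M.exactEst μ r X U) =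
          (Module.finrank ℝ (Policy n m) : ℝ) / r *
            (M.lagrForm μ (X + r • (U : Policy n m)) * inner ℝ v (U : Policy n m)) := fun U => by
        rw [exactEst, inner_smul_right, lagrExt_eq (h.add_smul_mem hr hrγ hX (by simp)), hdim]
        ring
      rw [hg, ← integral_inner hint]
      simp only [e]
      rw [integral_const_mul, integral_sphereUniform, smul_eq_mul]
      ring
    have h2 : inner ℝ v (gradient (M.lagrForm μ) X) = fderiv ℝ (M.lagrForm μ) X v := by
      rw [real_inner_comm, inner_gradient_lagrForm]
    have h3 := key v
    simp only [add_zero] at h3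
    rw [inner_sub_right, h1, h2]
    have h4 : ∀ a b : ℝ, (σ.real Set.univ)⁻¹ * a - b =
        (σ.real Set.univ)⁻¹ * (a - σ.real Set.univ * b) := fun a b => by
      field_simp
    rw [h4, abs_mul, abs_of_pos (inv_pos.mpr hσ0), inv_mul_le_iff₀ hσ0]
    exact h3
  have h5 := hv (g - gradient (M.lagrForm μ) X)
  rw [real_inner_self_eq_norm_sq, abs_of_nonneg (sq_nonneg _), pow_two] at h5
  by_contra hlt
  rw [not_le] at hlt
  have h6 : 0 ≤ β₀ * r := by positivity
  nlinarith [h6.trans_lt hlt]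

open scoped Classical in
/-- The optimality gap, infinite off the stabilizing policies. -/
noncomputable def potential (M : Model n m) (μ : ℝ) (X : Policy n m) : ENNReal :=
  if X ∈ M.stab then ENNReal.ofReal (M.lagrExt μ X - M.lagrMin μ) else ⊤

theorem measurable_potential (M : Model n m) (μ : ℝ) : Measurable (M.potential μ) := by
  classical
  exact Measurable.ite isOpen_stab.measurableSet
    ((M.measurable_lagrExt μ).sub_const _).ennreal_ofReal measurable_const

theorem potential_eq (hX : X ∈ M.stab) :
    M.potential μ X = ENNReal.ofReal (M.lagrForm μ X - M.lagrMin μ) := by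
  rw [potential, if_pos hX, lagrExt_eq hX]

theorem potential_le_iff {c : ℝ} (hc : 0 ≤ c) : M.potential μ X ≤ ENNReal.ofReal c ↔
    X ∈ M.stab ∧ M.lagrForm μ X - M.lagrMin μ ≤ c := by
  by_cases hX : X ∈ M.stab
  · rw [potential_eq hX, ENNReal.ofReal_le_ofReal_iff hc]
    simp [hX]
  · rw [potential, if_neg hX]
    simp [hX]

/-- The level is 11Δ₀ because the potential is measured from the minimum, while the sublevel set is
measured from the starting value. -/
theorem potential_le_iff_mem_sub10 (hM : M.Standing) (hμ : 0 ≤ μ) (hX₀ : X₀ ∈ M.stab) :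
    M.potential μ X ≤ ENNReal.ofReal (11 * M.gap₀ μ X₀) ↔ X ∈ M.sub10 μ X₀ := by
  rw [potential_le_iff (by linarith [gap₀_nonneg hM hμ hX₀]), sub10_eq hM]
  refine and_congr_right fun _ => ?_
  rw [gap₀]
  constructor <;> intro h <;> linarith

/-- The size of the step relative to the dominance constant is controlled by smoothness. -/
theorem one_le_two_mul_of_gradDominated (hM : M.Standing) (hμ : 0 ≤ μ) (hX₀ : X₀ ∈ M.stab)
    {lam₀ : ℝ} (hdom : M.GradDominated μ (M.sub10 μ X₀) lam₀)
    (h : M.LocalBounds μ X₀ ξ₀ β₀ γ₀) (hβ : 0 < β₀) (hγ : 0 < γ₀) (hgap : 0 < M.gap₀ μ X₀) :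
    1 ≤ 2 * β₀ * lam₀ := by
  obtain ⟨Y, hY, hmin, hYmin⟩ := exists_isMin hM hμ hX₀
  have hgapY : M.lagrForm μ X₀ - M.lagrForm μ Y = M.gap₀ μ X₀ := by
    rw [gap₀, lagr_eq hM hX₀, hYmin]
  have hYsub : Y ∈ M.sub10 μ X₀ := by
    rw [sub10_eq hM]
    refine ⟨hY, ?_⟩
    rw [lagr_eq hM hX₀]
    linarith
  have hne : X₀ - Y ≠ 0 := by
    intro h0
    rw [sub_eq_zero] at h0
    have h1 : M.lagrForm μ X₀ = M.lagrForm μ Y := by rw [h0]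
    linarith
  set c := ‖X₀ - Y‖ with hc
  have hc0 : 0 < c := norm_pos_iff.mpr hne
  -- Points on the segment towards the minimizer have a positive gap but small gradient, so a
  -- gradient step from them stays within γ₀.
  have hpath : Tendsto (fun s : ℝ => Y + s • (X₀ - Y)) (𝓝[>] 0) (𝓝 Y) := by
    have : Continuous fun s : ℝ => Y + s • (X₀ - Y) := by fun_prop
    have h0 := this.tendsto 0
    rw [zero_smul, add_zero] at h0
    exact h0.mono_left nhdsWithin_le_nhds
  have hcont := (contDiffAt_lagrForm μ hY).continuousAt
  have hlt0 : M.lagrForm μ Y < M.lagr μ X₀ + 10 * M.gap₀ μ X₀ := by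
    rw [lagr_eq hM hX₀]
    linarith
  have hev1 : ∀ᶠ Z in 𝓝 Y, Z ∈ M.sub10 μ X₀ := by
    filter_upwards [isOpen_stab.mem_nhds hY, hcont.eventually
      (gt_mem_nhds hlt0)]
      with Z hZ1 hZ2
    rw [sub10_eq hM]
    exact ⟨hZ1, hZ2.le⟩
  have hev2 : ∀ᶠ s : ℝ in 𝓝[>] 0, s * c ≤ γ₀ := by
    have h1 : Tendsto (fun s : ℝ => s * c) (𝓝[>] 0) (𝓝 0) := by
      have : Continuous fun s : ℝ => s * c := by fun_prop
      simpa using (this.tendsto 0).mono_left nhdsWithin_le_nhds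
    exact (h1.eventually (gt_mem_nhds hγ)).mono fun s hs => hs.le
  obtain ⟨s, ⟨hs1, hs2⟩, hs0⟩ := ((hpath.eventually hev1).and hev2).and self_mem_nhdsWithin |>.exists
  set X := Y + s • (X₀ - Y) with hX
  have hXY : ‖X - Y‖ = s * c := by
    rw [hX, add_sub_cancel_left, norm_smul, Real.norm_eq_abs, abs_of_pos hs0]
  have hlt : M.lagrForm μ Y < M.lagrForm μ X := lagrForm_lt_of_ne hM hμ hY hmin hs1.1 (by
    intro h0
    rw [h0, sub_self, norm_zero] at hXY
    exact (mul_pos hs0 hc0).ne hXY)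
  set g := gradient (M.lagrForm μ) X with hg
  have hd := hdom.2 X hs1
  rw [lagr_eq hM hs1.1, gradient_lagr hM hs1.1, hYmin, ← hg] at hd
  have hgβ : ‖g‖ ≤ β₀ * γ₀ := by
    have h1 := (h Y hYsub X (by rw [hXY]; exact hs2)).2.2
    rw [gradient_eq_zero_of_forall_le hY hmin, sub_zero, hXY] at h1
    exact h1.trans (mul_le_mul_of_nonneg_left hs2 hβ.le)
  -- A step of length 1/β₀ decreases the Lagrangian by ‖g‖²/(2β₀), which cannot exceed the gap.
  -- Gradient dominance bounds the gap by λ₀‖g‖², and ‖g‖² cancels.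
  set Z := X - (1 / β₀) • g with hZ
  have hZX : ‖Z - X‖ = ‖g‖ / β₀ := by
    rw [hZ, sub_sub_cancel_left, norm_neg, norm_smul, Real.norm_eq_abs, abs_of_pos (by positivity)]
    ring
  have hZγ : ‖Z - X‖ ≤ γ₀ := by
    rw [hZX, div_le_iff₀ hβ]
    linarith
  have hdesc := le_of_norm_gradient_sub_le (f := M.lagrForm μ) (x := X) (y := Z) (β := β₀)
    (fun z hz => (contDiffAt_lagrForm μ (h X hs1 z (hz.trans hZγ)).1).differentiableAt (by simp))
    (fun z hz => (h X hs1 z (hz.trans hZγ)).2.2)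
  have hZmin := hmin Z (h X hs1 Z hZγ).1
  rw [← hg, hZX] at hdesc
  have hin : inner ℝ g (Z - X) = -(‖g‖ ^ 2 / β₀) := by
    rw [hZ, sub_sub_cancel_left, inner_neg_right, inner_smul_right, real_inner_self_eq_norm_sq]
    ring
  have hq : β₀ / 2 * (‖g‖ / β₀) ^ 2 = ‖g‖ ^ 2 / β₀ / 2 := by
    field_simp
  rw [hin, hq] at hdesc
  have hg0 : 0 < ‖g‖ ^ 2 := by
    by_contra h0
    have : ‖g‖ ^ 2 = 0 := le_antisymm (not_lt.mp h0) (sq_nonneg _)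
    rw [this, mul_zero] at hd
    linarith
  have h2 : ‖g‖ ^ 2 / β₀ / 2 ≤ lam₀ * ‖g‖ ^ 2 := by linarith
  rw [div_div, div_le_iff₀ (by positivity)] at h2
  nlinarith

/-- One step of random search contracts the expected optimality gap up to a drift. -/
theorem LocalBounds.lintegral_potential_step_le (hM : M.Standing) (hμ : 0 ≤ μ) (hm : 0 < m)
    {lam₀ ε η : ℝ} (hdom : M.GradDominated μ (M.sub10 μ X₀) lam₀)
    (h : M.LocalBounds μ X₀ ξ₀ β₀ γ₀) (hβ : 0 < β₀) (hr : 0 < r) (hrγ : r ≤ γ₀) (hη : 0 < η)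
    (hX : X ∈ M.sub10 μ X₀) (hηβ : 2 * β₀ * η ≤ 1)
    (hstep : ∀ᵐ U ∂(sphereUniform n m), η * ‖M.exactEst μ r X U‖ ≤ γ₀)
    (hvar : 240 * lam₀ * β₀ * η * ∫ U, ‖M.exactEst μ r X U -
      ∫ U', M.exactEst μ r X U' ∂(sphereUniform n m)‖ ^ 2 ∂(sphereUniform n m) ≤ ε)
    (hbias : 120 * lam₀ * (β₀ * r) ^ 2 ≤ ε) :
    ∫⁻ U, M.potential μ (X - η • M.exactEst μ r X U) ∂(sphereUniform n m) ≤
      ENNReal.ofReal ((1 - η / (2 * lam₀)) * (M.lagrForm μ X - M.lagrMin μ) +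
        η / (2 * lam₀) * (ε / 80)) := by
  have hprob := isProbabilityMeasure_sphereUniform (n := n) hm
  have hlam := hdom.1
  have hL2 := h.memLp_exactEst hM hμ hr hrγ hX
  have hint := hL2.integrable one_le_two
  set σ := sphereUniform n m with hσ
  set f := M.exactEst μ r X with hf
  set g := ∫ U, f U ∂σ with hg
  set d := gradient (M.lagrForm μ) X with hd
  have hbias' : ‖g - d‖ ≤ β₀ * r := h.norm_integral_exactEst_sub_le hM hμ hm hβ.le hr hrγ hX
  have hsq : Integrable (fun U => ‖f U‖ ^ 2) σ :=
    (memLp_two_iff_integrable_sq_norm hL2.1).mp hL2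
  have hinn : Integrable (fun U => inner ℝ d (f U)) σ := hint.const_inner d
  have hinng : Integrable (fun U => inner ℝ g (f U)) σ := hint.const_inner g
  have hpt : ∀ᵐ U ∂σ, M.potential μ (X - η • f U) ≤ ENNReal.ofReal
      (M.lagrForm μ X - M.lagrMin μ - η * inner ℝ d (f U) + β₀ * η ^ 2 / 2 * ‖f U‖ ^ 2) ∧
      0 ≤ M.lagrForm μ X - M.lagrMin μ - η * inner ℝ d (f U) + β₀ * η ^ 2 / 2 * ‖f U‖ ^ 2 := by
    filter_upwards [hstep] with U hU
    have hn : ‖X - η • f U - X‖ = η * ‖f U‖ := by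
      rw [sub_sub_cancel_left, norm_neg, norm_smul, Real.norm_eq_abs, abs_of_pos hη]
    have hnγ : ‖X - η • f U - X‖ ≤ γ₀ := by rw [hn]; exact hU
    have hmem := (h X hX _ hnγ).1
    have hdesc := le_of_norm_gradient_sub_le (f := M.lagrForm μ) (x := X) (y := X - η • f U)
      (β := β₀)
      (fun z hz => (contDiffAt_lagrForm μ (h X hX z (hz.trans hnγ)).1).differentiableAt (by simp))
      (fun z hz => (h X hX z (hz.trans hnγ)).2.2)
    rw [hn, sub_sub_cancel_left, inner_neg_right, inner_smul_right, ← hd] at hdesc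
    have hle := lagrMin_le hM hμ hmem
    rw [potential_eq hmem]
    constructor
    · refine ENNReal.ofReal_le_ofReal ?_
      nlinarith
    · nlinarith
  refine (lintegral_mono_ae (hpt.mono fun U hU => hU.1)).trans ?_
  have i1 : Integrable (fun U => M.lagrForm μ X - M.lagrMin μ - η * inner ℝ d (f U)) σ :=
    (integrable_const _).sub (hinn.const_mul η)
  have i3 : Integrable (fun U => M.lagrForm μ X - M.lagrMin μ - η * inner ℝ d (f U) +
      β₀ * η ^ 2 / 2 * ‖f U‖ ^ 2) σ := i1.add (hsq.const_mul _)
  rw [← ofReal_integral_eq_lintegral_ofReal i3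
    (hpt.mono fun U hU => hU.2)]
  refine ENNReal.ofReal_le_ofReal ?_
  have e1 : ∫ U, (M.lagrForm μ X - M.lagrMin μ - η * inner ℝ d (f U) +
      β₀ * η ^ 2 / 2 * ‖f U‖ ^ 2) ∂σ = M.lagrForm μ X - M.lagrMin μ - η * inner ℝ d g +
      β₀ * η ^ 2 / 2 * ∫ U, ‖f U‖ ^ 2 ∂σ := by
    rw [integral_add i1 (hsq.const_mul _), integral_sub (integrable_const _) (hinn.const_mul η),
      integral_const_mul, integral_const_mul, integral_inner hint, integral_const]
    simp [hg]
  -- The second moment of the estimate splits into its variance and the square of its mean.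
  have e2 : ∫ U, ‖f U - g‖ ^ 2 ∂σ = ∫ U, ‖f U‖ ^ 2 ∂σ - ‖g‖ ^ 2 := by
    have e3 : ∀ U, ‖f U - g‖ ^ 2 = ‖f U‖ ^ 2 - 2 * inner ℝ g (f U) + ‖g‖ ^ 2 := fun U => by
      rw [norm_sub_sq_real, real_inner_comm]
    have i2 : Integrable (fun U => ‖f U‖ ^ 2 - 2 * inner ℝ g (f U)) σ :=
      hsq.sub (hinng.const_mul 2)
    simp only [e3]
    rw [integral_add i2 (integrable_const _), integral_sub hsq (hinng.const_mul 2),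
      integral_const_mul, integral_inner hint, integral_const, ← hg, real_inner_self_eq_norm_sq]
    simp
    ring
  change ∫ U, (M.lagrForm μ X - M.lagrMin μ - η * inner ℝ d (f U) +
      β₀ * η ^ 2 / 2 * ‖f U‖ ^ 2) ∂σ ≤ _
  rw [e1]
  have hdX := hdom.2 X hX
  rw [lagr_eq hM hX.1, gradient_lagr hM hX.1, ← hd] at hdX
  set v := ∫ U, ‖f U - g‖ ^ 2 ∂σ with hv
  have e4 : ∫ U, ‖f U‖ ^ 2 ∂σ = v + ‖g‖ ^ 2 := by rw [e2]; ring
  rw [e4]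
  set D := M.lagrForm μ X - M.lagrMin μ with hD
  -- Polarization trades -η⟨d, g⟩ for the squared bias minus ‖g‖² and ‖d‖². Since β₀η ≤ 1/2 the
  -- second-order term in ‖g‖² is absorbed, and -(η/2)‖d‖² gives the contraction by dominance.
  -- Variance and bias contribute ε/240 and ε/120, together ε/80.
  have hin : ‖g - d‖ ^ 2 = ‖g‖ ^ 2 - 2 * inner ℝ d g + ‖d‖ ^ 2 := by
    rw [norm_sub_sq_real, real_inner_comm]
  have hb2 : ‖g - d‖ ^ 2 ≤ (β₀ * r) ^ 2 := pow_le_pow_left₀ (norm_nonneg _) hbias' 2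
  have k1 : β₀ * η ^ 2 / 2 * ‖g‖ ^ 2 ≤ η / 4 * ‖g‖ ^ 2 := by
    refine mul_le_mul_of_nonneg_right ?_ (sq_nonneg _)
    nlinarith
  have k2 : β₀ * η ^ 2 / 2 * v ≤ η / (2 * lam₀) * (ε / 240) := by
    have : β₀ * η ^ 2 / 2 * v = η / (2 * lam₀) * ((240 * lam₀ * β₀ * η * v) / 240) := by
      field_simp
    rw [this]
    gcongr
  have k3 : η / 2 * (β₀ * r) ^ 2 ≤ η / (2 * lam₀) * (ε / 120) := by
    have : η / 2 * (β₀ * r) ^ 2 = η / (2 * lam₀) * ((120 * lam₀ * (β₀ * r) ^ 2) / 120) := by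
      field_simp
    rw [this]
    gcongr
  have k4 : η / (2 * lam₀) * D ≤ η / 2 * ‖d‖ ^ 2 := by
    have : η / 2 * ‖d‖ ^ 2 = η / (2 * lam₀) * (lam₀ * ‖d‖ ^ 2) := by field_simp
    rw [this]
    gcongr
  have k5 : η / 2 * ‖g - d‖ ^ 2 ≤ η / 2 * (β₀ * r) ^ 2 :=
    mul_le_mul_of_nonneg_left hb2 (by positivity)
  have k6 : 0 ≤ η * ‖g‖ ^ 2 := by positivity
  rw [hin] at k5
  have k7 : η / (2 * lam₀) * (ε / 80) = η / (2 * lam₀) * (ε / 240) + η / (2 * lam₀) * (ε / 120) := by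
    ring
  rw [k7]
  nlinarith

end Model

end RCLQR

namespace RCLQR

/-! ### Coupling with the stopped chain and the success probability -/

namespace Model

variable {n m : ℕ} {M : Model n m} {μ ξ₀ β₀ γ₀ r η ε lam₀ : ℝ} {X₀ X : Policy n m}

theorem measurePreserving_drawLaw_fst (hM : M.Standing) :
    MeasurePreserving Prod.fst M.drawLaw (sphereUniform n m) := by
  have := isProbabilityMeasure_pathLaw hM
  exact measurePreserving_fst

theorem isProbabilityMeasure_drawLaw (hM : M.Standing) (hm : 0 < m) :
    IsProbabilityMeasure M.drawLaw := by
  have := isProbabilityMeasure_pathLaw hM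
  have := isProbabilityMeasure_sphereUniform (n := n) hm
  unfold drawLaw
  infer_instance

/-- One step of random search with an exact oracle. -/
noncomputable def searchStep (M : Model n m) (μ η r : ℝ) (X : Policy n m) (d : Draw n m) :
    Policy n m := X - η • M.exactEst μ r X d.1

theorem measurable_searchStep (M : Model n m) (μ η r : ℝ) :
    Measurable fun q : Policy n m × Draw n m => M.searchStep μ η r q.1 q.2 :=
  measurable_fst.sub (((M.measurable_exactEst μ r).comp
    (measurable_fst.prodMk (measurable_fst.comp measurable_snd))).const_smul η)

/-- Random search with an exact oracle, stopped when it leaves the sublevel set. -/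
noncomputable def searchChain (M : Model n m) (μ η r : ℝ) (X₀ : Policy n m) (ds : ℕ → Draw n m)
    (k : ℕ) : Policy n m :=
  chain (stoppedStep (M.searchStep μ η r) (M.potential μ) (ENNReal.ofReal (11 * M.gap₀ μ X₀))) X₀ ds k

/-- Almost surely, the iterates coincide with the stopped chain until it leaves the sublevel
set. -/
theorem LocalBounds.ae_iter_eq (hM : M.Standing) (hμ : 0 ≤ μ) (hm : 0 < m) (hX₀ : X₀ ∈ M.stab)
    (h : M.LocalBounds μ X₀ ξ₀ β₀ γ₀) (hr : 0 < r) (hrγ : r ≤ γ₀) :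
    ∀ᵐ ds ∂M.runLaw, ∀ k, M.searchChain μ η r X₀ ds k ∈ M.sub10 μ X₀ →
      M.iter μ η r X₀ ds (k + 1) = M.searchChain μ η r X₀ ds (k + 1) := by
  have hprob := isProbabilityMeasure_drawLaw hM hm
  have hstep := measurable_stoppedStep (b := ENNReal.ofReal (11 * M.gap₀ μ X₀))
    (M.measurable_searchStep μ η r) (M.measurable_potential μ)
  have hsub : MeasurableSet (M.sub10 μ X₀) := (isCompact_sub10 hM hμ X₀).isClosed.measurableSet
  have hG : MeasurableSet {q : Policy n m × Draw n m | q.1 ∈ M.sub10 μ X₀ →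
      (q.1 + r • (q.2.1 : Policy n m), q.2.2) ∈ M.regularPaths μ} := by
    have hmap : Measurable fun q : Policy n m × Draw n m =>
        (q.1 + r • (q.2.1 : Policy n m), q.2.2) :=
      (measurable_fst.add ((measurable_subtype_coe.comp
        (measurable_fst.comp measurable_snd)).const_smul r)).prodMk
        (measurable_snd.comp measurable_snd)
    exact (measurable_fst hsub).imp (hmap (M.measurableSet_regularPaths μ))
  have hreg : ∀ᵐ ds ∂M.runLaw, ∀ k, M.searchChain μ η r X₀ ds k ∈ M.sub10 μ X₀ →
      (M.searchChain μ η r X₀ ds k + r • ((ds k).1 : Policy n m), (ds k).2) ∈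
        M.regularPaths μ := by
    refine ae_all_iff.mpr fun k => ?_
    have hmk := (measurable_chain (z₀ := X₀) hstep k).prodMk (measurable_pi_apply k)
    -- The stopped state and the next draw have a product law, so regularity can be checked for each
    -- fixed policy in the sublevel set.
    have key : ∀ᵐ q ∂(M.runLaw.map fun ds => (M.searchChain μ η r X₀ ds k, ds k)),
        q.1 ∈ M.sub10 μ X₀ → (q.1 + r • (q.2.1 : Policy n m), q.2.2) ∈ M.regularPaths μ := by
      rw [runLaw]
      unfold searchChain
      rw [map_chain_prod M.drawLaw hstep, Measure.ae_prod_iff_ae_ae hG]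
      refine ae_of_all _ fun X => ?_
      by_cases hX : X ∈ M.sub10 μ X₀
      · filter_upwards [ae_drawLaw_mem_regularPaths hM μ fun _ hU =>
          h.add_smul_mem hr hrγ hX hU] with d hd _
        exact hd
      · exact ae_of_all _ fun d hd => absurd hd hX
    exact ae_of_ae_map hmk.aemeasurable key
  filter_upwards [hreg] with ds hds
  have hnext : ∀ k, M.searchChain μ η r X₀ ds k ∈ M.sub10 μ X₀ →
      M.searchChain μ η r X₀ ds (k + 1) = M.searchChain μ η r X₀ ds k -
        η • M.gradEst μ r (M.searchChain μ η r X₀ ds k) (ds k) := by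
    intro k hk
    rw [gradEst_eq (hds k hk)]
    change stoppedStep _ _ _ (M.searchChain μ η r X₀ ds k) (ds k) = _
    rw [stoppedStep, if_pos ((potential_le_iff_mem_sub10 hM hμ hX₀).mpr hk), searchStep]
  -- A chain that has left is frozen outside. Being inside at time k + 1 therefore means it was
  -- inside at time k, and the induction never meets an irregular step.
  have heq : ∀ k, M.searchChain μ η r X₀ ds k ∈ M.sub10 μ X₀ →
      M.iter μ η r X₀ ds k = M.searchChain μ η r X₀ ds k := by
    intro k
    induction k with
    | zero => exact fun _ => rfl
    | succ k ih =>
      intro hk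
      by_cases hk' : M.searchChain μ η r X₀ ds k ∈ M.sub10 μ X₀
      · rw [hnext k hk', iter, ih hk']
      · have hstay : M.searchChain μ η r X₀ ds (k + 1) = M.searchChain μ η r X₀ ds k := by
          change stoppedStep _ _ _ (M.searchChain μ η r X₀ ds k) (ds k) = _
          rw [stoppedStep, if_neg fun hle =>
            hk' ((potential_le_iff_mem_sub10 hM hμ hX₀).mp hle)]
        rw [hstay] at hk
        exact absurd hk hk'
  intro k hk
  rw [iter, heq k hk, hnext k hk]

theorem LocalBounds.integral_gradEst (hM : M.Standing) (h : M.LocalBounds μ X₀ ξ₀ β₀ γ₀)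
    (hr : 0 < r) (hrγ : r ≤ γ₀) (hX : X ∈ M.sub10 μ X₀) :
    ∫ d, M.gradEst μ r X d ∂M.drawLaw = ∫ U, M.exactEst μ r X U ∂(sphereUniform n m) := by
  rw [integral_congr_ae (h.ae_gradEst hM hr hrγ hX), ← (measurePreserving_drawLaw_fst hM).map_eq,
    integral_map measurable_fst.aemeasurable
      (M.measurable_exactEst_right μ r X).aestronglyMeasurable]

/-- The step-size bound in terms of the variance of the estimate. -/
theorem LocalBounds.variance_le (hM : M.Standing) (hμ : 0 ≤ μ)
    (h : M.LocalBounds μ X₀ ξ₀ β₀ γ₀) (hr : 0 < r) (hrγ : r ≤ γ₀) (hX : X ∈ M.sub10 μ X₀)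
    (hε : 0 < ε) (hη : 0 < η) (hk : 0 ≤ 240 * lam₀ * β₀)
    (hG : ENNReal.ofReal η ≤ ENNReal.ofReal ε /
      (ENNReal.ofReal (240 * lam₀ * β₀) * M.G2 μ r X₀)) :
    240 * lam₀ * β₀ * η * ∫ U, ‖M.exactEst μ r X U -
      ∫ U', M.exactEst μ r X U' ∂(sphereUniform n m)‖ ^ 2 ∂(sphereUniform n m) ≤ ε := by
  set g := ∫ U', M.exactEst μ r X U' ∂(sphereUniform n m) with hg
  have hL2 : MemLp (fun U => M.exactEst μ r X U - g) 2 (sphereUniform n m) :=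
    (h.memLp_exactEst hM hμ hr hrγ hX).sub (memLp_const g)
  have hsq : Integrable (fun U => ‖M.exactEst μ r X U - g‖ ^ 2) (sphereUniform n m) :=
    (memLp_two_iff_integrable_sq_norm hL2.1).mp hL2
  have h1 : ENNReal.ofReal (∫ U, ‖M.exactEst μ r X U - g‖ ^ 2 ∂(sphereUniform n m)) ≤
      M.G2 μ r X₀ := by
    refine le_trans (le_of_eq ?_) (le_iSup₂ (f := fun X (_ : X ∈ M.sub10 μ X₀) =>
      ∫⁻ d, ‖M.gradEst μ r X d - ∫ d', M.gradEst μ r X d' ∂M.drawLaw‖ₑ ^ 2 ∂M.drawLaw) X hX)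
    rw [ofReal_integral_eq_lintegral_ofReal hsq (ae_of_all _ fun U => sq_nonneg _),
      h.integral_gradEst hM hr hrγ hX, ← hg]
    have h2 : ∫⁻ d, ‖M.gradEst μ r X d - g‖ₑ ^ 2 ∂M.drawLaw =
        ∫⁻ d, ‖M.exactEst μ r X d.1 - g‖ₑ ^ 2 ∂M.drawLaw :=
      lintegral_congr_ae ((h.ae_gradEst hM hr hrγ hX).mono fun d hd => by
        dsimp only
        rw [hd])
    have hmeas : Measurable fun U => ‖M.exactEst μ r X U - g‖ₑ ^ 2 :=
      ((M.measurable_exactEst_right μ r X).sub_const g).enorm.pow_const 2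
    rw [h2, (measurePreserving_drawLaw_fst hM).lintegral_comp hmeas]
    refine lintegral_congr fun U => ?_
    rw [ENNReal.ofReal_pow (norm_nonneg _), ofReal_norm]
  have h3 := ENNReal.mul_le_of_le_div hG
  have h4 : ENNReal.ofReal (η * (240 * lam₀ * β₀ *
      ∫ U, ‖M.exactEst μ r X U - g‖ ^ 2 ∂(sphereUniform n m))) ≤ ENNReal.ofReal ε := by
    rw [ENNReal.ofReal_mul hη.le, ENNReal.ofReal_mul hk]
    refine le_trans ?_ h3
    gcongr
  rw [ENNReal.ofReal_le_ofReal_iff hε.le] at h4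
  linarith

/-- The step-size bound in terms of the essential supremum of the estimate. -/
theorem LocalBounds.ae_norm_step_le (hM : M.Standing) (h : M.LocalBounds μ X₀ ξ₀ β₀ γ₀)
    (hr : 0 < r) (hrγ : r ≤ γ₀) (hX : X ∈ M.sub10 μ X₀) (hη : 0 < η)
    (hG : ENNReal.ofReal η ≤ ENNReal.ofReal γ₀ / M.Ginf μ r X₀) :
    ∀ᵐ U ∂(sphereUniform n m), η * ‖M.exactEst μ r X U‖ ≤ γ₀ := by
  have hP := isProbabilityMeasure_pathLaw hM
  have h1 := ENNReal.mul_le_of_le_div hG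
  have h2 : ∀ᵐ d ∂M.drawLaw, η * ‖M.exactEst μ r X d.1‖ ≤ γ₀ := by
    filter_upwards [h.ae_gradEst hM hr hrγ hX, ae_le_essSup (μ := M.drawLaw)
      (f := fun d => ‖M.gradEst μ r X d‖ₑ)]
      with d hd hle
    rw [hd] at hle
    have h3 : ‖M.exactEst μ r X d.1‖ₑ ≤ M.Ginf μ r X₀ := hle.trans
      (le_iSup₂ (f := fun X (_ : X ∈ M.sub10 μ X₀) =>
        essSup (fun d => ‖M.gradEst μ r X d‖ₑ) M.drawLaw) X hX)
    rw [← ENNReal.ofReal_le_ofReal_iff (hr.le.trans hrγ), ENNReal.ofReal_mul hη.le, ofReal_norm]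
    exact (mul_le_mul_right h3 _).trans h1
  filter_upwards [Measure.ae_ae_of_ae_prod h2] with U hU
  simpa using hU

/-- Failure probability of the stopped chain in terms of real parameters. -/
theorem failure_bound_lt {Δ₀ : ℝ} {k : ℕ} (hΔ : 0 < Δ₀) (hε : 0 < ε) (hη : 0 < η) (hlam : 0 < lam₀)
    (ha : η / (2 * lam₀) ≤ 1)
    (hlow : 4 * lam₀ * Real.log (120 * Δ₀ / ε) / η ≤ ((k + 1 : ℕ) : ℝ))
    (hup : ((k + 1 : ℕ) : ℝ) ≤ 100 * lam₀ * Δ₀ / (η * ε) + 1) :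
    (Δ₀ + k * (η / (2 * lam₀) * (ε / 80))) / (11 * Δ₀) +
      ((1 - η / (2 * lam₀)) ^ (k + 1) * Δ₀ + ε / 80) / ε < 1 / 4 := by
  -- Over k = N - 1 steps the drift adds at most 0.625 Δ₀ to the expected gap; Markov at level 11Δ₀
  -- gives 1.625/11.
  have h1 : (Δ₀ + k * (η / (2 * lam₀) * (ε / 80))) / (11 * Δ₀) ≤ 1.625 / 11 := by
    have h2 : (k : ℝ) ≤ 100 * lam₀ * Δ₀ / (η * ε) := by
      push_cast at hup
      linarith
    have h3 : (k : ℝ) * (η / (2 * lam₀) * (ε / 80)) ≤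
        100 * lam₀ * Δ₀ / (η * ε) * (η / (2 * lam₀) * (ε / 80)) :=
      mul_le_mul_of_nonneg_right h2 (by positivity)
    have h4 : 100 * lam₀ * Δ₀ / (η * ε) * (η / (2 * lam₀) * (ε / 80)) = 0.625 * Δ₀ := by
      field_simp
      norm_num
    rw [div_le_iff₀ (by positivity)]
    linarith
  -- With x = 120Δ₀/ε the lower bound on N gives a factor at most x⁻², so the initial gap
  -- contributes at most ε/(120x). When x ≤ 1 the claim is immediate.
  have h5 : (1 - η / (2 * lam₀)) ^ (k + 1) * Δ₀ ≤ ε / 120 := by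
    have hq0 : 0 ≤ 1 - η / (2 * lam₀) := by linarith
    have ha0 : 0 < η / (2 * lam₀) := by positivity
    rcases le_or_gt (120 * Δ₀) ε with hle | hlt
    · have : (1 - η / (2 * lam₀)) ^ (k + 1) ≤ 1 := pow_le_one₀ hq0 (by linarith)
      nlinarith
    · set x := 120 * Δ₀ / ε with hx
      have hx1 : 1 < x := by rwa [hx, one_lt_div hε]
      have h6 : (1 - η / (2 * lam₀)) ^ (k + 1) ≤ Real.exp (-(2 * Real.log x)) := by
        have h7 : 1 - η / (2 * lam₀) ≤ Real.exp (-(η / (2 * lam₀))) := by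
          linarith [Real.add_one_le_exp (-(η / (2 * lam₀)))]
        refine (pow_le_pow_left₀ hq0 h7 _).trans ?_
        rw [← Real.exp_nat_mul]
        refine Real.exp_le_exp.mpr ?_
        rw [mul_neg, neg_le_neg_iff]
        rw [div_le_iff₀ hη] at hlow
        rw [← mul_div_assoc, le_div_iff₀ (by positivity)]
        linarith
      have h8 : Real.exp (-(2 * Real.log x)) = (x ^ 2)⁻¹ := by
        rw [Real.exp_neg, two_mul, Real.exp_add, Real.exp_log (by positivity), pow_two]
      have h9 : Δ₀ = x * ε / 120 := by
        rw [hx]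
        field_simp
      rw [h8] at h6
      refine (mul_le_mul_of_nonneg_right h6 hΔ.le).trans ?_
      rw [h9, inv_mul_le_iff₀ (by positivity)]
      nlinarith [mul_pos hε (by linarith : (0 : ℝ) < x), mul_pos (mul_pos hε
        (by linarith : (0 : ℝ) < x)) (sub_pos.mpr hx1)]
  have h10 : ((1 - η / (2 * lam₀)) ^ (k + 1) * Δ₀ + ε / 80) / ε ≤ 1 / 120 + 1 / 80 := by
    rw [div_le_iff₀ hε]
    linarith
  have h11 : (1.625 / 11 : ℝ) + (1 / 120 + 1 / 80) < 1 / 4 := by norm_num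
  linarith

/-- Random search reaches accuracy `ε` with probability greater than `3 / 4`. -/
theorem LocalBounds.lt_runLaw (hM : M.Standing) (hμ : 0 ≤ μ) (hm : 0 < m) (hX₀ : X₀ ∈ M.stab)
    (hdom : M.GradDominated μ (M.sub10 μ X₀) lam₀)
    (h : M.LocalBounds μ X₀ ξ₀ β₀ γ₀) (hβ : 0 < β₀) (hε : 0 < ε) (hη : 0 < η) (hr : 0 < r)
    (hrγ : r ≤ γ₀) (hgap : 0 < M.gap₀ μ X₀) (hηβ : 2 * β₀ * η ≤ 1)
    (hG2 : ENNReal.ofReal η ≤ ENNReal.ofReal ε /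
      (ENNReal.ofReal (240 * lam₀ * β₀) * M.G2 μ r X₀))
    (hGinf : ENNReal.ofReal η ≤ ENNReal.ofReal γ₀ / M.Ginf μ r X₀)
    (hbias : 120 * lam₀ * (β₀ * r) ^ 2 ≤ ε) {k : ℕ}
    (hlow : 4 * lam₀ * Real.log (120 * M.gap₀ μ X₀ / ε) / η ≤ ((k + 1 : ℕ) : ℝ))
    (hup : ((k + 1 : ℕ) : ℝ) ≤ 100 * lam₀ * M.gap₀ μ X₀ / (η * ε) + 1) :
    3 / 4 < M.runLaw {ds | M.iter μ η r X₀ ds (k + 1) ∈ M.stab ∧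
      M.lagr μ (M.iter μ η r X₀ ds (k + 1)) - M.lagrMin μ ≤ ε} := by
  have hprob := isProbabilityMeasure_drawLaw hM hm
  have hrun : IsProbabilityMeasure M.runLaw := by unfold runLaw; infer_instance
  have hlam := hdom.1
  set Δ₀ := M.gap₀ μ X₀ with hΔ₀
  set a := η / (2 * lam₀) with ha
  have ha0 : 0 < a := by positivity
  -- Smoothness and dominance force 2β₀λ₀ ≥ 1, hence η ≤ 1/(2β₀) ≤ λ₀, and the contraction factor is
  -- nonnegative.
  have ha1 : a ≤ 1 := by
    have h1 := one_le_two_mul_of_gradDominated hM hμ hX₀ hdom h hβ (hr.trans_le hrγ) hgap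
    rw [ha, div_le_one (by positivity)]
    have h2 : 2 * β₀ * η ≤ 2 * β₀ * lam₀ := hηβ.trans h1
    have h3 : η ≤ lam₀ := le_of_mul_le_mul_left h2 (by positivity)
    linarith
  set V := M.potential μ with hV
  have hVX₀ : V X₀ = ENNReal.ofReal Δ₀ := by
    rw [hV, potential_eq hX₀, hΔ₀, gap₀, lagr_eq hM hX₀]
  have hone : ∀ X, V X ≤ ENNReal.ofReal (11 * Δ₀) →
      ∫⁻ d, V (M.searchStep μ η r X d) ∂M.drawLaw ≤
        ENNReal.ofReal (1 - a) * V X + ENNReal.ofReal (a * (ε / 80)) := by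
    intro X hX
    have hXs := (potential_le_iff_mem_sub10 hM hμ hX₀).mp hX
    have hmeas : Measurable fun U => V (X - η • M.exactEst μ r X U) :=
      (M.measurable_potential μ).comp
        (((M.measurable_exactEst_right μ r X).const_smul η).const_sub X)
    have h1 := (measurePreserving_drawLaw_fst hM).lintegral_comp hmeas
    unfold searchStep
    rw [h1]
    refine (h.lintegral_potential_step_le hM hμ hm hdom hβ hr hrγ hη hXs hηβ
      (h.ae_norm_step_le hM hr hrγ hXs hη hGinf)
      (h.variance_le hM hμ hr hrγ hXs hε hη (by positivity) hG2) hbias).trans (le_of_eq ?_)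
    rw [hV, potential_eq hXs.1, ENNReal.ofReal_add
      (mul_nonneg (by linarith) (sub_nonneg.mpr (lagrMin_le hM hμ hXs.1))) (by positivity),
      ENNReal.ofReal_mul (by linarith)]
  have hs : ENNReal.ofReal (1 - a) * ENNReal.ofReal (ε / 80) + ENNReal.ofReal (a * (ε / 80)) ≤
      ENNReal.ofReal (ε / 80) := by
    rw [← ENNReal.ofReal_mul (by linarith), ← ENNReal.ofReal_add
      (mul_nonneg (by linarith) (by positivity)) (by positivity)]
    refine ENNReal.ofReal_le_ofReal (le_of_eq (by ring))
  have hfail := measure_stopped_compl_le (z₀ := X₀) M.drawLaw (M.measurable_searchStep μ η r)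
    (M.measurable_potential μ) (b := ENNReal.ofReal (11 * Δ₀)) (e := ENNReal.ofReal ε)
    (ENNReal.ofReal_le_one.mpr (by linarith)) (by simpa using hgap)
    ENNReal.ofReal_ne_top (by simpa using hε) ENNReal.ofReal_ne_top hone hs k
  have hbound : (V X₀ + k * ENNReal.ofReal (a * (ε / 80))) / ENNReal.ofReal (11 * Δ₀) +
      (ENNReal.ofReal (1 - a) ^ (k + 1) * V X₀ + ENNReal.ofReal (ε / 80)) / ENNReal.ofReal ε <
      ENNReal.ofReal (1 / 4) := by
    have hqk : 0 ≤ (1 - a) ^ (k + 1) := pow_nonneg (by linarith) _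
    rw [hVX₀, ← ENNReal.ofReal_natCast k, ← ENNReal.ofReal_mul (by positivity),
      ← ENNReal.ofReal_add hgap.le (by positivity), ← ENNReal.ofReal_div_of_pos (by positivity),
      ← ENNReal.ofReal_pow (by linarith), ← ENNReal.ofReal_mul hqk,
      ← ENNReal.ofReal_add (mul_nonneg hqk hgap.le) (by positivity),
      ← ENNReal.ofReal_div_of_pos hε, ← ENNReal.ofReal_add (by positivity) (by positivity)]
    exact (ENNReal.ofReal_lt_ofReal_iff (by norm_num)).mpr
      (failure_bound_lt hgap hε hη hlam ha1 hlow hup)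
  set A : Set (ℕ → Draw n m) := {ds | V (M.searchChain μ η r X₀ ds k) ≤ ENNReal.ofReal (11 * Δ₀) ∧
    V (M.searchChain μ η r X₀ ds (k + 1)) ≤ ENNReal.ofReal ε} with hA
  have hAc : M.runLaw Aᶜ < ENNReal.ofReal (1 / 4) := hfail.trans_lt hbound
  have hAle : M.runLaw A ≤ M.runLaw {ds | M.iter μ η r X₀ ds (k + 1) ∈ M.stab ∧
      M.lagr μ (M.iter μ η r X₀ ds (k + 1)) - M.lagrMin μ ≤ ε} := by
    refine measure_mono_ae ?_
    filter_upwards [h.ae_iter_eq (η := η) hM hμ hm hX₀ hr hrγ] with ds hds hdsA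
    obtain ⟨h1, h2⟩ := hdsA
    have h3 := hds k ((potential_le_iff_mem_sub10 hM hμ hX₀).mp h1)
    have h4 := (potential_le_iff hε.le).mp h2
    change M.iter μ η r X₀ ds (k + 1) ∈ M.stab ∧
      M.lagr μ (M.iter μ η r X₀ ds (k + 1)) - M.lagrMin μ ≤ ε
    rw [h3, lagr_eq hM h4.1]
    exact h4
  refine lt_of_lt_of_le ?_ hAle
  by_contra hle
  rw [not_lt] at hle
  -- Subadditivity over the event and its complement; measurability of the event is not required.
  have h5 : (1 : ENNReal) ≤ M.runLaw A + M.runLaw Aᶜ := by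
    have := measure_univ_le_add_compl (μ := M.runLaw) A
    rwa [measure_univ] at this
  have h6 : M.runLaw A + M.runLaw Aᶜ < 3 / 4 + ENNReal.ofReal (1 / 4) :=
    ENNReal.add_lt_add_of_le_of_lt (measure_ne_top _ _) hle hAc
  have h7 : (3 / 4 : ENNReal) + ENNReal.ofReal (1 / 4) = 1 := by
    have : (3 / 4 : ENNReal) = ENNReal.ofReal (3 / 4) := by
      rw [ENNReal.ofReal_div_of_pos (by norm_num)]
      simp
    rw [this, ← ENNReal.ofReal_add (by norm_num) (by norm_num)]
    norm_num
  rw [h7] at h6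
  exact absurd h5 (not_le.mpr h6)

theorem gap₀_eq_zero_of_isEmpty {n : ℕ} {M : Model n 0} (hM : M.Standing) (hμ : 0 ≤ μ)
    {X₀ : Policy n 0} (hX₀ : X₀ ∈ M.stab) : M.gap₀ μ X₀ = 0 := by
  obtain ⟨Y, hY, -, hmin⟩ := exists_isMin hM hμ hX₀
  have : X₀ = Y := by
    ext p
    exact p.1.elim0
  rw [gap₀, hmin, lagr_eq hM hX₀, this, sub_self]

end Model

end RCLQR

theorem theorem5 {n m : ℕ} (M : RCLQR.Model n m) (hM : M.Standing)
    (μ : ℝ) (hμ : 0 ≤ μ)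
    (X₀ : RCLQR.Policy n m) (hX₀ : X₀ ∈ M.stab) :
    -- the constants on the sublevel set exist
    ((∃ lam₀ : ℝ, M.GradDominated μ (M.sub10 μ X₀) lam₀) ∧
      ∃ (ξ β γ : RCLQR.Policy n m → ℝ) (ξ₀ β₀ γ₀ : ℝ),
        M.LocalLipschitz μ ξ β γ ∧ IsLUB (ξ '' M.sub10 μ X₀) ξ₀ ∧
        IsLUB (β '' M.sub10 μ X₀) β₀ ∧ IsGLB (γ '' M.sub10 μ X₀) γ₀ ∧ 0 < γ₀) ∧
    -- for every choice of these constants: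
    ∀ (lam₀ : ℝ) (ξ β γ : RCLQR.Policy n m → ℝ) (ξ₀ β₀ γ₀ : ℝ),
      M.GradDominated μ (M.sub10 μ X₀) lam₀ →
      M.LocalLipschitz μ ξ β γ →
      IsLUB (ξ '' M.sub10 μ X₀) ξ₀ →
      IsLUB (β '' M.sub10 μ X₀) β₀ →
      IsGLB (γ '' M.sub10 μ X₀) γ₀ →
      -- the norm and variance bounds of the gradient estimate are finite
      (∀ r : ℝ, 0 < r → r ≤ γ₀ → M.Ginf μ r X₀ < ⊤ ∧ M.G2 μ r X₀ < ⊤) ∧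
      -- and random search converges
      ∀ (ε η r : ℝ) (N : ℕ), 0 < ε → 0 < η → 0 < r →
        ENNReal.ofReal η ≤
          min (ENNReal.ofReal ε / (ENNReal.ofReal (240 * lam₀ * β₀) * M.G2 μ r X₀))
            (min (ENNReal.ofReal (1 / (2 * β₀))) (ENNReal.ofReal γ₀ / M.Ginf μ r X₀)) →
        r ≤ min (min (1 / (2 * β₀)) (γ₀ / ξ₀) / (8 * lam₀ * β₀) * Real.sqrt (ε / 15))
            (min (1 / (2 * β₀) * Real.sqrt (ε / (30 * lam₀))) γ₀) →
        ε * Real.log (120 * M.gap₀ μ X₀ / ε) < 10 * M.gap₀ μ X₀ / 3 →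
        4 * lam₀ * Real.log (120 * M.gap₀ μ X₀ / ε) / η ≤ (N : ℝ) →
        (N : ℝ) ≤ 100 * lam₀ * M.gap₀ μ X₀ / (η * ε) + 1 →
        3 / 4 < M.runLaw {ds | M.iter μ η r X₀ ds N ∈ M.stab ∧
          M.lagr μ (M.iter μ η r X₀ ds N) - M.lagrMin μ ≤ ε} := by
  refine ⟨⟨RCLQR.Model.exists_gradDominated hM hμ hX₀,
    RCLQR.Model.exists_localLipschitz hM hμ hX₀⟩, ?_⟩
  intro lam₀ ξ β γ ξ₀ β₀ γ₀ hdom hlip hξ hβ hγ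
  obtain ⟨-, hβ0, hloc⟩ := RCLQR.Model.LocalLipschitz.localBounds hM hμ hX₀ hlip hξ hβ hγ
  refine ⟨fun r hr hrγ => hloc.norm_bounds_finite hM hμ hr hrγ, ?_⟩
  intro ε η r N hε hη hr hηle hrle hlog hlow hup
  have hlam := hdom.1
  -- For a zero gap the strict inequality would read 0 < 0, because `Real.log 0` is 0.
  have hgap : 0 < M.gap₀ μ X₀ := by
    refine (RCLQR.Model.gap₀_nonneg hM hμ hX₀).lt_of_ne fun h0 => ?_
    rw [← h0] at hlog
    simp at hlog
  -- With no inputs there is only one policy, so the gap would vanish.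
  have hm : 0 < m := by
    refine Nat.pos_of_ne_zero fun h0 => ?_
    subst h0
    exact hgap.ne' (RCLQR.Model.gap₀_eq_zero_of_isEmpty hM hμ hX₀)
  have hηβ : 2 * β₀ * η ≤ 1 := by
    have h1 := hηle.trans ((min_le_right _ _).trans (min_le_left _ _))
    rw [ENNReal.ofReal_le_ofReal_iff (by positivity), le_div_iff₀ (by positivity)] at h1
    linarith
  have hrγ : r ≤ γ₀ := hrle.trans ((min_le_right _ _).trans (min_le_right _ _))
  have hbias : 120 * lam₀ * (β₀ * r) ^ 2 ≤ ε := by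
    have h1 : r ≤ 1 / (2 * β₀) * Real.sqrt (ε / (30 * lam₀)) :=
      hrle.trans ((min_le_right _ _).trans (min_le_left _ _))
    have h2 : β₀ * r ≤ Real.sqrt (ε / (30 * lam₀)) / 2 := by
      have h3 := mul_le_mul_of_nonneg_left h1 hβ0.le
      refine h3.trans (le_of_eq ?_)
      field_simp
    have h4 := pow_le_pow_left₀ (by positivity) h2 2
    rw [div_pow, Real.sq_sqrt (by positivity)] at h4
    have h5 := mul_le_mul_of_nonneg_left h4 (by positivity : 0 ≤ 120 * lam₀)
    refine h5.trans (le_of_eq ?_)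
    field_simp
    norm_num
  cases N with
  | zero =>
    have hprob := RCLQR.Model.isProbabilityMeasure_drawLaw hM hm
    have hrun : IsProbabilityMeasure M.runLaw := by
      unfold RCLQR.Model.runLaw
      infer_instance
    -- N = 0 is admissible only if the logarithm is not positive, that is 120Δ₀ ≤ ε, so the starting
    -- policy already has the required accuracy.
    have hle : M.gap₀ μ X₀ ≤ ε := by
      by_contra hlt
      rw [not_le] at hlt
      have h1 : 1 < 120 * M.gap₀ μ X₀ / ε := by
        rw [one_lt_div hε]
        linarith
      have h2 : 0 < 4 * lam₀ * Real.log (120 * M.gap₀ μ X₀ / ε) / η := by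
        have := Real.log_pos h1
        positivity
      rw [Nat.cast_zero] at hlow
      linarith
    have huniv : {ds | M.iter μ η r X₀ ds 0 ∈ M.stab ∧
        M.lagr μ (M.iter μ η r X₀ ds 0) - M.lagrMin μ ≤ ε} = Set.univ :=
      Set.eq_univ_of_forall fun ds => ⟨hX₀, hle⟩
    rw [huniv, measure_univ]
    exact ENNReal.div_lt_of_lt_mul (by norm_num)
  | succ k =>
    exact hloc.lt_runLaw hM hμ hm hX₀ hdom hβ0 hε hη hr hrγ hgap hηβ
      (hηle.trans (min_le_left _ _))
      (hηle.trans ((min_le_right _ _).trans (min_le_right _ _))) hbias hlow hup
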